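/- Let $d>1$ and let $\tilde{\mathbb R}=(-\infty,-1]\cup[1,\infty)$ carry the measure $d\mu(r)=|r|^{d-1}\,dr$; $\|\cdot\|_p$ denotes the norm of $L^p(\tilde{\mathbb R},\mu)$ (functions are real-valued). The points $-1$ and $1$ are identified: $C^1(\tilde{\mathbb R})$ consists of the continuously differentiable functions $f$ on $\tilde{\mathbb R}$ (one-sided derivatives at $\pm1$) with $f(-1)=f(1)$ and $f'(-1)=f'(1)$, and $S_0(\tilde{\mathbb R})$ consists of the smooth compactly supported functions $f$ on $\tilde{\mathbb R}$ with $f^{(k)}(-1)=f^{(k)}(1)$ for all $k\ge 0$ and $f(\pm1)=0$. Let $\Delta_d$ be the nonnegative self-adjoint operator on $L^2(\tilde{\mathbb R},\mu)$ associated with the closure of the quadratic form $Q(f,g)=\int_{\tilde{\mathbb R}} f'g'\,d\mu$ defined for $f,g\in C^1(\tilde{\mathbb R})$ with $f,f',g,g'\in L^2(\mu)$, and let $$\Delta_d^{1/2}f=\frac{2}{\pi}\int_0^\infty \Delta_d(\Delta_d+\lambda^2)^{-1}f\,d\lambda$$ be its square root, where the integral is an absolutely convergent $L^2$-valued integral for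 every $f\in S_0(\tilde{\mathbb R})$. Let $p\in(1,\infty)$ if $d\ge 2$, and $p\in(1,d)\cup(d,\infty)$ if $1<d<2$. Then there is a constant $C$, depending only on $d$ and $p$, such that $$\|\Delta_d^{1/2}f\|_p\le C\,\|f'\|_p\qquad\text{for all } f\in S_0(\tilde{\mathbb R}).$$ -/

import Mathlib

open MeasureTheory Set Filter Topology
open scoped ContDiff

noncomputable section

namespace BrokenLine

/-- The broken line `(-∞, -1] ∪ [1, ∞)`. Functions on it are represented by functions `ℝ → ℝ`
whose values off this set are irrelevant. -/
def line : Set ℝ := Iic (-1) ∪ Ici 1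

/-- The measure `|r|^(d-1) dr` on the broken line, as a measure on `ℝ` that vanishes
off the broken line. -/
def mu (d : ℝ) : Measure ℝ :=
  (volume.restrict line).withDensity fun r => ENNReal.ofReal (|r| ^ (d - 1))

/-- The real Hilbert space `L²` of the broken line. -/
abbrev L2 (d : ℝ) : Type := Lp ℝ 2 (mu d)

/-- The derivative on the broken line (one-sided at `-1` and at `1`). -/
def grad (f : ℝ → ℝ) : ℝ → ℝ := derivWithin f line

/-- `C¹` functions on the broken line, with `-1` and `1` identified. -/
structure IsC1 (f : ℝ → ℝ) : Prop where
  contDiffOn : ContDiffOn ℝ 1 f line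
  glue : f (-1) = f 1
  glue_grad : grad f (-1) = grad f 1

/-- Smooth compactly supported functions on the broken line, all of whose derivatives agree
at `-1` and `1`. -/
structure IsTest (f : ℝ → ℝ) : Prop where
  contDiffOn : ContDiffOn ℝ ∞ f line
  compactSupport : ∃ K : Set ℝ, IsCompact K ∧ ∀ r ∈ line, r ∉ K → f r = 0
  glue : ∀ k : ℕ, iteratedDerivWithin k f line (-1) = iteratedDerivWithin k f line 1

/-- The space `S₀`: test functions that vanish at `±1`. -/
structure IsS0 (f : ℝ → ℝ) : Prop extends IsTest f where
  left : f (-1) = 0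
  right : f 1 = 0

theorem isClosed_line : IsClosed line := isClosed_Iic.union isClosed_Ici

theorem uniqueDiffOn_line : UniqueDiffOn ℝ line := by
  rintro x (hx | hx)
  · exact ((uniqueDiffOn_Iic (-1 : ℝ)) x hx).mono subset_union_left
  · exact ((uniqueDiffOn_Ici (1 : ℝ)) x hx).mono subset_union_right

theorem grad_add {f g : ℝ → ℝ} (hf : IsC1 f) (hg : IsC1 g) {r : ℝ} (hr : r ∈ line) :
    grad (f + g) r = grad f r + grad g r :=
  derivWithin_add (hf.contDiffOn.differentiableOn (by simp) r hr)
    (hg.contDiffOn.differentiableOn (by simp) r hr)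

theorem grad_smul {f : ℝ → ℝ} (c : ℝ) (r : ℝ) :
    grad (c • f) r = c * grad f r := by
  simp [grad, derivWithin_const_smul_field]

theorem neg_one_mem : (-1 : ℝ) ∈ line := Or.inl (by simp)

theorem one_mem : (1 : ℝ) ∈ line := Or.inr (by simp)

theorem IsC1.add {f g : ℝ → ℝ} (hf : IsC1 f) (hg : IsC1 g) : IsC1 (f + g) where
  contDiffOn := hf.contDiffOn.add hg.contDiffOn
  glue := by simp [hf.glue, hg.glue]
  glue_grad := by
    rw [grad_add hf hg neg_one_mem, grad_add hf hg one_mem, hf.glue_grad, hg.glue_grad]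

theorem IsC1.smul {f : ℝ → ℝ} (c : ℝ) (hf : IsC1 f) : IsC1 (c • f) where
  contDiffOn := contDiffOn_const.smul hf.contDiffOn
  glue := by simp [hf.glue]
  glue_grad := by rw [grad_smul, grad_smul, hf.glue_grad]

theorem IsC1.zero : IsC1 0 := by
  have h : IsC1 (fun _ => (0 : ℝ)) := ⟨contDiffOn_const, rfl, by simp [grad]⟩
  exact h

theorem ae_mem_line (d : ℝ) : ∀ᵐ r ∂(mu d), r ∈ line :=
  (withDensity_absolutelyContinuous _ _).ae_le (ae_restrict_mem isClosed_line.measurableSet)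

/-- The pairs `(f, f')` in `L² × L²`, for `f` a `C¹` function on the broken line such that `f`
and `f'` are square integrable. -/
def gradGraph (d : ℝ) : Submodule ℝ (WithLp 2 (L2 d × L2 d)) where
  carrier := {x | ∃ f : ℝ → ℝ, IsC1 f ∧ x.fst =ᵐ[mu d] f ∧ x.snd =ᵐ[mu d] grad f}
  zero_mem' := by
    refine ⟨0, IsC1.zero, Lp.coeFn_zero _ _ _, (Lp.coeFn_zero _ _ _).trans ?_⟩
    refine Eventually.of_forall fun r => ?_
    have h : grad (0 : ℝ → ℝ) r = 0 := by
      change derivWithin (fun _ => (0 : ℝ)) line r = 0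
      simp
    simp [h]
  add_mem' := by
    rintro x y ⟨f, hf, h1, h2⟩ ⟨g, hg, h3, h4⟩
    refine ⟨f + g, hf.add hg, (Lp.coeFn_add _ _).trans (h1.add h3), ?_⟩
    refine (Lp.coeFn_add _ _).trans ?_
    filter_upwards [h2, h4, ae_mem_line d] with r a b hr
    simp [a, b, grad_add hf hg hr]
  smul_mem' := by
    rintro c x ⟨f, hf, h1, h2⟩
    refine ⟨c • f, hf.smul c, (Lp.coeFn_smul _ _).trans (h1.const_smul c), ?_⟩
    refine (Lp.coeFn_smul _ _).trans ?_
    filter_upwards [h2] with r a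
    simp [a, grad_smul]

/-- The closure of the quadratic form `Q(f, g) = ∫ f' g' dμ`: its elements are the pairs `(u, u')`
with `u` in the domain of the closed form. -/
def formGraph (d : ℝ) : Submodule ℝ (WithLp 2 (L2 d × L2 d)) := (gradGraph d).topologicalClosure

/-- `Δ_d u = h` for the self-adjoint operator `Δ_d` associated with the closed form: `u` lies in the
form domain and `Q(u, v) = ⟨h, v⟩` for all `v` in the form domain. -/
def IsLaplacian (d : ℝ) (u h : L2 d) : Prop :=
  ∃ x ∈ formGraph d, x.fst = u ∧ ∀ y ∈ formGraph d, inner ℝ x.snd y.snd = inner ℝ h y.fst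

theorem existsUnique_resolvent (d l : ℝ) (hl : 0 < l) (g : L2 d) :
    ∃! u : L2 d, IsLaplacian d u (g - l ^ 2 • u) := by
  have hcl : IsClosed (formGraph d : Set (WithLp 2 (L2 d × L2 d))) :=
    (gradGraph d).isClosed_topologicalClosure
  have : CompleteSpace (formGraph d) := hcl.completeSpace_coe
  let P1 : formGraph d →L[ℝ] L2 d :=
    (WithLp.fstL 2 ℝ (L2 d) (L2 d)).comp (formGraph d).subtypeL
  let P2 : formGraph d →L[ℝ] L2 d :=
    (WithLp.sndL 2 ℝ (L2 d) (L2 d)).comp (formGraph d).subtypeL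
  let B : formGraph d →L[ℝ] formGraph d →L[ℝ] ℝ :=
    ((innerSL ℝ).bilinearComp P2 P2) + l ^ 2 • ((innerSL ℝ).bilinearComp P1 P1)
  have hB : ∀ x y : formGraph d,
      B x y = inner ℝ x.1.snd y.1.snd + l ^ 2 * inner ℝ x.1.fst y.1.fst := fun x y => rfl
  have hco : IsCoercive B := by
    refine ⟨min 1 (l ^ 2), by positivity, fun x => ?_⟩
    have hn : ‖x‖ * ‖x‖ = ‖x.1.fst‖ ^ 2 + ‖x.1.snd‖ ^ 2 := by
      rw [← sq]; exact WithLp.prod_norm_sq_eq_of_L2 x.1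
    rw [hB, mul_assoc, hn, real_inner_self_eq_norm_sq, real_inner_self_eq_norm_sq]
    have h1 : min 1 (l ^ 2) ≤ 1 := min_le_left _ _
    have h2 : min 1 (l ^ 2) ≤ l ^ 2 := min_le_right _ _
    nlinarith [sq_nonneg ‖x.1.fst‖, sq_nonneg ‖x.1.snd‖]
  let F : StrongDual ℝ (formGraph d) := (innerSL ℝ g).comp P1
  let z : formGraph d := (InnerProductSpace.toDual ℝ (formGraph d)).symm F
  let x : formGraph d := hco.continuousLinearEquivOfBilin.symm z
  have hx : ∀ y : formGraph d, B x y = inner ℝ g y.1.fst := by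
    intro y
    have h1 := hco.continuousLinearEquivOfBilin_apply x y
    rw [← h1]
    simp only [x, ContinuousLinearEquiv.apply_symm_apply, z]
    rw [InnerProductSpace.toDual_symm_apply]
    rfl
  refine ⟨x.1.fst, ⟨x.1, x.2, rfl, fun y hy => ?_⟩, ?_⟩
  · have := hx ⟨y, hy⟩
    rw [hB] at this
    rw [inner_sub_left, real_inner_smul_left]
    linarith
  · rintro u ⟨y, hy, rfl, hyy⟩
    have e1 := hyy (y - x.1) (sub_mem hy x.2)
    have e2 := hx ⟨y - x.1, sub_mem hy x.2⟩
    rw [hB] at e2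
    simp only [WithLp.sub_fst, WithLp.sub_snd] at e1 e2
    rw [inner_sub_left, real_inner_smul_left] at e1
    have e3 : inner ℝ (y.snd - x.1.snd) (y.snd - x.1.snd)
        + l ^ 2 * inner ℝ (y.fst - x.1.fst) (y.fst - x.1.fst) = 0 := by
      rw [inner_sub_left, inner_sub_left (y.fst) (x.1.fst) (y.fst - x.1.fst)]
      linarith
    rw [real_inner_self_eq_norm_sq, real_inner_self_eq_norm_sq] at e3
    have h5 : 0 < l ^ 2 := by positivity
    have h4 : ‖y.fst - x.1.fst‖ ^ 2 = 0 := by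
      nlinarith [sq_nonneg ‖y.snd - x.1.snd‖, sq_nonneg ‖y.fst - x.1.fst‖]
    exact sub_eq_zero.1 (norm_eq_zero.1 (pow_eq_zero_iff (two_ne_zero) |>.1 h4))

open Classical in
/-- The resolvent `(Δ_d + l²)⁻¹ g` for `l > 0`: the unique `u` with `Δ_d u = g - l² u`. -/
def resolvent (d l : ℝ) (g : L2 d) : L2 d :=
  if hl : 0 < l then (existsUnique_resolvent d l hl g).choose else 0

/-- `Δ_d (Δ_d + l²)⁻¹ u = u - l² (Δ_d + l²)⁻¹ u`. -/
def sqrtIntegrand (d : ℝ) (u : L2 d) (l : ℝ) : L2 d := u - l ^ 2 • resolvent d l u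

/-- Absolute convergence in `L²` of the integral that defines `Δ_d^{1/2} u`. -/
def SqrtConverges (d : ℝ) (u : L2 d) : Prop := IntegrableOn (sqrtIntegrand d u) (Ioi 0)

/-- The square root of the nonnegative self-adjoint operator `Δ_d`, by the resolvent formula
`Δ_d^{1/2} u = (2/π) ∫₀^∞ Δ_d (Δ_d + l²)⁻¹ u dl`, a Bochner integral in `L²` that converges
absolutely for `u` in the domain of `Δ_d`. -/
def sqrtLaplacian (d : ℝ) (u : L2 d) : L2 d :=
  (2 / Real.pi) • ∫ l in Ioi (0 : ℝ), sqrtIntegrand d u l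

theorem IsTest.memLp {f : ℝ → ℝ} (hf : IsTest f) (d : ℝ) : MemLp f 2 (mu d) := by
  obtain ⟨K, hK, h0⟩ := hf.compactSupport
  have hc : IsCompact (K ∩ line) := hK.inter_right isClosed_line
  have hcont : ContinuousOn f line := hf.contDiffOn.continuousOn
  obtain ⟨M, hM⟩ := hc.exists_bound_of_continuousOn (hcont.mono inter_subset_right)
  have hdens : ContinuousOn (fun r : ℝ => |r| ^ (d - 1)) (K ∩ line) := by
    refine ContinuousOn.rpow_const continuous_abs.continuousOn ?_
    rintro r ⟨-, hr | hr⟩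
    · exact Or.inl (abs_ne_zero.2 (by simp only [mem_Iic] at hr; linarith))
    · exact Or.inl (abs_ne_zero.2 (by simp only [mem_Ici] at hr; linarith))
  have hmeas : AEStronglyMeasurable f (mu d) :=
    (hcont.aestronglyMeasurable isClosed_line.measurableSet).mono_ac
      (withDensity_absolutelyContinuous _ _)
  have hfin : mu d (K ∩ line) < ⊤ := by
    obtain ⟨D, hD⟩ := hc.exists_bound_of_continuousOn hdens
    rw [mu, withDensity_apply _ hc.measurableSet]
    calc ∫⁻ r in K ∩ line, ENNReal.ofReal (|r| ^ (d - 1)) ∂(volume.restrict line)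
        ≤ ∫⁻ _ in K ∩ line, ENNReal.ofReal D ∂(volume.restrict line) := by
          refine setLIntegral_mono' hc.measurableSet fun r hr => ?_
          exact ENNReal.ofReal_le_ofReal ((le_abs_self _).trans (hD r hr))
      _ < ⊤ := by
          rw [setLIntegral_const]
          refine ENNReal.mul_lt_top ENNReal.ofReal_lt_top ?_
          exact (Measure.restrict_apply_le _ _).trans_lt hc.measure_lt_top
  have hind : MemLp ((K ∩ line).indicator fun _ => M) 2 (mu d) :=
    memLp_indicator_const 2 hc.measurableSet M (Or.inr hfin.ne)
  refine hind.mono hmeas ?_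
  filter_upwards [ae_mem_line d] with r hr
  by_cases hrK : r ∈ K
  · rw [indicator_of_mem (show r ∈ K ∩ line from ⟨hrK, hr⟩)]
    exact (hM r ⟨hrK, hr⟩).trans (le_abs_self _)
  · rw [h0 r hr hrK]; simp

/-- The class in `L²` of a test function. -/
def IsTest.toL2 {f : ℝ → ℝ} (hf : IsTest f) (d : ℝ) : L2 d := (hf.memLp d).toLp f

end BrokenLine

end

/-! Write φ for f' on the right half-line and ψ for the derivative of the reflected left half of f.
The operators Δ(Δ+l²)⁻¹ are explicit. Let k be the solution of (r^(d-1)v')' = l² r^(d-1)v that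
decays at infinity, and u the solution that continues through the gluing point as the reflection of
a multiple a·k, normalized to Wronskian one. Since f(±1) = 0, f is the primitive of its derivative,
and Δ(Δ+l²)⁻¹f becomes an integral operator applied to φ and ψ (`sqrtIntegrand_eq`). On the same
side its kernel is k(r)t^(d-1)u'(t) for t ≤ r and u(r)t^(d-1)k'(t) for t > r; on opposite sides it
is a·k(r)t^(d-1)k'(t). The theorem is an L^p bound for these kernels integrated in l.

Near the diagonal the same-side kernel is sgn(r-t)e^(-l|r-t|)/2 up to a small error, so its integral
in l is half the Hilbert kernel 1/(r-t) plus an integrable singularity. Conjugation by r^((d-1)/p)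
removes the weight, and M. Riesz' theorem (`hilbert_le`) applies. For t ≥ 2r both integrated kernels
are O(1/t). For t ≤ r/2 they are ±c(r) + O(r⁻¹(t/r)^d), where c(r) is the integral of k(r)/(2k(1))
in l. The errors (`sameInt_error_le`, `crossInt_error_le`) are dominated by a kernel homogeneous of
degree -1, which is bounded for every p > 1 (`lintegral_homogeneous_le`), and by a Stieltjes kernel
1/((r-1)+(t-1)) at the gluing point.

The remaining term c(r)∫_1^(r/2) φ decides the range of p (`tail_le`). In general c(r) is only
O(1/r) for large r. For p > d Hardy's inequality suffices. For p < d one uses that f vanishes at ±1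
and at infinity: φ has integral zero, the integral over (1, r/2] is minus the one over (r/2, ∞), and
the dual Hardy inequality applies. At p = d neither inequality is available. If d ≥ 2, however, k is
convex as a function of log r, which improves c(r) to O(1/(r log r)), and Hardy's inequality in the
variable log r closes the case.

All integrals in l carry a factor e^(-lε), and the bounds are uniform in ε (`halfLine_le`). As ε → 0
the regularized vectors converge in L², and Fatou's lemma carries the L^p bound to the limit. -/

noncomputable section

namespace BrokenLine

/-! ### Moment integrals of Bessel type -/

/-- The measure `(t² - 1)^((d-3)/2) dt` on `(1, ∞)`. -/
def besselMeasure (d : ℝ) : Measure ℝ :=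
  (volume.restrict (Ioi 1)).withDensity fun t => ENNReal.ofReal ((t ^ 2 - 1) ^ ((d - 3) / 2))

/-- The moments `∫ tⁿ e^(-zt) (t² - 1)^((d-3)/2) dt` over `(1, ∞)`. -/
def besselMoment (d : ℝ) (n : ℕ) (z : ℝ) : ℝ :=
  ∫ t, t ^ n * Real.exp (-z * t) ∂(besselMeasure d)

theorem integrable_besselMeasure_iff (d : ℝ) {g : ℝ → ℝ} :
    Integrable g (besselMeasure d) ↔
      IntegrableOn (fun t => g t * (t ^ 2 - 1) ^ ((d - 3) / 2)) (Ioi 1) := by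
  rw [besselMeasure, integrable_withDensity_iff (by fun_prop) (by simp), IntegrableOn]
  refine integrable_congr ?_
  filter_upwards [ae_restrict_mem measurableSet_Ioi] with t ht
  rw [ENNReal.toReal_ofReal]
  exact Real.rpow_nonneg (by nlinarith [mem_Ioi.1 ht]) _

theorem integral_besselMeasure (d : ℝ) (g : ℝ → ℝ) :
    ∫ t, g t ∂(besselMeasure d) = ∫ t in Ioi 1, g t * (t ^ 2 - 1) ^ ((d - 3) / 2) := by
  rw [besselMeasure, integral_withDensity_eq_integral_toReal_smul (by fun_prop) (by simp)]
  refine setIntegral_congr_fun measurableSet_Ioi fun t ht => ?_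
  simp only [smul_eq_mul]
  rw [ENNReal.toReal_ofReal, mul_comm]
  exact Real.rpow_nonneg (by nlinarith [mem_Ioi.1 ht]) _

theorem rpow_add_one_le_exp (s z : ℝ) (hz : 0 < z) :
    ∃ C : ℝ, ∀ t : ℝ, 0 ≤ t → (t + 1) ^ s ≤ C * Real.exp (z * t) := by
  rcases le_or_gt s 0 with hs | hs
  · refine ⟨1, fun t ht => ?_⟩
    rw [one_mul]
    exact (Real.rpow_le_one_of_one_le_of_nonpos (by linarith) hs).trans
      (Real.one_le_exp (by positivity))
  · refine ⟨(s / z) ^ s * Real.exp z, fun t ht => ?_⟩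
    have h1 : t + 1 ≤ (s / z) * Real.exp (z / s * (t + 1)) := by
      have := Real.add_one_le_exp (z / s * (t + 1))
      calc t + 1 = (s / z) * (z / s * (t + 1)) := by field_simp
        _ ≤ _ := by gcongr; linarith
    calc (t + 1) ^ s ≤ ((s / z) * Real.exp (z / s * (t + 1))) ^ s := by gcongr
      _ = (s / z) ^ s * Real.exp (z / s * (t + 1) * s) := by
        rw [Real.mul_rpow (by positivity) (by positivity), ← Real.exp_mul]
      _ = _ := by
        rw [mul_assoc ((s / z) ^ s), ← Real.exp_add]; congr 2; field_simp; ring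

theorem integrable_exp_besselMeasure {d : ℝ} (hd : 1 < d) {z : ℝ} (hz : 0 < z) :
    Integrable (fun t => Real.exp (-z * t)) (besselMeasure d) := by
  rw [integrable_besselMeasure_iff]
  set s := (d - 3) / 2 with hs
  have hs1 : -1 < s := by rw [hs]; linarith
  -- Half of the exponential rate absorbs the factor (t+1)^s; the other half integrates (t-1)^s,
  -- whose singularity at 1 is harmless because d > 1 means s > -1.
  obtain ⟨C, hC⟩ := rpow_add_one_le_exp s (z / 2) (by positivity)
  have h0 := integrableOn_rpow_mul_exp_neg_mul_rpow hs1 (one_pos (α := ℝ)) (half_pos hz)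
  have h1 : IntegrableOn (fun t : ℝ => (t - 1) ^ s * Real.exp (-(z / 2) * (t - 1) ^ (1:ℝ)))
      (Ioi 1) := by
    have := (measurePreserving_sub_right volume (1:ℝ)).integrableOn_comp_preimage
      (MeasurableEquiv.subRight (1:ℝ)).measurableEmbedding (s := Ioi 0)
      (f := fun x : ℝ => x ^ s * Real.exp (-(z / 2) * x ^ (1:ℝ)))
    have e : (fun x : ℝ => x - 1) ⁻¹' Ioi 0 = Ioi 1 := by ext; simp
    rw [e] at this
    exact this.2 h0
  refine (h1.const_mul (C * Real.exp (-(z / 2)))).mono' (by fun_prop) ?_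
  filter_upwards [ae_restrict_mem measurableSet_Ioi] with t ht
  have ht' : 1 < t := ht
  have e1 : (t ^ 2 - 1) ^ s = (t - 1) ^ s * (t + 1) ^ s := by
    rw [← Real.mul_rpow (by linarith) (by linarith)]; congr 1; ring
  have e2 : 0 ≤ (t - 1) ^ s := Real.rpow_nonneg (by linarith) _
  have e3 : 0 ≤ (t + 1) ^ s := Real.rpow_nonneg (by linarith) _
  rw [e1, Real.norm_of_nonneg (by positivity), Real.rpow_one]
  calc Real.exp (-z * t) * ((t - 1) ^ s * (t + 1) ^ s)
      ≤ Real.exp (-z * t) * ((t - 1) ^ s * (C * Real.exp (z / 2 * t))) := by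
        gcongr; exact hC t (by linarith)
    _ = C * (t - 1) ^ s * (Real.exp (-z * t) * Real.exp (z / 2 * t)) := by ring
    _ = C * (t - 1) ^ s * (Real.exp (-(z / 2)) * Real.exp (-(z / 2) * (t - 1))) := by
        rw [← Real.exp_add, ← Real.exp_add]; congr 2; ring
    _ = _ := by ring

/-- The moments are derivatives of the moment generating function of `besselMeasure d` at -z.
Interiority yields both their finiteness and differentiation under the integral sign. -/
theorem mem_interior_integrableExpSet {d : ℝ} (hd : 1 < d) {z : ℝ} (hz : 0 < z) :
    -z ∈ interior (ProbabilityTheory.integrableExpSet id (besselMeasure d)) := by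
  refine mem_interior.2 ⟨Iio 0, fun x hx => ?_, isOpen_Iio, by simpa using hz⟩
  have := integrable_exp_besselMeasure hd (z := -x) (by simpa using hx)
  simpa [ProbabilityTheory.integrableExpSet] using this

theorem integrable_besselMoment {d : ℝ} (hd : 1 < d) (n : ℕ) {z : ℝ} (hz : 0 < z) :
    Integrable (fun t => t ^ n * Real.exp (-z * t)) (besselMeasure d) :=
  ProbabilityTheory.integrable_pow_mul_exp_of_mem_interior_integrableExpSet
    (mem_interior_integrableExpSet hd hz) n

theorem hasDerivAt_besselMoment {d : ℝ} (hd : 1 < d) (n : ℕ) {z : ℝ} (hz : 0 < z) :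
    HasDerivAt (besselMoment d n) (-besselMoment d (n + 1) z) z := by
  have h := ProbabilityTheory.hasDerivAt_integral_pow_mul_exp_real
    (mem_interior_integrableExpSet hd hz) n
  have := HasDerivAt.comp z h (hasDerivAt_neg z)
  simp only [id, mul_neg, mul_one] at this
  exact this

theorem besselMeasure_ae {d : ℝ} : ∀ᵐ t ∂(besselMeasure d), 1 < t :=
  (withDensity_absolutelyContinuous _ _).ae_le (ae_restrict_mem measurableSet_Ioi)

/-- Holds because the measure lives on t > 1. For n = 0 and n = 1 it becomes k' ≤ -l·k and the
exponential decay of k'. -/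
theorem besselMoment_le_succ {d : ℝ} (hd : 1 < d) (n : ℕ) {z : ℝ} (hz : 0 < z) :
    besselMoment d n z ≤ besselMoment d (n + 1) z := by
  refine integral_mono_ae (integrable_besselMoment hd n hz)
    (integrable_besselMoment hd (n + 1) hz) ?_
  filter_upwards [besselMeasure_ae] with t ht
  gcongr
  · exact ht.le
  · simp

theorem besselMoment_zero_pos {d : ℝ} (hd : 1 < d) {z : ℝ} (hz : 0 < z) :
    0 < besselMoment d 0 z := by
  have h1 := integrable_besselMoment hd 0 hz
  rw [besselMoment, integral_besselMeasure]
  rw [integrable_besselMeasure_iff] at h1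
  rw [setIntegral_pos_iff_support_of_nonneg_ae _ h1]
  · have : Ioi (1:ℝ) ⊆ Function.support
        (fun t : ℝ => t ^ 0 * Real.exp (-z * t) * (t ^ 2 - 1) ^ ((d - 3) / 2)) := by
      intro t ht
      have : (0:ℝ) < t ^ 2 - 1 := by nlinarith [mem_Ioi.1 ht]
      simp only [Function.mem_support]; positivity
    rw [inter_eq_self_of_subset_right this]; simp
  · filter_upwards [ae_restrict_mem measurableSet_Ioi] with t ht
    have : (0:ℝ) < t ^ 2 - 1 := by nlinarith [mem_Ioi.1 ht]
    simp only [Pi.zero_apply]; positivity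

/-- Integrate the derivative of e^(-zt)(t²-1)^((d-1)/2) over (1, ∞); both boundary terms vanish, the
one at 1 because d > 1. As each moment is minus the derivative of the preceding one, this is κ'' +
((d-1)/z)κ' = κ for κ = `besselMoment d 0`. -/
theorem besselMoment_ode {d : ℝ} (hd : 1 < d) {z : ℝ} (hz : 0 < z) :
    besselMoment d 2 z = besselMoment d 0 z + (d - 1) / z * besselMoment d 1 z := by
  set s := (d - 3) / 2 with hs
  have i0 := integrable_besselMoment hd 0 hz
  have i1 := integrable_besselMoment hd 1 hz
  have i2 := integrable_besselMoment hd 2 hz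
  have key : ∫ t, (-z * (t ^ 2 * Real.exp (-z * t) - t ^ 0 * Real.exp (-z * t))
      + (d - 1) * (t ^ 1 * Real.exp (-z * t))) ∂(besselMeasure d) = 0 := by
    have hintg := (((i2.sub i0).const_mul (-z)).add (i1.const_mul (d - 1)))
    have hintg2 := i2.sub i0
    rw [integrable_besselMeasure_iff] at hintg hintg2
    rw [integral_besselMeasure]
    have hder : ∀ t ∈ Ioi (1:ℝ), HasDerivAt (fun t : ℝ => Real.exp (-z * t) * (t ^ 2 - 1) ^ (s + 1))
        ((-z * (t ^ 2 * Real.exp (-z * t) - t ^ 0 * Real.exp (-z * t))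
          + (d - 1) * (t ^ 1 * Real.exp (-z * t))) * (t ^ 2 - 1) ^ s) t := by
      intro t ht
      have hpos : (0:ℝ) < t ^ 2 - 1 := by nlinarith [mem_Ioi.1 ht]
      have h1 : HasDerivAt (fun t : ℝ => Real.exp (-z * t)) (Real.exp (-z * t) * (-z)) t := by
        simpa using ((hasDerivAt_id t).const_mul (-z)).exp
      have h2 : HasDerivAt (fun t : ℝ => (t ^ 2 - 1) ^ (s + 1))
          ((2 * t) * (s + 1) * (t ^ 2 - 1) ^ (s + 1 - 1)) t := by
        have : HasDerivAt (fun t : ℝ => t ^ 2 - 1) (2 * t) t := by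
          simpa using (hasDerivAt_pow 2 t).sub_const 1
        exact this.rpow_const (Or.inl hpos.ne')
      refine (h1.mul h2).congr_deriv ?_
      rw [Real.rpow_add_one hpos.ne', add_sub_cancel_right, hs]
      ring
    have e : ∀ t ∈ Ioi (1:ℝ), Real.exp (-z * t) * (t ^ 2 - 1) ^ (s + 1) =
        ((fun t => t ^ 2 * Real.exp (-z * t)) - fun t => t ^ 0 * Real.exp (-z * t)) t *
          (t ^ 2 - 1) ^ s := by
      intro t ht
      have hpos : (0:ℝ) < t ^ 2 - 1 := by nlinarith [mem_Ioi.1 ht]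
      rw [Real.rpow_add_one hpos.ne']; simp; ring
    have hI : IntegrableOn (fun t : ℝ => Real.exp (-z * t) * (t ^ 2 - 1) ^ (s + 1)) (Ioi 1) :=
      hintg2.congr_fun (fun t ht => (e t ht).symm) measurableSet_Ioi
    have hlim := tendsto_zero_of_hasDerivAt_of_integrableOn_Ioi hder hintg hI
    have hcont : ContinuousWithinAt (fun t : ℝ => Real.exp (-z * t) * (t ^ 2 - 1) ^ (s + 1))
        (Ici 1) 1 := by
      refine ContinuousAt.continuousWithinAt (ContinuousAt.mul (by fun_prop) ?_)
      exact ContinuousAt.rpow_const (by fun_prop) (Or.inr (by rw [hs]; linarith))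
    have := integral_Ioi_of_hasDerivAt_of_tendsto hcont hder hintg hlim
    refine this.trans ?_
    rw [one_pow, sub_self, Real.zero_rpow (by rw [hs]; linarith)]; simp
  have i3 : Integrable (fun t => -z * (t ^ 2 * Real.exp (-z * t) - t ^ 0 * Real.exp (-z * t)))
      (besselMeasure d) := (i2.sub i0).const_mul _
  rw [integral_add i3 (i1.const_mul _), integral_const_mul,
    integral_const_mul, integral_sub i2 i0] at key
  change -z * (besselMoment d 2 z - besselMoment d 0 z) + (d - 1) * besselMoment d 1 z = 0 at key
  field_simp
  linarith

/-! ### The decaying and the growing solution: logarithmic derivatives and exponential bounds -/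

theorem monotoneOn_of_hasDerivAt_nonneg {s : Set ℝ} (hs : Convex ℝ s) {f f' : ℝ → ℝ}
    (h : ∀ x ∈ s, HasDerivAt f (f' x) x) (h0 : ∀ x ∈ s, 0 ≤ f' x) : MonotoneOn f s :=
  monotoneOn_of_deriv_nonneg hs (fun x hx => (h x hx).continuousAt.continuousWithinAt)
    (fun x hx => (h x (interior_subset hx)).differentiableAt.differentiableWithinAt)
    fun x hx => by rw [(h x (interior_subset hx)).deriv]; exact h0 x (interior_subset hx)

theorem antitoneOn_of_hasDerivAt_nonpos {s : Set ℝ} (hs : Convex ℝ s) {f f' : ℝ → ℝ}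
    (h : ∀ x ∈ s, HasDerivAt f (f' x) x) (h0 : ∀ x ∈ s, f' x ≤ 0) : AntitoneOn f s :=
  antitoneOn_of_deriv_nonpos hs (fun x hx => (h x hx).continuousAt.continuousWithinAt)
    (fun x hx => (h x (interior_subset hx)).differentiableAt.differentiableWithinAt)
    fun x hx => by rw [(h x (interior_subset hx)).deriv]; exact h0 x (interior_subset hx)

/-- A decaying solution `k` and a growing solution `u` of `(r^(d-1) v')' = l² r^(d-1) v` with
Wronskian one, such that `u` continues across the gluing point as `a k`. -/
structure SolutionPair (d l a : ℝ) (k k₁ u u₁ : ℝ → ℝ) : Prop where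
  pos : ∀ r, 0 < r → 0 < k r
  deriv_le : ∀ r, 0 < r → k₁ r ≤ -(l * k r)
  decay : ∀ ρ t, 0 < ρ → ρ ≤ t → -k₁ t ≤ -k₁ ρ * Real.exp (-(l * (t - ρ)))
  hasDerivAt_k : ∀ r, 0 < r → HasDerivAt k (k₁ r) r
  hasDerivAt_k₁ : ∀ r, 0 < r →
    HasDerivAt (fun r => r ^ (d - 1) * k₁ r) (l ^ 2 * (r ^ (d - 1) * k r)) r
  hasDerivAt_u : ∀ r, 0 < r → HasDerivAt u (u₁ r) r
  hasDerivAt_u₁ : ∀ r, 0 < r →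
    HasDerivAt (fun r => r ^ (d - 1) * u₁ r) (l ^ 2 * (r ^ (d - 1) * u r)) r
  wronskian : ∀ r, 0 < r → r ^ (d - 1) * (k r * u₁ r - u r * k₁ r) = 1
  glue : u 1 = a * k 1
  glue_deriv : u₁ 1 = -(a * k₁ 1)
  le_u : ∀ r, 1 ≤ r → a * k r ≤ u r

theorem hasDerivAt_weight (d : ℝ) {r : ℝ} (hr : 0 < r) :
    HasDerivAt (fun r : ℝ => r ^ (d - 1)) ((d - 1) * r ^ (d - 1) / r) r := by
  refine (Real.hasDerivAt_rpow_const (Or.inl hr.ne')).congr_deriv ?_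
  rw [Real.rpow_sub_one hr.ne']; ring

namespace SolutionPair

variable {d l a : ℝ} {k k₁ u u₁ : ℝ → ℝ}

theorem k₁_neg (S : SolutionPair d l a k k₁ u u₁) (hl : 0 < l) {r : ℝ} (hr : 0 < r) :
    k₁ r < 0 := by
  have := S.deriv_le r hr
  have := mul_pos hl (S.pos r hr)
  linarith

/-- The Wronskian at the gluing point: by the two gluing conditions both of its terms equal
a·k(1)·(-k₁(1)). -/
theorem a_mul (S : SolutionPair d l a k k₁ u u₁) : a * (k 1 * -k₁ 1) = 1 / 2 := by
  have := S.wronskian 1 one_pos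
  rw [S.glue, S.glue_deriv, Real.one_rpow] at this
  linarith

theorem a_pos (S : SolutionPair d l a k k₁ u u₁) (hl : 0 < l) : 0 < a := by
  have h1 := S.a_mul
  have h2 : 0 < k 1 * -k₁ 1 := mul_pos (S.pos 1 one_pos) (by linarith [S.k₁_neg hl one_pos])
  by_contra h
  nlinarith [mul_nonneg (sub_nonneg.2 (not_lt.1 h)) h2.le]

theorem u_pos (S : SolutionPair d l a k k₁ u u₁) (hl : 0 < l) {r : ℝ} (hr : 1 ≤ r) : 0 < u r :=
  (mul_pos (S.a_pos hl) (S.pos r (by linarith))).trans_le (S.le_u r hr)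

theorem u₁_one_pos (S : SolutionPair d l a k k₁ u u₁) (hl : 0 < l) : 0 < u₁ 1 := by
  rw [S.glue_deriv]
  have := mul_pos (S.a_pos hl) (neg_pos.2 (S.k₁_neg hl one_pos))
  linarith

theorem monotoneOn_wu₁ (S : SolutionPair d l a k k₁ u u₁) (hl : 0 < l) :
    MonotoneOn (fun r => r ^ (d - 1) * u₁ r) (Ici 1) := by
  refine monotoneOn_of_hasDerivAt_nonneg (convex_Ici 1)
    (fun r hr => S.hasDerivAt_u₁ r (one_pos.trans_le hr)) fun r hr => ?_
  have h1 := S.u_pos hl hr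
  have h2 : 0 < r := one_pos.trans_le hr
  positivity

theorem monotoneOn_wk₁ (S : SolutionPair d l a k k₁ u u₁) :
    MonotoneOn (fun r => r ^ (d - 1) * k₁ r) (Ioi 0) := by
  refine monotoneOn_of_hasDerivAt_nonneg (convex_Ioi 0)
    (fun r hr => S.hasDerivAt_k₁ r hr) fun r hr => ?_
  have h1 := S.pos r hr
  have h2 : 0 < r := hr
  positivity

theorem u₁_pos (S : SolutionPair d l a k k₁ u u₁) (hl : 0 < l) {r : ℝ} (hr : 1 ≤ r) :
    0 < u₁ r := by
  have h := S.monotoneOn_wu₁ hl (mem_Ici.2 le_rfl) (mem_Ici.2 hr) hr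
  simp only [Real.one_rpow, one_mul] at h
  have h2 : 0 < r ^ (d - 1) := Real.rpow_pos_of_pos (by linarith) _
  have h3 := (S.u₁_one_pos hl).trans_le h
  exact (mul_pos_iff_of_pos_left h2).1 h3

theorem monotoneOn_u (S : SolutionPair d l a k k₁ u u₁) (hl : 0 < l) :
    MonotoneOn u (Ici 1) :=
  monotoneOn_of_hasDerivAt_nonneg (convex_Ici 1)
    (fun r hr => S.hasDerivAt_u r (one_pos.trans_le hr)) fun _ hr => (S.u₁_pos hl hr).le

/-- A barrier run from infinity. The defect F times the integrating factor e^(-lr)r^(-(d+1)) is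
nondecreasing, and at R it is at most -k₁(1)·e^(-lR), which tends to 0; so F ≤ 0. With the constant
d+1 every term of the derivative is positive. -/
theorem k₁_ge (S : SolutionPair d l a k k₁ u u₁) (hd : 1 < d) (hl : 0 < l) {r : ℝ} (hr : 1 ≤ r) :
    -k₁ r ≤ (l + (d + 1) / r) * k r := by
  set F : ℝ → ℝ := fun r => -(r ^ (d - 1) * k₁ r) - (l + (d + 1) / r) * (r ^ (d - 1) * k r) with hF
  set E : ℝ → ℝ := fun r => F r * (Real.exp (-(l * r)) * r ^ (-(d + 1))) with hE
  have hmono : MonotoneOn E (Ici 1) := by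
    refine monotoneOn_of_hasDerivAt_nonneg (convex_Ici 1) (f' := fun r =>
      (r ^ (d - 1) * k r * (l * (d + 3) / r + 3 * (d + 1) / r ^ 2)) *
        (Real.exp (-(l * r)) * r ^ (-(d + 1)))) ?_ ?_
    · intro r hr
      have h0 : 0 < r := one_pos.trans_le hr
      have e1 := (S.hasDerivAt_k₁ r h0).neg
      have e2 : HasDerivAt (fun r : ℝ => l + (d + 1) / r) (-((d + 1) / r ^ 2)) r := by
        have := ((hasDerivAt_inv h0.ne').const_mul (d + 1)).const_add l
        simpa [div_eq_mul_inv] using this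
      have e3 := (hasDerivAt_weight d h0).mul (S.hasDerivAt_k r h0)
      have e4 : HasDerivAt (fun r : ℝ => Real.exp (-(l * r))) (Real.exp (-(l * r)) * -l) r := by
        simpa using ((hasDerivAt_id r).const_mul l).neg.exp
      have e5 : HasDerivAt (fun r : ℝ => r ^ (-(d + 1))) (-(d + 1) * r ^ (-(d + 1)) / r) r := by
        refine (Real.hasDerivAt_rpow_const (Or.inl h0.ne')).congr_deriv ?_
        rw [Real.rpow_sub_one h0.ne']; ring
      refine ((e1.sub (e2.mul e3)).mul (e4.mul e5)).congr_deriv ?_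
      simp only [Pi.mul_apply, Pi.sub_apply, Pi.neg_apply]
      field_simp
      ring
    · intro r hr
      have h0 : 0 < r := one_pos.trans_le hr
      have := S.pos r h0
      positivity
  have hlim : Tendsto (fun R : ℝ => -k₁ 1 * Real.exp (-(l * R))) atTop (𝓝 0) := by
    have : Tendsto (fun R : ℝ => Real.exp (-(l * R))) atTop (𝓝 0) :=
      Real.tendsto_exp_neg_atTop_nhds_zero.comp (tendsto_id.const_mul_atTop hl)
    simpa using this.const_mul (-k₁ 1)
  have hEr : E r ≤ 0 := by
    refine ge_of_tendsto hlim ?_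
    filter_upwards [eventually_ge_atTop r] with R hR
    have hR1 : 1 ≤ R := hr.trans hR
    have hR0 : 0 < R := by linarith
    refine (hmono (mem_Ici.2 hr) (mem_Ici.2 hR1) hR).trans ?_
    have h1 : F R ≤ -k₁ 1 := by
      have h := S.monotoneOn_wk₁ (mem_Ioi.2 one_pos) (mem_Ioi.2 hR0) hR1
      simp only [Real.one_rpow, one_mul] at h
      have : 0 ≤ (l + (d + 1) / R) * (R ^ (d - 1) * k R) := by
        have := S.pos R hR0
        positivity
      simp only [hF]; linarith
    have h2 : R ^ (-(d + 1)) ≤ 1 := Real.rpow_le_one_of_one_le_of_nonpos hR1 (by linarith)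
    have h3 : 0 < -k₁ 1 := neg_pos.2 (S.k₁_neg hl one_pos)
    have h4 : 0 < R ^ (-(d + 1)) := Real.rpow_pos_of_pos hR0 _
    calc E R ≤ -k₁ 1 * (Real.exp (-(l * R)) * R ^ (-(d + 1))) := by
          simp only [hE]; gcongr
      _ ≤ -k₁ 1 * (Real.exp (-(l * R)) * 1) := by gcongr
      _ = _ := by ring
  have h0 : 0 < r := by linarith
  have hFr : F r ≤ 0 := by
    have : 0 < Real.exp (-(l * r)) * r ^ (-(d + 1)) := by positivity
    by_contra hcon
    have := mul_pos (not_le.1 hcon) this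
    simp only [hE] at hEr
    linarith
  simp only [hF] at hFr
  have hw : 0 < r ^ (d - 1) := by positivity
  refine le_of_mul_le_mul_left ?_ hw
  linarith

/-- The same barrier, run outwards from the gluing point. There u and u₁ are a·k and -a·k₁, so the
initial sign is `k₁_ge` at r = 1. -/
theorem u₁_le (S : SolutionPair d l a k k₁ u u₁) (hd : 1 < d) (hl : 0 < l) {r : ℝ} (hr : 1 ≤ r) :
    u₁ r ≤ (l + (d + 1) / r) * u r := by
  set F : ℝ → ℝ := fun r => r ^ (d - 1) * u₁ r - (l + (d + 1) / r) * (r ^ (d - 1) * u r) with hF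
  set E : ℝ → ℝ := fun r => F r * (Real.exp (l * r) * r ^ (d + 1)) with hE
  have hmono : AntitoneOn E (Ici 1) := by
    refine antitoneOn_of_hasDerivAt_nonpos (convex_Ici 1) (f' := fun r =>
      (-(r ^ (d - 1) * u r * (l * (3 * d + 1) / r + (d + 1) * (2 * d - 1) / r ^ 2))) *
        (Real.exp (l * r) * r ^ (d + 1))) ?_ ?_
    · intro r hr
      have h0 : 0 < r := one_pos.trans_le hr
      have e1 := S.hasDerivAt_u₁ r h0
      have e2 : HasDerivAt (fun r : ℝ => l + (d + 1) / r) (-((d + 1) / r ^ 2)) r := by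
        have := ((hasDerivAt_inv h0.ne').const_mul (d + 1)).const_add l
        simpa [div_eq_mul_inv] using this
      have e3 := (hasDerivAt_weight d h0).mul (S.hasDerivAt_u r h0)
      have e4 : HasDerivAt (fun r : ℝ => Real.exp (l * r)) (Real.exp (l * r) * l) r := by
        simpa using ((hasDerivAt_id r).const_mul l).exp
      have e5 : HasDerivAt (fun r : ℝ => r ^ (d + 1)) ((d + 1) * r ^ (d + 1) / r) r := by
        refine (Real.hasDerivAt_rpow_const (Or.inl h0.ne')).congr_deriv ?_
        rw [Real.rpow_sub_one h0.ne']; ring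
      refine ((e1.sub (e2.mul e3)).mul (e4.mul e5)).congr_deriv ?_
      simp only [Pi.mul_apply, Pi.sub_apply]
      field_simp
      ring
    · intro r hr
      have h0 : 0 < r := one_pos.trans_le hr
      have := S.u_pos hl hr
      have h3 : 0 < 2 * d - 1 := by linarith
      have : 0 ≤ (r ^ (d - 1) * u r * (l * (3 * d + 1) / r + (d + 1) * (2 * d - 1) / r ^ 2)) *
        (Real.exp (l * r) * r ^ (d + 1)) := by positivity
      linarith
  have hEr : E r ≤ 0 := by
    refine (hmono (mem_Ici.2 le_rfl) (mem_Ici.2 hr) hr).trans ?_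
    have h1 := S.k₁_ge hd hl le_rfl
    have h2 : F 1 ≤ 0 := by
      simp only [hF, Real.one_rpow, one_mul, S.glue, S.glue_deriv]
      nlinarith [S.a_pos hl]
    exact mul_nonpos_of_nonpos_of_nonneg h2 (by positivity)
  have h0 : 0 < r := by linarith
  have hFr : F r ≤ 0 := by
    have : 0 < Real.exp (l * r) * r ^ (d + 1) := by positivity
    by_contra hcon
    have := mul_pos (not_le.1 hcon) this
    simp only [hE] at hEr
    linarith
  simp only [hF] at hFr
  have hw : 0 < r ^ (d - 1) := by positivity
  refine le_of_mul_le_mul_left ?_ hw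
  linarith

theorem le_u₁ (S : SolutionPair d l a k k₁ u u₁) (hd : 1 < d) (hl : 0 < l) {r : ℝ} (hr : 1 ≤ r) :
    (l - (d + 1) / r) * u r ≤ u₁ r := by
  have h0 : 0 < r := by linarith
  rcases le_or_gt (l * r) (d + 1) with hlr | hlr
  · have h1 : l - (d + 1) / r ≤ 0 := by rw [sub_nonpos, le_div_iff₀ h0]; exact hlr
    exact (mul_nonpos_of_nonpos_of_nonneg h1 (S.u_pos hl hr).le).trans (S.u₁_pos hl hr).le
  -- The derivative of E has the sign of l·r·(d+3) - 3(d+1), which is nonnegative once l·r ≥ d+1;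
  -- hence the barrier starts at b. Initially F(b) ≥ 0: either b = 1, where gluing and k₁ ≤ -l·k
  -- give it, or the coefficient l - (d+1)/b is zero and u₁ > 0 suffices.
  set b := max 1 ((d + 1) / l) with hb
  have hbr : b ≤ r := max_le hr (by rw [div_le_iff₀ hl]; linarith)
  set F : ℝ → ℝ := fun r => r ^ (d - 1) * u₁ r - (l - (d + 1) / r) * (r ^ (d - 1) * u r) with hF
  set E : ℝ → ℝ := fun r => F r * (Real.exp (l * r) * r ^ (-(d + 1))) with hE
  have hmono : MonotoneOn E (Ici b) := by
    refine monotoneOn_of_hasDerivAt_nonneg (convex_Ici b) (f' := fun r =>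
      (r ^ (d - 1) * u r * ((l * r * (d + 3) - 3 * (d + 1)) / r ^ 2)) *
        (Real.exp (l * r) * r ^ (-(d + 1)))) ?_ ?_
    · intro r hr
      have h0 : 0 < r := one_pos.trans_le ((le_max_left _ _).trans hr)
      have e1 := S.hasDerivAt_u₁ r h0
      have e2 : HasDerivAt (fun r : ℝ => l - (d + 1) / r) ((d + 1) / r ^ 2) r := by
        have := ((hasDerivAt_inv h0.ne').const_mul (d + 1)).const_sub l
        simpa [div_eq_mul_inv] using this
      have e3 := (hasDerivAt_weight d h0).mul (S.hasDerivAt_u r h0)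
      have e4 : HasDerivAt (fun r : ℝ => Real.exp (l * r)) (Real.exp (l * r) * l) r := by
        simpa using ((hasDerivAt_id r).const_mul l).exp
      have e5 : HasDerivAt (fun r : ℝ => r ^ (-(d + 1))) (-(d + 1) * r ^ (-(d + 1)) / r) r := by
        refine (Real.hasDerivAt_rpow_const (Or.inl h0.ne')).congr_deriv ?_
        rw [Real.rpow_sub_one h0.ne']; ring
      refine ((e1.sub (e2.mul e3)).mul (e4.mul e5)).congr_deriv ?_
      simp only [Pi.mul_apply, Pi.sub_apply]
      field_simp
      ring
    · intro r hr
      have h1 : 1 ≤ r := (le_max_left _ _).trans hr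
      have h0 : 0 < r := one_pos.trans_le h1
      have h2 : (d + 1) / l ≤ r := (le_max_right _ _).trans hr
      rw [div_le_iff₀ hl] at h2
      have := S.u_pos hl h1
      have h3 : 0 ≤ l * r * (d + 3) - 3 * (d + 1) := by nlinarith
      positivity
  have hb1 : 1 ≤ b := le_max_left _ _
  have hb0 : 0 < b := by linarith
  have hFb : 0 ≤ F b := by
    rcases le_or_gt ((d + 1) / l) 1 with h | h
    · have e : b = 1 := max_eq_left h
      rw [e]
      simp only [hF, Real.one_rpow, one_mul, S.glue, S.glue_deriv]
      have h1 := S.deriv_le 1 one_pos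
      have h2 := S.a_pos hl
      have h3 := S.pos 1 one_pos
      have h4 : 0 ≤ a * (-(l * k 1) - k₁ 1) := mul_nonneg h2.le (by linarith)
      have h5 : 0 < (d + 1) * (a * k 1) := by positivity
      rw [div_one]
      linarith
    · have e : b = (d + 1) / l := max_eq_right h.le
      have h1 : l - (d + 1) / b = 0 := by
        rw [e]; field_simp; ring
      simp only [hF, h1, zero_mul, sub_zero]
      have := S.u₁_pos hl hb1
      positivity
  have hEr : 0 ≤ E r :=
    le_trans (mul_nonneg hFb (by positivity)) (hmono (mem_Ici.2 le_rfl) (mem_Ici.2 hbr) hbr)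
  have hFr : 0 ≤ F r := by
    have : 0 < Real.exp (l * r) * r ^ (-(d + 1)) := by positivity
    exact nonneg_of_mul_nonneg_left hEr this
  simp only [hF] at hFr
  have hw : 0 < r ^ (d - 1) := by positivity
  refine le_of_mul_le_mul_left ?_ hw
  linarith

theorem k_le_exp (S : SolutionPair d l a k k₁ u u₁) {t r : ℝ} (ht : 0 < t) (htr : t ≤ r) :
    k r ≤ k t * Real.exp (-(l * (r - t))) := by
  have hanti : AntitoneOn (fun r => k r * Real.exp (l * r)) (Ioi 0) := by
    refine antitoneOn_of_hasDerivAt_nonpos (convex_Ioi 0)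
      (f' := fun r => (k₁ r + l * k r) * Real.exp (l * r)) ?_ ?_
    · intro r hr
      have e4 : HasDerivAt (fun r : ℝ => Real.exp (l * r)) (Real.exp (l * r) * l) r := by
        simpa using ((hasDerivAt_id r).const_mul l).exp
      exact ((S.hasDerivAt_k r hr).mul e4).congr_deriv (by ring)
    · intro r hr
      exact mul_nonpos_of_nonpos_of_nonneg (by linarith [S.deriv_le r hr]) (by positivity)
  have h := hanti (mem_Ioi.2 ht) (mem_Ioi.2 (ht.trans_le htr)) htr
  simp only at h
  have e : Real.exp (-(l * (r - t))) = Real.exp (l * t) * Real.exp (-(l * r)) := by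
    rw [← Real.exp_add]; congr 1; ring
  rw [e, ← mul_assoc]
  calc k r = k r * Real.exp (l * r) * Real.exp (-(l * r)) := by
        rw [mul_assoc, ← Real.exp_add]; simp
    _ ≤ _ := by gcongr

/-- The integrated form of `k₁_ge`. With `k_le_exp` it determines k(r)/k(t) as e^(-l(r-t)) up to a
factor between (t/r)^(d+1) and 1, hence up to a relative error O((r-t)/r). -/
theorem exp_le_k (S : SolutionPair d l a k k₁ u u₁) (hd : 1 < d) (hl : 0 < l) {t r : ℝ}
    (ht : 1 ≤ t) (htr : t ≤ r) :
    k t * ((t / r) ^ (d + 1) * Real.exp (-(l * (r - t)))) ≤ k r := by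
  have hmono : MonotoneOn (fun r => k r * (Real.exp (l * r) * r ^ (d + 1))) (Ici 1) := by
    refine monotoneOn_of_hasDerivAt_nonneg (convex_Ici 1)
      (f' := fun r => (k₁ r + (l + (d + 1) / r) * k r) * (Real.exp (l * r) * r ^ (d + 1))) ?_ ?_
    · intro r hr
      have h0 : 0 < r := one_pos.trans_le hr
      have e4 : HasDerivAt (fun r : ℝ => Real.exp (l * r)) (Real.exp (l * r) * l) r := by
        simpa using ((hasDerivAt_id r).const_mul l).exp
      have e5 : HasDerivAt (fun r : ℝ => r ^ (d + 1)) ((d + 1) * r ^ (d + 1) / r) r := by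
        refine (Real.hasDerivAt_rpow_const (Or.inl h0.ne')).congr_deriv ?_
        rw [Real.rpow_sub_one h0.ne']; ring
      exact ((S.hasDerivAt_k r h0).mul (e4.mul e5)).congr_deriv
        (by simp only [Pi.mul_apply]; field_simp)
    · intro r hr
      have h0 : 0 < r := one_pos.trans_le hr
      exact mul_nonneg (by linarith [S.k₁_ge hd hl hr]) (by positivity)
  have hr : 1 ≤ r := ht.trans htr
  have h0 : 0 < t := by linarith
  have h1 : 0 < r := by linarith
  have h := hmono (mem_Ici.2 ht) (mem_Ici.2 hr) htr
  simp only at h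
  have e : Real.exp (-(l * (r - t))) = Real.exp (l * t) * (Real.exp (l * r))⁻¹ := by
    rw [← Real.exp_neg, ← Real.exp_add]; congr 1; ring
  have hp : 0 < Real.exp (l * r) * r ^ (d + 1) := by positivity
  rw [← div_le_iff₀ hp] at h
  refine le_trans (le_of_eq ?_) h
  rw [e, Real.div_rpow h0.le h1.le]; field_simp

theorem u_le_exp (S : SolutionPair d l a k k₁ u u₁) (hd : 1 < d) (hl : 0 < l) {r t : ℝ}
    (hr : 1 ≤ r) (hrt : r ≤ t) :
    u r ≤ u t * ((t / r) ^ (d + 1) * Real.exp (-(l * (t - r)))) := by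
  have hmono : MonotoneOn (fun r => u r * (Real.exp (-(l * r)) * r ^ (d + 1))) (Ici 1) := by
    refine monotoneOn_of_hasDerivAt_nonneg (convex_Ici 1)
      (f' := fun r => (u₁ r - (l - (d + 1) / r) * u r) *
        (Real.exp (-(l * r)) * r ^ (d + 1))) ?_ ?_
    · intro r hr
      have h0 : 0 < r := one_pos.trans_le hr
      have e4 : HasDerivAt (fun r : ℝ => Real.exp (-(l * r))) (Real.exp (-(l * r)) * -l) r := by
        simpa using ((hasDerivAt_id r).const_mul l).neg.exp
      have e5 : HasDerivAt (fun r : ℝ => r ^ (d + 1)) ((d + 1) * r ^ (d + 1) / r) r := by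
        refine (Real.hasDerivAt_rpow_const (Or.inl h0.ne')).congr_deriv ?_
        rw [Real.rpow_sub_one h0.ne']; ring
      exact ((S.hasDerivAt_u r h0).mul (e4.mul e5)).congr_deriv
        (by simp only [Pi.mul_apply]; field_simp; ring)
    · intro r hr
      have h0 : 0 < r := one_pos.trans_le hr
      exact mul_nonneg (by linarith [S.le_u₁ hd hl hr]) (by positivity)
  have ht : 1 ≤ t := hr.trans hrt
  have h0 : 0 < t := by linarith
  have h1 : 0 < r := by linarith
  have h := hmono (mem_Ici.2 hr) (mem_Ici.2 ht) hrt
  simp only at h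
  have e : Real.exp (-(l * (t - r))) = Real.exp (-(l * t)) * (Real.exp (-(l * r)))⁻¹ := by
    rw [← Real.exp_neg, ← Real.exp_add]; congr 1; ring
  have hp : 0 < Real.exp (-(l * r)) * r ^ (d + 1) := by positivity
  rw [← le_div_iff₀ hp] at h
  refine h.trans (le_of_eq ?_)
  rw [e, Real.div_rpow h0.le h1.le]; field_simp

theorem exp_le_u (S : SolutionPair d l a k k₁ u u₁) (hd : 1 < d) (hl : 0 < l) {r t : ℝ}
    (hr : 1 ≤ r) (hrt : r ≤ t) :
    u t * ((r / t) ^ (d + 1) * Real.exp (-(l * (t - r)))) ≤ u r := by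
  have hanti : AntitoneOn (fun r => u r * (Real.exp (-(l * r)) * r ^ (-(d + 1)))) (Ici 1) := by
    refine antitoneOn_of_hasDerivAt_nonpos (convex_Ici 1)
      (f' := fun r => (u₁ r - (l + (d + 1) / r) * u r) *
        (Real.exp (-(l * r)) * r ^ (-(d + 1)))) ?_ ?_
    · intro r hr
      have h0 : 0 < r := one_pos.trans_le hr
      have e4 : HasDerivAt (fun r : ℝ => Real.exp (-(l * r))) (Real.exp (-(l * r)) * -l) r := by
        simpa using ((hasDerivAt_id r).const_mul l).neg.exp
      have e5 : HasDerivAt (fun r : ℝ => r ^ (-(d + 1))) (-(d + 1) * r ^ (-(d + 1)) / r) r := by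
        refine (Real.hasDerivAt_rpow_const (Or.inl h0.ne')).congr_deriv ?_
        rw [Real.rpow_sub_one h0.ne']; ring
      exact ((S.hasDerivAt_u r h0).mul (e4.mul e5)).congr_deriv
        (by simp only [Pi.mul_apply]; field_simp; ring)
    · intro r hr
      have h0 : 0 < r := one_pos.trans_le hr
      exact mul_nonpos_of_nonpos_of_nonneg (by linarith [S.u₁_le hd hl hr]) (by positivity)
  have ht : 1 ≤ t := hr.trans hrt
  have h0 : 0 < t := by linarith
  have h1 : 0 < r := by linarith
  have h := hanti (mem_Ici.2 hr) (mem_Ici.2 ht) hrt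
  simp only at h
  have e : Real.exp (-(l * (t - r))) = Real.exp (-(l * t)) * (Real.exp (-(l * r)))⁻¹ := by
    rw [← Real.exp_neg, ← Real.exp_add]; congr 1; ring
  have hp : 0 < Real.exp (-(l * r)) * r ^ (-(d + 1)) := by positivity
  rw [← div_le_iff₀ hp] at h
  refine le_trans (le_of_eq ?_) h
  rw [e, Real.div_rpow h1.le h0.le, Real.rpow_neg h0.le, Real.rpow_neg h1.le]; field_simp

/-! ### Pointwise estimates of the kernels at a fixed spectral parameter -/

theorem wku₁_nonneg (S : SolutionPair d l a k k₁ u u₁) (hl : 0 < l) {r : ℝ} (hr : 1 ≤ r) :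
    0 ≤ k r * (r ^ (d - 1) * u₁ r) := by
  have h0 : 0 < r := by linarith
  have h1 := S.pos r h0
  have h2 := S.u₁_pos hl hr
  positivity

theorem wuk₁_nonneg (S : SolutionPair d l a k k₁ u u₁) (hl : 0 < l) {r : ℝ} (hr : 1 ≤ r) :
    0 ≤ -(u r * (r ^ (d - 1) * k₁ r)) := by
  have h0 : 0 < r := by linarith
  have h1 := S.u_pos hl hr
  have h2 := neg_pos.2 (S.k₁_neg hl h0)
  have : 0 ≤ u r * (r ^ (d - 1) * -k₁ r) := by positivity
  linarith

/-- Up to sign the two summands are the one-sided limits of the same-side kernel at the diagonal, so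
the Wronskian says that the kernel jumps by one. Both are nonnegative, hence each is at most one. -/
theorem wku₁_add (S : SolutionPair d l a k k₁ u u₁) {r : ℝ} (hr : 1 ≤ r) :
    k r * (r ^ (d - 1) * u₁ r) + -(u r * (r ^ (d - 1) * k₁ r)) = 1 := by
  linarith [S.wronskian r (by linarith)]

/-- The two one-sided values add up to one, so only their difference r^(d-1)(k·u₁ + u·k₁) matters.
In it the leading parts ±l·k·u of the logarithmic derivatives cancel. What is left is O(1/r) times g
= r^(d-1)·k·u, and g ≤ 1/l by the Wronskian. -/
theorem wku₁_sub_half (S : SolutionPair d l a k k₁ u u₁) (hd : 1 < d) (hl : 0 < l) {r : ℝ}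
    (hr : 1 ≤ r) : |k r * (r ^ (d - 1) * u₁ r) - 1 / 2| ≤ (d + 1) / (l * r) := by
  have h0 : 0 < r := by linarith
  have hk := S.pos r h0
  have hu := S.u_pos hl hr
  have hw : 0 < r ^ (d - 1) := by positivity
  have h1 := S.wronskian r h0
  have hk1 := S.deriv_le r h0
  have hk2 := S.k₁_ge hd hl hr
  have hu1 := S.u₁_le hd hl hr
  have hu2 := S.le_u₁ hd hl hr
  have hu0 := S.u₁_pos hl hr
  set g := r ^ (d - 1) * (k r * u r) with hg
  have hg0 : 0 < g := by positivity
  have hgl : g * l ≤ 1 := by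
    rw [← h1, hg]
    have : 0 ≤ r ^ (d - 1) * (k r * u₁ r + u r * (-(l * k r) - k₁ r)) := by
      have : 0 ≤ u r * (-(l * k r) - k₁ r) := mul_nonneg hu.le (by linarith)
      positivity
    linarith
  have hgl' : g ≤ 1 / l := by rwa [le_div_iff₀ hl]
  have e : k r * (r ^ (d - 1) * u₁ r) - 1 / 2 =
      (r ^ (d - 1) * (k r * u₁ r + u r * k₁ r)) / 2 := by
    nlinarith
  have b1 : r ^ (d - 1) * (k r * u₁ r + u r * k₁ r) ≤ g * ((d + 1) / r) := by
    have i1 : k r * u₁ r ≤ k r * ((l + (d + 1) / r) * u r) := by gcongr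
    have i2 : u r * k₁ r ≤ u r * -(l * k r) := by gcongr
    calc _ ≤ r ^ (d - 1) * (k r * ((l + (d + 1) / r) * u r) + u r * -(l * k r)) := by gcongr
      _ = _ := by rw [hg]; ring
  have b2 : -(g * (2 * ((d + 1) / r))) ≤ r ^ (d - 1) * (k r * u₁ r + u r * k₁ r) := by
    have i1 : k r * ((l - (d + 1) / r) * u r) ≤ k r * u₁ r := by gcongr
    have i2 : u r * -((l + (d + 1) / r) * k r) ≤ u r * k₁ r := by gcongr; linarith
    calc _ = r ^ (d - 1) * (k r * ((l - (d + 1) / r) * u r) +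
          u r * -((l + (d + 1) / r) * k r)) := by rw [hg]; ring
      _ ≤ _ := by gcongr
  have b3 : g * ((d + 1) / r) ≤ (d + 1) / (l * r) := by
    calc g * ((d + 1) / r) ≤ 1 / l * ((d + 1) / r) := by gcongr
      _ = _ := by field_simp
  have b4 : 0 ≤ g * ((d + 1) / r) := by positivity
  rw [e, abs_le]
  constructor <;> linarith

/-- Weakens 1/(lr) to (lr)^(-1/2), which stays integrable in l at 0. For lr < 1 the trivial bound is
enough. -/
theorem wku₁_sub_half' (S : SolutionPair d l a k k₁ u u₁) (hd : 1 < d) (hl : 0 < l) {r t : ℝ}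
    (ht : 1 ≤ t) (hr : 0 < r) (hrt : r / 2 ≤ t) :
    |k t * (t ^ (d - 1) * u₁ t) - 1 / 2| ≤ 2 * (d + 1) * (l * r) ^ (-(1 / 2) : ℝ) := by
  have hlr : 0 < l * r := by positivity
  rcases le_or_gt 1 (l * r) with h | h
  · refine (S.wku₁_sub_half hd hl ht).trans ?_
    calc (d + 1) / (l * t) ≤ (d + 1) / (l * (r / 2)) := by gcongr
      _ = 2 * (d + 1) * (l * r) ^ (-1 : ℝ) := by rw [Real.rpow_neg_one]; field_simp
      _ ≤ _ := by
        gcongr ?_ * ?_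
        exact Real.rpow_le_rpow_of_exponent_le h (by norm_num)
  · have h1 := S.wku₁_nonneg hl ht
    have h2 := S.wuk₁_nonneg hl ht
    have h3 := S.wku₁_add ht
    have h4 : (1:ℝ) ≤ (l * r) ^ (-(1 / 2) : ℝ) :=
      Real.one_le_rpow_of_pos_of_le_one_of_nonpos hlr h.le (by norm_num)
    rw [abs_le]
    constructor <;> nlinarith

theorem one_sub_rpow_le {d x : ℝ} (hd : 1 < d) (hx : 0 ≤ x) :
    1 - x ^ (d + 1) ≤ (d + 1) * (1 - x) := by
  have := one_add_mul_self_le_rpow_one_add (s := x - 1) (by linarith) (p := d + 1) (by linarith)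
  simp only [add_sub_cancel] at this
  linarith

theorem rpow_sub_one_le {d x : ℝ} (hd : 1 < d) (hx : 1 ≤ x) (hx2 : x ≤ 2) :
    x ^ (d + 1) - 1 ≤ 2 ^ (d + 1) * (d + 1) * (x - 1) := by
  have h0 : 0 < x := by linarith
  have h1 := one_sub_rpow_le hd (x := x⁻¹) (by positivity)
  have e : x ^ (d + 1) - 1 = x ^ (d + 1) * (1 - x⁻¹ ^ (d + 1)) := by
    rw [Real.inv_rpow h0.le]; field_simp
  have h2 : 0 ≤ 1 - x⁻¹ := by
    rw [sub_nonneg]; exact inv_le_one_of_one_le₀ hx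
  rw [e]
  calc x ^ (d + 1) * (1 - x⁻¹ ^ (d + 1)) ≤ x ^ (d + 1) * ((d + 1) * (1 - x⁻¹)) := by gcongr
    _ ≤ 2 ^ (d + 1) * ((d + 1) * (x - 1)) := by
      have h3 : 1 - x⁻¹ ≤ x - 1 := by
        have : x * x⁻¹ = 1 := mul_inv_cancel₀ h0.ne'
        nlinarith [mul_nonneg h2 (sub_nonneg.2 hx)]
      gcongr
    _ = _ := by ring

/-- The kernel of `l ↦ Δ (Δ + l²)⁻¹` (acting on derivatives) just below the diagonal. -/
theorem near_left (S : SolutionPair d l a k k₁ u u₁) (hd : 1 < d) (hl : 0 < l) {r t : ℝ}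
    (ht : 1 ≤ t) (htr : t ≤ r) (hrt : r / 2 ≤ t) :
    |k r * (t ^ (d - 1) * u₁ t) - Real.exp (-(l * (r - t))) / 2| ≤
      2 ^ (d + 1) * (2 * (d + 1)) * ((l * r) ^ (-(1 / 2) : ℝ) + (r - t) / r) *
        Real.exp (-(l * (r - t))) := by
  have h0 : 0 < t := by linarith
  have h1 : 0 < r := by linarith
  set e := Real.exp (-(l * (r - t))) with he
  have he0 : 0 < e := Real.exp_pos _
  set X := k t * (t ^ (d - 1) * u₁ t) with hX
  set ρ := k r / k t with hρ
  have hk := S.pos t h0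
  have eq : k r * (t ^ (d - 1) * u₁ t) = X * ρ := by rw [hX, hρ]; field_simp
  have hρ1 : ρ ≤ e := by
    rw [hρ, div_le_iff₀ hk, mul_comm]; exact S.k_le_exp h0 htr
  have hρ2 : (t / r) ^ (d + 1) * e ≤ ρ := by
    rw [hρ, le_div_iff₀ hk, mul_comm]; exact S.exp_le_k hd hl ht htr
  have hρ0 : 0 ≤ ρ := le_trans (by positivity) hρ2
  have hb := one_sub_rpow_le hd (x := t / r) (by positivity)
  have hb' : 1 - t / r = (r - t) / r := by field_simp
  rw [hb'] at hb
  have hX' := S.wku₁_sub_half' hd hl ht h1 hrt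
  rw [← hX] at hX'
  have hB : 0 ≤ (r - t) / r := div_nonneg (by linarith) h1.le
  have hA : 0 ≤ (l * r) ^ (-(1 / 2) : ℝ) := by positivity
  have key : |X * ρ - e / 2| ≤ (2 * (d + 1) * (l * r) ^ (-(1 / 2) : ℝ)) * e +
      (d + 1) * ((r - t) / r) * e := by
    have : X * ρ - e / 2 = (X - 1 / 2) * ρ + (ρ - e) / 2 := by ring
    rw [this]
    refine (abs_add_le _ _).trans ?_
    have i1 : |(X - 1 / 2) * ρ| ≤ (2 * (d + 1) * (l * r) ^ (-(1 / 2) : ℝ)) * e := by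
      rw [abs_mul, abs_of_nonneg hρ0]
      gcongr
    have i2 : |(ρ - e) / 2| ≤ (d + 1) * ((r - t) / r) * e := by
      have h5 : (1 - (t / r) ^ (d + 1)) * e ≤ (d + 1) * ((r - t) / r) * e := by gcongr
      have h6 : 0 ≤ (d + 1) * ((r - t) / r) * e := by positivity
      rw [abs_le]; constructor <;> linarith
    linarith
  rw [eq]
  refine key.trans ?_
  have h2 : (1:ℝ) ≤ 2 ^ (d + 1) := Real.one_le_rpow (by norm_num) (by linarith)
  have i1 : 2 * (d + 1) * (l * r) ^ (-(1 / 2) : ℝ) + (d + 1) * ((r - t) / r) ≤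
      1 * (2 * (d + 1)) * ((l * r) ^ (-(1 / 2) : ℝ) + (r - t) / r) := by
    have : 0 ≤ (d + 1) * ((r - t) / r) := by positivity
    linarith
  rw [← add_mul]
  calc _ ≤ 1 * (2 * (d + 1)) * ((l * r) ^ (-(1 / 2) : ℝ) + (r - t) / r) * e := by gcongr
    _ ≤ _ := by gcongr

/-- The counterpart of `near_left` above the diagonal, through the ratio u(r)/u(t). This ratio may
exceed e^(-l(t-r)) by the factor (t/r)^(d+1), which t ≤ 2r keeps below 2^(d+1). -/
theorem near_right (S : SolutionPair d l a k k₁ u u₁) (hd : 1 < d) (hl : 0 < l) {r t : ℝ}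
    (hr : 1 ≤ r) (hrt : r ≤ t) (htr : t ≤ 2 * r) :
    |u r * (t ^ (d - 1) * k₁ t) + Real.exp (-(l * (t - r))) / 2| ≤
      2 ^ (d + 1) * (2 * (d + 1)) * ((l * r) ^ (-(1 / 2) : ℝ) + (t - r) / r) *
        Real.exp (-(l * (t - r))) := by
  have h0 : 0 < t := by linarith
  have h1 : 0 < r := by linarith
  have ht : 1 ≤ t := hr.trans hrt
  set e := Real.exp (-(l * (t - r))) with he
  have he0 : 0 < e := Real.exp_pos _
  set Y := -(u t * (t ^ (d - 1) * k₁ t)) with hY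
  set ρ := u r / u t with hρ
  have hu := S.u_pos hl ht
  have eq : u r * (t ^ (d - 1) * k₁ t) = -(Y * ρ) := by rw [hY, hρ]; field_simp
  have hρ1 : ρ ≤ (t / r) ^ (d + 1) * e := by
    rw [hρ, div_le_iff₀ hu, mul_comm]; exact S.u_le_exp hd hl hr hrt
  have hρ2 : (r / t) ^ (d + 1) * e ≤ ρ := by
    rw [hρ, le_div_iff₀ hu, mul_comm]; exact S.exp_le_u hd hl hr hrt
  have hρ0 : 0 ≤ ρ := le_trans (by positivity) hρ2
  have h2 : (1:ℝ) ≤ 2 ^ (d + 1) := Real.one_le_rpow (by norm_num) (by linarith)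
  have hb := one_sub_rpow_le hd (x := r / t) (by positivity)
  have hb2 := rpow_sub_one_le hd (x := t / r) (by rw [le_div_iff₀ h1]; linarith)
    (by rw [div_le_iff₀ h1]; linarith)
  have hb2' : t / r - 1 = (t - r) / r := by field_simp
  rw [hb2'] at hb2
  have hB : 0 ≤ (t - r) / r := div_nonneg (by linarith) h1.le
  have hb' : 1 - r / t ≤ (t - r) / r := by
    have : 1 - r / t = (t - r) / t := by field_simp
    rw [this]
    have : 0 ≤ t - r := by linarith
    gcongr
  have hX' := S.wku₁_sub_half' hd hl ht h1 (by linarith)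
  have hY' : |Y - 1 / 2| ≤ 2 * (d + 1) * (l * r) ^ (-(1 / 2) : ℝ) := by
    have := S.wku₁_add ht
    rw [← hY] at this
    rw [← abs_neg]; convert! hX' using 2; linarith
  have hA : 0 ≤ (l * r) ^ (-(1 / 2) : ℝ) := by positivity
  have hρ3 : ρ ≤ 2 ^ (d + 1) * e := by
    refine hρ1.trans ?_
    have : t / r ≤ 2 := by rw [div_le_iff₀ h1]; linarith
    gcongr
  have i2 : |(ρ - e) / 2| ≤ 2 ^ (d + 1) * (d + 1) * ((t - r) / r) * e := by
    have h5 : ((t / r) ^ (d + 1) - 1) * e ≤ 2 ^ (d + 1) * (d + 1) * ((t - r) / r) * e := by gcongr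
    have h6 : 0 ≤ 2 ^ (d + 1) * (d + 1) * ((t - r) / r) * e := by positivity
    have h7 : (1 - (r / t) ^ (d + 1)) * e ≤ 2 ^ (d + 1) * (d + 1) * ((t - r) / r) * e := by
      have : 1 - (r / t) ^ (d + 1) ≤ 1 * (d + 1) * ((t - r) / r) := by
        refine hb.trans ?_
        rw [one_mul]; gcongr
      calc _ ≤ 1 * (d + 1) * ((t - r) / r) * e := by gcongr
        _ ≤ _ := by gcongr
    rw [abs_le]; constructor <;> linarith
  have i1 : |(Y - 1 / 2) * ρ| ≤ (2 * (d + 1) * (l * r) ^ (-(1 / 2) : ℝ)) * (2 ^ (d + 1) * e) := by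
    rw [abs_mul, abs_of_nonneg hρ0]
    gcongr
  have : u r * (t ^ (d - 1) * k₁ t) + e / 2 = -((Y - 1 / 2) * ρ + (ρ - e) / 2) := by
    rw [eq]; ring
  rw [this, abs_neg]
  refine (abs_add_le _ _).trans ?_
  have h8 : 0 ≤ 2 ^ (d + 1) * (d + 1) * ((t - r) / r) * e := by positivity
  linarith

/-- Pass through the midpoint ρ of r and t: the decay of k₁ from ρ to t provides half of the
exponent, and u(ρ)ρ^(d-1)|k₁(ρ)| ≤ 1 bounds the rest. -/
theorem far_right (S : SolutionPair d l a k k₁ u u₁) (hd : 1 < d) (hl : 0 < l) {r t : ℝ}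
    (hr : 1 ≤ r) (hrt : r ≤ t) :
    |u r * (t ^ (d - 1) * k₁ t)| ≤ 2 ^ (d + 1) * Real.exp (-(l * (t - r) / 2)) := by
  have h1 : 0 < r := by linarith
  have h0 : 0 < t := by linarith
  set ρ := (t + r) / 2 with hρ
  have hρ0 : 0 < ρ := by rw [hρ]; linarith
  have hρ1 : 1 ≤ ρ := by rw [hρ]; linarith
  have hrρ : r ≤ ρ := by rw [hρ]; linarith
  have hur := S.u_pos hl hr
  have huρ := S.u_pos hl hρ1
  have hk1 := neg_pos.2 (S.k₁_neg hl h0)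
  have hkρ := neg_pos.2 (S.k₁_neg hl hρ0)
  have e1 : |u r * (t ^ (d - 1) * k₁ t)| = u r * (t ^ (d - 1) * -k₁ t) := by
    rw [← abs_neg, abs_of_nonneg]
    · ring
    · have : 0 < u r * (t ^ (d - 1) * -k₁ t) := by positivity
      linarith
  have h2 := S.decay ρ t hρ0 (by rw [hρ]; linarith)
  have e2 : l * (t - ρ) = l * (t - r) / 2 := by rw [hρ]; ring
  rw [e2] at h2
  have h3 : t ^ (d - 1) ≤ 2 ^ (d - 1) * ρ ^ (d - 1) := by
    rw [← Real.mul_rpow (by norm_num) hρ0.le]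
    exact Real.rpow_le_rpow h0.le (by rw [hρ]; linarith) (by linarith)
  have h4 : u r ≤ u ρ := S.monotoneOn_u hl hr hρ1 hrρ
  have h5 : u ρ * (ρ ^ (d - 1) * -k₁ ρ) ≤ 1 := by
    have := S.wku₁_add hρ1
    have := S.wku₁_nonneg hl hρ1
    linarith
  have h6 : (2:ℝ) ^ (d - 1) ≤ 2 ^ (d + 1) := by
    gcongr
    · norm_num
    · linarith
  rw [e1]
  calc u r * (t ^ (d - 1) * -k₁ t)
      ≤ u ρ * ((2 ^ (d - 1) * ρ ^ (d - 1)) * (-k₁ ρ * Real.exp (-(l * (t - r) / 2)))) := by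
        gcongr
    _ = 2 ^ (d - 1) * (u ρ * (ρ ^ (d - 1) * -k₁ ρ)) * Real.exp (-(l * (t - r) / 2)) := by ring
    _ ≤ 2 ^ (d + 1) * 1 * Real.exp (-(l * (t - r) / 2)) := by gcongr
    _ = _ := by ring

theorem far_left_nonneg (S : SolutionPair d l a k k₁ u u₁) (hl : 0 < l) {t : ℝ} (ht : 1 ≤ t) :
    0 ≤ t ^ (d - 1) * u₁ t - u₁ 1 := by
  have h := S.monotoneOn_wu₁ hl (mem_Ici.2 le_rfl) (mem_Ici.2 ht) ht
  simp only [Real.one_rpow, one_mul] at h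
  linarith

/-- The function s^(d-1)u₁(s) has derivative l²s^(d-1)u(s), and u increases. So its increment over
[1, t] is at most l²u(t)t^d/d, while over [t, ρ] with ρ = 3r/4 it is at least l²u(t)(ρ^d - t^d)/d.
Comparison gains the factor (t/ρ)^d; then k(ρ)ρ^(d-1)u₁(ρ) ≤ 1, and k loses e^(-lr/4) between ρ and
r. -/
theorem far_left (S : SolutionPair d l a k k₁ u u₁) (hd : 1 < d) (hl : 0 < l) {r t : ℝ}
    (ht : 1 ≤ t) (htr : t ≤ r / 2) :
    k r * (t ^ (d - 1) * u₁ t - u₁ 1) ≤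
      2 ^ (d + 2) * (t / r) ^ d * Real.exp (-(l * r / 4)) := by
  have h0 : 0 < t := by linarith
  have h1 : 0 < r := by linarith
  set ρ := 3 * r / 4 with hρ
  have hρ0 : 0 < ρ := by rw [hρ]; linarith
  have hρ1 : 1 ≤ ρ := by rw [hρ]; linarith
  have htρ : t ≤ ρ := by rw [hρ]; linarith
  have hu := S.u_pos hl ht
  have hpow : ∀ s : ℝ, 0 < s → HasDerivAt (fun s : ℝ => l ^ 2 * u t * (s ^ d / d))
      (l ^ 2 * (s ^ (d - 1) * u t)) s := by
    intro s hs
    refine (((Real.hasDerivAt_rpow_const (p := d) (Or.inl hs.ne')).div_const d).const_mul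
      (l ^ 2 * u t)).congr_deriv ?_
    field_simp
  have hd0 : 0 < d := by linarith
  have i1 : t ^ (d - 1) * u₁ t - u₁ 1 ≤ l ^ 2 * u t * (t ^ d / d) := by
    have hanti : AntitoneOn (fun s => s ^ (d - 1) * u₁ s - l ^ 2 * u t * (s ^ d / d)) (Icc 1 t) := by
      refine antitoneOn_of_hasDerivAt_nonpos (convex_Icc 1 t)
        (fun s hs => (S.hasDerivAt_u₁ s (by linarith [hs.1])).sub (hpow s (by linarith [hs.1]))) ?_
      intro s hs
      have hs0 : 0 < s := by linarith [hs.1]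
      have h2 := S.monotoneOn_u hl (mem_Ici.2 hs.1) (mem_Ici.2 ht) hs.2
      have : l ^ 2 * (s ^ (d - 1) * u s) ≤ l ^ 2 * (s ^ (d - 1) * u t) := by gcongr
      linarith
    have := hanti (left_mem_Icc.2 ht) (right_mem_Icc.2 ht) ht
    simp only [Real.one_rpow, one_mul] at this
    have h3 : 0 ≤ l ^ 2 * u t * (1 / d) := by positivity
    linarith
  have i2 : l ^ 2 * u t * ((ρ ^ d - t ^ d) / d) ≤ ρ ^ (d - 1) * u₁ ρ - t ^ (d - 1) * u₁ t := by
    have hm : MonotoneOn (fun s => s ^ (d - 1) * u₁ s - l ^ 2 * u t * (s ^ d / d)) (Icc t ρ) := by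
      refine monotoneOn_of_hasDerivAt_nonneg (convex_Icc t ρ)
        (fun s hs => (S.hasDerivAt_u₁ s (by linarith [hs.1])).sub (hpow s (by linarith [hs.1]))) ?_
      intro s hs
      have hs0 : 0 < s := by linarith [hs.1]
      have h2 := S.monotoneOn_u hl (mem_Ici.2 ht) (mem_Ici.2 (ht.trans hs.1)) hs.1
      have : l ^ 2 * (s ^ (d - 1) * u t) ≤ l ^ 2 * (s ^ (d - 1) * u s) := by gcongr
      linarith
    have := hm (left_mem_Icc.2 htρ) (right_mem_Icc.2 htρ) htρ
    simp only at this
    rw [sub_div, mul_sub]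
    linarith
  have i3 : ρ ^ d / 3 ≤ ρ ^ d - t ^ d := by
    have : t ^ d ≤ (2 / 3) * ρ ^ d := by
      calc t ^ d ≤ (2 / 3 * ρ) ^ d := by gcongr; rw [hρ]; linarith
        _ = (2 / 3) ^ d * ρ ^ d := Real.mul_rpow (by norm_num) hρ0.le
        _ ≤ (2 / 3) ^ (1:ℝ) * ρ ^ d := by
          gcongr ?_ * _
          exact Real.rpow_le_rpow_of_exponent_ge (by norm_num) (by norm_num) hd.le
        _ = _ := by rw [Real.rpow_one]
    linarith
  have hk := S.pos r h1
  have hN0 := S.far_left_nonneg hl ht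
  have i4 : l ^ 2 * u t * (ρ ^ d / 3 / d) ≤ ρ ^ (d - 1) * u₁ ρ := by
    have : l ^ 2 * u t * (ρ ^ d / 3 / d) ≤ l ^ 2 * u t * ((ρ ^ d - t ^ d) / d) := by gcongr
    have := S.u₁_one_pos hl
    linarith
  have i5 : t ^ (d - 1) * u₁ t - u₁ 1 ≤ 3 * (t / ρ) ^ d * (ρ ^ (d - 1) * u₁ ρ) := by
    calc _ ≤ l ^ 2 * u t * (t ^ d / d) := i1
      _ = 3 * (t / ρ) ^ d * (l ^ 2 * u t * (ρ ^ d / 3 / d)) := by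
        rw [Real.div_rpow h0.le hρ0.le]; field_simp
      _ ≤ _ := by gcongr
  have i6 : k r ≤ k ρ * Real.exp (-(l * r / 4)) := by
    have := S.k_le_exp hρ0 (r := r) (by rw [hρ]; linarith)
    convert this using 4
    rw [hρ]; ring
  have i7 : k ρ * (ρ ^ (d - 1) * u₁ ρ) ≤ 1 := by
    have := S.wku₁_add hρ1
    have := S.wuk₁_nonneg hl hρ1
    linarith
  have hu1ρ := S.u₁_pos hl hρ1
  calc k r * (t ^ (d - 1) * u₁ t - u₁ 1)
      ≤ (k ρ * Real.exp (-(l * r / 4))) * (3 * (t / ρ) ^ d * (ρ ^ (d - 1) * u₁ ρ)) := by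
        have := S.pos ρ hρ0
        gcongr
    _ = 3 * (t / ρ) ^ d * (k ρ * (ρ ^ (d - 1) * u₁ ρ)) * Real.exp (-(l * r / 4)) := by ring
    _ ≤ 3 * (t / ρ) ^ d * 1 * Real.exp (-(l * r / 4)) := by gcongr
    _ ≤ _ := by
      refine mul_le_mul_of_nonneg_right ?_ (Real.exp_pos _).le
      rw [mul_one]
      have : (t / ρ) ^ d ≤ 2 ^ d * (t / r) ^ d := by
        rw [← Real.mul_rpow (by norm_num) (by positivity)]
        gcongr
        rw [hρ, div_le_iff₀ (by positivity)]
        field_simp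
        nlinarith
      have e : (2:ℝ) ^ (d + 2) = 4 * 2 ^ d := by
        rw [Real.rpow_add (by norm_num)]; norm_num; ring
      rw [e]
      nlinarith [show 0 ≤ 2 ^ d * (t / r) ^ d by positivity]

/-- The derivative of t^(d-1)(u₁ - a·k₁) is l²t^(d-1)(u - a·k) ≥ 0, and its value at 1 is 2u₁(1).
Hence the opposite-side kernel deviates from its limit no more than the same-side kernel does. -/
theorem cross_le_left (S : SolutionPair d l a k k₁ u u₁) (hl : 0 < l) {t : ℝ} (ht : 1 ≤ t) :
    a * (t ^ (d - 1) * k₁ t) + u₁ 1 ≤ t ^ (d - 1) * u₁ t - u₁ 1 := by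
  have hm : MonotoneOn (fun s => s ^ (d - 1) * u₁ s - a * (s ^ (d - 1) * k₁ s)) (Ici 1) := by
    refine monotoneOn_of_hasDerivAt_nonneg (convex_Ici 1)
      (fun s hs => (S.hasDerivAt_u₁ s (one_pos.trans_le hs)).sub
        ((S.hasDerivAt_k₁ s (one_pos.trans_le hs)).const_mul a)) ?_
    intro s hs
    have h0 : 0 < s := one_pos.trans_le hs
    have h1 := S.le_u s hs
    have : 0 ≤ l ^ 2 * s ^ (d - 1) * (u s - a * k s) := mul_nonneg (by positivity) (by linarith)
    linarith
  have := hm (mem_Ici.2 le_rfl) (mem_Ici.2 ht) ht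
  simp only [Real.one_rpow, one_mul] at this
  linarith [S.glue_deriv]

theorem cross_nonneg_left (S : SolutionPair d l a k k₁ u u₁) (hl : 0 < l) {t : ℝ} (ht : 1 ≤ t) :
    0 ≤ a * (t ^ (d - 1) * k₁ t) + u₁ 1 := by
  have h := S.monotoneOn_wk₁ (mem_Ioi.2 one_pos) (mem_Ioi.2 (one_pos.trans_le ht)) ht
  simp only [Real.one_rpow, one_mul] at h
  have := mul_le_mul_of_nonneg_left h (S.a_pos hl).le
  linarith [S.glue_deriv]

/-- The left side is the limiting kernel far below the diagonal; this form shows that the decay of k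
alone controls it. -/
theorem k_mul_u₁_one (S : SolutionPair d l a k k₁ u u₁) (r : ℝ) :
    k r * u₁ 1 = k r / (2 * k 1) := by
  have h1 := S.a_mul
  have h2 := S.pos 1 one_pos
  rw [S.glue_deriv, eq_div_iff (by positivity)]
  linear_combination 2 * k r * h1

/-- A path between the two sides runs through the gluing point, whence the exponent (r-1)+(t-1).
Integration in l turns it into a Stieltjes kernel. -/
theorem cross_le (S : SolutionPair d l a k k₁ u u₁) (hl : 0 < l) {r t : ℝ}
    (hr : 1 ≤ r) (ht : 1 ≤ t) :
    |a * k r * (t ^ (d - 1) * k₁ t)| ≤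
      t ^ (d - 1) * Real.exp (-(l * ((r - 1) + (t - 1)))) := by
  have h0 : 0 < t := by linarith
  have ha := S.a_pos hl
  have hk := S.pos r (by linarith)
  have hk1 := S.pos 1 one_pos
  have hk₁ := neg_pos.2 (S.k₁_neg hl h0)
  have e1 : |a * k r * (t ^ (d - 1) * k₁ t)| = a * k r * (t ^ (d - 1) * -k₁ t) := by
    rw [← abs_neg, abs_of_nonneg]
    · ring
    · have : 0 < a * k r * (t ^ (d - 1) * -k₁ t) := by positivity
      linarith
  have h1 := S.k_le_exp one_pos hr
  have h2 := S.decay 1 t one_pos ht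
  have e2 : Real.exp (-(l * ((r - 1) + (t - 1)))) =
      Real.exp (-(l * (r - 1))) * Real.exp (-(l * (t - 1))) := by
    rw [← Real.exp_add]; congr 1; ring
  rw [e1, e2]
  calc a * k r * (t ^ (d - 1) * -k₁ t)
      ≤ a * (k 1 * Real.exp (-(l * (r - 1)))) *
          (t ^ (d - 1) * (-k₁ 1 * Real.exp (-(l * (t - 1))))) := by gcongr
    _ = (a * (k 1 * -k₁ 1)) * (t ^ (d - 1) * (Real.exp (-(l * (r - 1))) *
          Real.exp (-(l * (t - 1))))) := by ring
    _ ≤ 1 * (t ^ (d - 1) * (Real.exp (-(l * (r - 1))) * Real.exp (-(l * (t - 1))))) := by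
        gcongr; rw [S.a_mul]; norm_num
    _ = _ := one_mul _

/-- Uses the monotonicity of t^(d-1)k₁ in place of its decay, so that no power of t appears. -/
theorem cross_le' (S : SolutionPair d l a k k₁ u u₁) (hl : 0 < l) {r t : ℝ}
    (hr : 1 ≤ r) (ht : 1 ≤ t) :
    |a * k r * (t ^ (d - 1) * k₁ t)| ≤ Real.exp (-(l * (r - 1))) := by
  have h0 : 0 < t := by linarith
  have ha := S.a_pos hl
  have hk := S.pos r (by linarith)
  have hk1 := S.pos 1 one_pos
  have hk₁ := neg_pos.2 (S.k₁_neg hl h0)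
  have e1 : |a * k r * (t ^ (d - 1) * k₁ t)| = a * k r * (t ^ (d - 1) * -k₁ t) := by
    rw [← abs_neg, abs_of_nonneg]
    · ring
    · have : 0 < a * k r * (t ^ (d - 1) * -k₁ t) := by positivity
      linarith
  have h1 := S.k_le_exp one_pos hr
  have h := S.monotoneOn_wk₁ (mem_Ioi.2 one_pos) (mem_Ioi.2 h0) ht
  simp only [Real.one_rpow, one_mul] at h
  rw [e1]
  calc a * k r * (t ^ (d - 1) * -k₁ t)
      ≤ a * (k 1 * Real.exp (-(l * (r - 1)))) * (-k₁ 1) := by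
        gcongr; linarith
    _ = (a * (k 1 * -k₁ 1)) * Real.exp (-(l * (r - 1))) := by ring
    _ ≤ 1 * Real.exp (-(l * (r - 1))) := by gcongr; rw [S.a_mul]; norm_num
    _ = _ := one_mul _

theorem cross_le_right (S : SolutionPair d l a k k₁ u u₁) (hl : 0 < l) {r : ℝ} (hr : 1 ≤ r)
    (t : ℝ) :
    |a * k r * (t ^ (d - 1) * k₁ t)| ≤ |u r * (t ^ (d - 1) * k₁ t)| := by
  rw [abs_mul, abs_mul (u r)]
  refine mul_le_mul_of_nonneg_right ?_ (abs_nonneg _)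
  rw [abs_of_pos (mul_pos (S.a_pos hl) (S.pos r (by linarith))), abs_of_pos (S.u_pos hl hr)]
  exact S.le_u r hr

theorem left_le_one (S : SolutionPair d l a k k₁ u u₁) (hl : 0 < l) {r t : ℝ}
    (ht : 1 ≤ t) (htr : t ≤ r) : |k r * (t ^ (d - 1) * u₁ t)| ≤ 1 := by
  have h0 : 0 < t := by linarith
  have h1 := S.wku₁_add ht
  have h2 := S.wuk₁_nonneg hl ht
  have h3 := S.k_le_exp h0 htr
  have hu := S.u₁_pos hl ht
  have hkt := S.pos t h0
  have hkr := S.pos r (by linarith)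
  have : Real.exp (-(l * (r - t))) ≤ 1 := by
    rw [Real.exp_le_one_iff]; nlinarith
  have h4 : k r ≤ k t := h3.trans (mul_le_of_le_one_right hkt.le this)
  rw [abs_of_nonneg (by positivity)]
  calc k r * (t ^ (d - 1) * u₁ t) ≤ k t * (t ^ (d - 1) * u₁ t) := by gcongr
    _ ≤ 1 := by linarith

theorem right_le_one (S : SolutionPair d l a k k₁ u u₁) (hl : 0 < l) {r t : ℝ}
    (hr : 1 ≤ r) (hrt : r ≤ t) : |u r * (t ^ (d - 1) * k₁ t)| ≤ 1 := by
  have ht := hr.trans hrt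
  have h0 : 0 < t := by linarith
  have h1 := S.wku₁_add ht
  have h2 := S.wku₁_nonneg hl ht
  have h3 := S.monotoneOn_u hl hr ht hrt
  have hk := neg_pos.2 (S.k₁_neg hl h0)
  have hu := S.u_pos hl hr
  rw [← abs_neg, abs_of_nonneg]
  · have : u r * (t ^ (d - 1) * -k₁ t) ≤ u t * (t ^ (d - 1) * -k₁ t) := by gcongr
    linarith
  · have : 0 ≤ u r * (t ^ (d - 1) * -k₁ t) := by positivity
    linarith

/-! ### Logarithmic decay in dimension at least two -/

/-- In r·k₁ = r^(2-d)·(r^(d-1)k₁) the second factor is negative and nondecreasing, and the first is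
nonincreasing because d ≥ 2. As r·k₁ is the derivative of k in log r, this is convexity. -/
theorem monotoneOn_mul_k₁ (S : SolutionPair d l a k k₁ u u₁) (hd : 2 ≤ d) (hl : 0 < l) :
    MonotoneOn (fun x => x * k₁ x) (Ioi 0) := by
  intro x hx r hr hxr
  have hx0 : 0 < x := hx
  have hr0 : 0 < r := hr
  have h := S.monotoneOn_wk₁ hx hr hxr
  simp only at h ⊢
  have ex : x ^ (d - 1) = x ^ (d - 2) * x := by
    rw [← Real.rpow_add_one hx0.ne']; congr 1; ring
  have er : r ^ (d - 1) = r ^ (d - 2) * r := by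
    rw [← Real.rpow_add_one hr0.ne']; congr 1; ring
  rw [ex, er] at h
  have hle : x ^ (d - 2) ≤ r ^ (d - 2) := Real.rpow_le_rpow hx0.le hxr (by linarith)
  have hxp : 0 < x ^ (d - 2) := by positivity
  have h3 : r ^ (d - 2) * (r * k₁ r) ≤ x ^ (d - 2) * (r * k₁ r) :=
    mul_le_mul_of_nonpos_right hle
      (mul_nonpos_of_nonneg_of_nonpos hr0.le (S.k₁_neg hl hr0).le)
  have h4 : x ^ (d - 2) * (x * k₁ x) ≤ x ^ (d - 2) * (r * k₁ r) := by linarith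
  exact le_of_mul_le_mul_left h4 hxp

/-- In dimension at least two, the decaying solution is convex as a function of `log r`. -/
theorem log_decay (S : SolutionPair d l a k k₁ u u₁) (hd : 2 ≤ d) (hl : 0 < l) {s r : ℝ}
    (hs : 0 < s) (hsr : s ≤ r) :
    r * -k₁ r * Real.log (r / s) ≤ k s - k r ∧ k s - k r ≤ s * -k₁ s * Real.log (r / s) := by
  have hr : 0 < r := by linarith
  have hmono := S.monotoneOn_mul_k₁ hd hl
  have hder : ∀ c : ℝ, ∀ x ∈ Icc s r, HasDerivAt (fun x => k x + c * -k₁ c * Real.log x)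
      ((x * k₁ x - c * k₁ c) * x⁻¹) x := by
    intro c x hx
    have hx0 : 0 < x := by linarith [hx.1]
    refine ((S.hasDerivAt_k x hx0).add
        ((Real.hasDerivAt_log hx0.ne').const_mul (c * -k₁ c))).congr_deriv ?_
    field_simp; ring
  rw [Real.log_div hr.ne' hs.ne', mul_sub, mul_sub]
  constructor
  · have hm : AntitoneOn (fun x => k x + r * -k₁ r * Real.log x) (Icc s r) := by
      refine antitoneOn_of_hasDerivAt_nonpos (convex_Icc s r) (hder r) fun x hx => ?_
      have hx0 : 0 < x := by linarith [hx.1]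
      have h2 : x * k₁ x ≤ r * k₁ r := hmono hx0 hr hx.2
      exact mul_nonpos_of_nonpos_of_nonneg (by linarith) (by positivity)
    have := hm (left_mem_Icc.2 hsr) (right_mem_Icc.2 hsr) hsr
    simp only at this
    linarith
  · have hm : MonotoneOn (fun x => k x + s * -k₁ s * Real.log x) (Icc s r) := by
      refine monotoneOn_of_hasDerivAt_nonneg (convex_Icc s r) (hder s) fun x hx => ?_
      have hx0 : 0 < x := by linarith [hx.1]
      have h2 : s * k₁ s ≤ x * k₁ x := hmono hs hx0 hx.1
      exact mul_nonneg (by linarith) (by positivity)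
    have := hm (left_mem_Icc.2 hsr) (right_mem_Icc.2 hsr) hsr
    simp only at this
    linarith

/-- In dimension at least two, the decaying solution decays logarithmically at low energies. -/
theorem k_mul_log_le (S : SolutionPair d l a k k₁ u u₁) (hd : 2 ≤ d) (hl : 0 < l) {r : ℝ}
    (hr : 4 ≤ r) :
    k r * Real.log r ≤ k 1 * (4 * (l * r) ^ (-(1 / 2) : ℝ) * Real.exp (-(l * (r / 2)))) := by
  have hr0 : 0 < r := by linarith
  have hlr : 0 < l * r := by positivity
  have hlog : 0 < Real.log r := Real.log_pos (by linarith)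
  have hk1 := S.pos 1 one_pos
  have hkr := S.pos r hr0
  -- For lr ≤ 1 the slope q = -r·k₁(r) in log r links two ranges: convexity on [1, r] gives q·log r
  -- ≤ k(1), and on [r, 1/l] it gives k(r) ≤ q(1 + log(1/(lr))), where the logarithm is at most a
  -- multiple of (lr)^(-1/2). For lr > 1 convexity is used up to r/2 only, and the decay from r/2 to
  -- r supplies the exponential.
  rcases le_or_gt (l * r) 1 with h | h
  · have hR : r ≤ 1 / l := by rw [le_div_iff₀ hl]; linarith
    have hR0 : 0 < 1 / l := by positivity
    have h1 := (S.log_decay hd hl one_pos (by linarith : (1:ℝ) ≤ r)).1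
    rw [div_one] at h1
    have h2 := (S.log_decay hd hl hr0 hR).2
    have h3 : k (1 / l) ≤ 1 / l * -k₁ (1 / l) := by
      have := S.deriv_le (1 / l) hR0
      calc k (1 / l) = 1 / l * (l * k (1 / l)) := by field_simp
        _ ≤ _ := by gcongr; linarith
    have h4 : r * k₁ r ≤ 1 / l * k₁ (1 / l) := S.monotoneOn_mul_k₁ hd hl hr0 hR0 hR
    set q := r * -k₁ r with hq
    have hq0 : 0 < q := mul_pos hr0 (neg_pos.2 (S.k₁_neg hl hr0))
    have h5 : Real.log (1 / l / r) ≤ 2 * (l * r) ^ (-(1 / 2) : ℝ) - 2 := by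
      have e : Real.log (1 / l / r) = 2 * Real.log ((l * r) ^ (-(1 / 2) : ℝ)) := by
        rw [Real.log_rpow hlr, div_div, Real.log_div one_ne_zero hlr.ne', Real.log_one]; ring
      rw [e]
      have := Real.log_le_sub_one_of_pos (x := (l * r) ^ (-(1 / 2) : ℝ)) (by positivity)
      linarith
    have h6 : k r ≤ q * (2 * (l * r) ^ (-(1 / 2) : ℝ)) := by
      have : q * Real.log (1 / l / r) ≤ q * (2 * (l * r) ^ (-(1 / 2) : ℝ) - 2) := by gcongr
      linarith
    have h7 : 1 / 2 ≤ Real.exp (-(l * (r / 2))) := by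
      have := Real.add_one_le_exp (-(l * (r / 2)))
      linarith
    have hy : 0 < (l * r) ^ (-(1 / 2) : ℝ) := by positivity
    calc k r * Real.log r ≤ q * (2 * (l * r) ^ (-(1 / 2) : ℝ)) * Real.log r := by gcongr
      _ = (q * Real.log r) * (2 * (l * r) ^ (-(1 / 2) : ℝ)) := by ring
      _ ≤ k 1 * (2 * (l * r) ^ (-(1 / 2) : ℝ)) := by gcongr; linarith
      _ = k 1 * (4 * (l * r) ^ (-(1 / 2) : ℝ) * (1 / 2)) := by ring
      _ ≤ _ := by gcongr
  · have h1 := (S.log_decay hd hl one_pos (by linarith : (1:ℝ) ≤ r / 2)).1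
    rw [div_one] at h1
    have h2 := S.k_le_exp (half_pos hr0) (by linarith : r / 2 ≤ r)
    rw [show r - r / 2 = r / 2 by ring] at h2
    have h3 := S.deriv_le (r / 2) (half_pos hr0)
    have hkh := S.pos (r / 2) (half_pos hr0)
    have h4 : Real.log r / 2 ≤ Real.log (r / 2) := by
      rw [Real.log_div hr0.ne' two_ne_zero]
      have : Real.log 4 ≤ Real.log r := Real.log_le_log (by norm_num) hr
      have e : Real.log 4 = 2 * Real.log 2 := by
        rw [show (4:ℝ) = 2 ^ 2 by norm_num, Real.log_pow]; norm_num
      linarith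
    have h5 : (l * r) / 4 * k (r / 2) * Real.log r ≤ k 1 := by
      calc (l * r) / 4 * k (r / 2) * Real.log r
          = r / 2 * (l * k (r / 2)) * (Real.log r / 2) := by ring
        _ ≤ r / 2 * -k₁ (r / 2) * Real.log (r / 2) := by
            gcongr
            · exact mul_nonneg (by positivity) (neg_pos.2 (S.k₁_neg hl (half_pos hr0))).le
            · linarith
        _ ≤ k 1 := by linarith
    have h6 : (l * r) ^ (-1 : ℝ) ≤ (l * r) ^ (-(1 / 2) : ℝ) :=
      Real.rpow_le_rpow_of_exponent_le h.le (by norm_num)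
    rw [Real.rpow_neg_one] at h6
    calc k r * Real.log r ≤ k (r / 2) * Real.exp (-(l * (r / 2))) * Real.log r := by gcongr
      _ = ((l * r) / 4 * k (r / 2) * Real.log r) *
            (4 * (l * r)⁻¹ * Real.exp (-(l * (r / 2)))) := by field_simp
      _ ≤ k 1 * (4 * (l * r) ^ (-(1 / 2) : ℝ) * Real.exp (-(l * (r / 2)))) := by gcongr

end SolutionPair

/-! ### Construction of the solution pair -/

/-- The decaying solution of `(r^(d-1) v')' = l² r^(d-1) v`. -/
def decaySol (d l r : ℝ) : ℝ := besselMoment d 0 (l * r)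

/-- The derivative of the decaying solution. -/
def decaySolDeriv (d l r : ℝ) : ℝ := -(l * besselMoment d 1 (l * r))

/-- A primitive of `y^(1-d) κ(y)⁻²`, where `κ` is the decaying solution for `l = 1`. -/
def besselPrimitive (d z : ℝ) : ℝ := ∫ y in (1:ℝ)..z, y ^ (1 - d) / besselMoment d 0 y ^ 2

/-- The factor by which the growing solution continues as the reflected decaying one. -/
def gluing (d l : ℝ) : ℝ := 1 / (2 * (decaySol d l 1 * -decaySolDeriv d l 1))

/-- The growing solution of `(r^(d-1) v')' = l² r^(d-1) v`. -/
def growSol (d l r : ℝ) : ℝ :=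
  decaySol d l r * (gluing d l + l ^ (d - 2) * (besselPrimitive d (l * r) - besselPrimitive d l))

/-- The derivative of the growing solution. -/
def growSolDeriv (d l r : ℝ) : ℝ :=
  decaySolDeriv d l r *
      (gluing d l + l ^ (d - 2) * (besselPrimitive d (l * r) - besselPrimitive d l)) +
    (r ^ (d - 1) * decaySol d l r)⁻¹

theorem continuousOn_besselMoment {d : ℝ} (hd : 1 < d) (n : ℕ) :
    ContinuousOn (besselMoment d n) (Ioi 0) := fun _ hz =>
  (hasDerivAt_besselMoment hd n hz).continuousAt.continuousWithinAt

theorem continuousOn_primitive_integrand {d : ℝ} (hd : 1 < d) :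
    ContinuousOn (fun y => y ^ (1 - d) / besselMoment d 0 y ^ 2) (Ioi 0) := by
  refine ContinuousOn.div ?_ ((continuousOn_besselMoment hd 0).pow 2) fun z hz => ?_
  · exact continuousOn_id.rpow_const fun z hz => Or.inl (ne_of_gt hz)
  · exact pow_ne_zero _ (besselMoment_zero_pos hd hz).ne'

theorem hasDerivAt_besselPrimitive {d : ℝ} (hd : 1 < d) {z : ℝ} (hz : 0 < z) :
    HasDerivAt (besselPrimitive d) (z ^ (1 - d) / besselMoment d 0 z ^ 2) z := by
  have hc := continuousOn_primitive_integrand hd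
  refine intervalIntegral.integral_hasDerivAt_right ?_ ?_ (hc.continuousAt (Ioi_mem_nhds hz))
  · refine (hc.mono fun y hy => ?_).intervalIntegrable
    rcases le_total 1 z with h | h
    · rw [uIcc_of_le h] at hy; exact one_pos.trans_le hy.1
    · rw [uIcc_of_ge h] at hy; exact hz.trans_le hy.1
  · exact hc.stronglyMeasurableAtFilter isOpen_Ioi z hz

/-- Reduction of order: u = k·J with J' = 1/(r^(d-1)k²) solves the equation and has Wronskian one
for every initial value of J. Taking J(1) = a, the gluing of the derivatives at 1 forces the value
`gluing d l`. Since J increases, u ≥ a·k beyond 1. -/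
theorem solutionPair {d : ℝ} (hd : 1 < d) {l : ℝ} (hl : 0 < l) :
    SolutionPair d l (gluing d l) (decaySol d l) (decaySolDeriv d l) (growSol d l)
      (growSolDeriv d l) := by
  have hpos : ∀ r, 0 < r → 0 < decaySol d l r := fun r hr =>
    besselMoment_zero_pos hd (mul_pos hl hr)
  have hle : ∀ r, 0 < r → decaySolDeriv d l r ≤ -(l * decaySol d l r) := by
    intro r hr
    have := besselMoment_le_succ hd 0 (mul_pos hl hr)
    simp only [decaySolDeriv, decaySol, zero_add] at this ⊢
    have := mul_le_mul_of_nonneg_left this hl.le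
    linarith
  have hmul : ∀ r, HasDerivAt (fun r : ℝ => l * r) l r := fun r => by
    simpa using (hasDerivAt_id r).const_mul l
  have hk : ∀ r, 0 < r → HasDerivAt (decaySol d l) (decaySolDeriv d l r) r := by
    intro r hr
    refine ((hasDerivAt_besselMoment hd 0 (mul_pos hl hr)).comp r (hmul r)).congr_deriv ?_
    simp only [decaySolDeriv]; ring
  have hk1 : ∀ r, 0 < r → HasDerivAt (decaySolDeriv d l) (l ^ 2 * besselMoment d 2 (l * r)) r := by
    intro r hr
    refine (((hasDerivAt_besselMoment hd 1 (mul_pos hl hr)).comp r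
      (hmul r)).const_mul l).neg.congr_deriv ?_
    simp only [Nat.reduceAdd]; ring
  have hwk1 : ∀ r, 0 < r → HasDerivAt (fun r => r ^ (d - 1) * decaySolDeriv d l r)
      (l ^ 2 * (r ^ (d - 1) * decaySol d l r)) r := by
    intro r hr
    refine ((hasDerivAt_weight d hr).mul (hk1 r hr)).congr_deriv ?_
    rw [besselMoment_ode hd (mul_pos hl hr)]
    simp only [decaySolDeriv, decaySol]
    field_simp
    ring
  -- The integral of 1/(s^(d-1)k(s)²) from 1 to r, rescaled by y = ls. One primitive then serves all
  -- l, and measurability in l is inherited from it.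
  set J : ℝ → ℝ := fun r => gluing d l +
    l ^ (d - 2) * (besselPrimitive d (l * r) - besselPrimitive d l) with hJ
  have hJd : ∀ r, 0 < r → HasDerivAt J ((r ^ (d - 1) * decaySol d l r ^ 2)⁻¹) r := by
    intro r hr
    refine (((((hasDerivAt_besselPrimitive hd (mul_pos hl hr)).comp r (hmul r)).sub_const
      (besselPrimitive d l)).const_mul (l ^ (d - 2))).const_add (gluing d l)).congr_deriv ?_
    have e1 : l ^ (d - 2) * l * l ^ (1 - d) = 1 := by
      rw [← Real.rpow_add_one hl.ne', ← Real.rpow_add hl]; ring_nf; simp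
    have e2 : r ^ (1 - d) = (r ^ (d - 1))⁻¹ := by rw [← Real.rpow_neg hr.le]; ring_nf
    rw [Real.mul_rpow hl.le hr.le, e2]
    simp only [decaySol]
    rw [mul_inv, div_eq_mul_inv]
    linear_combination ((r ^ (d - 1))⁻¹ * (besselMoment d 0 (l * r) ^ 2)⁻¹) * e1
  have hu : ∀ r, 0 < r → HasDerivAt (growSol d l) (growSolDeriv d l r) r := by
    intro r hr
    refine ((hk r hr).mul (hJd r hr)).congr_deriv ?_
    have := hpos r hr
    simp only [growSolDeriv, hJ]
    field_simp
  have hk1neg : decaySolDeriv d l 1 < 0 := by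
    have := hle 1 one_pos
    have := mul_pos hl (hpos 1 one_pos)
    linarith
  have hJ1 : J 1 = gluing d l := by simp [hJ]
  have ha : 2 * (gluing d l * (decaySol d l 1 * -decaySolDeriv d l 1)) = 1 := by
    have := hpos 1 one_pos
    have := hk1neg.ne
    rw [gluing]; field_simp
  have hgu : ∀ r, growSol d l r = decaySol d l r * J r := fun r => rfl
  have hgu1 : ∀ r, growSolDeriv d l r = decaySolDeriv d l r * J r +
    (r ^ (d - 1) * decaySol d l r)⁻¹ := fun r => rfl
  have hJge : ∀ r, 1 ≤ r → gluing d l ≤ J r := by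
    intro r hr
    have hm : MonotoneOn J (Ici 1) := monotoneOn_of_hasDerivAt_nonneg (convex_Ici 1)
      (fun x hx => hJd x (one_pos.trans_le hx)) fun x hx => by
        have h0 : 0 < x := one_pos.trans_le hx
        positivity
    have := hm (mem_Ici.2 le_rfl) (mem_Ici.2 hr) hr
    rwa [hJ1] at this
  refine ⟨hpos, hle, ?_, hk, hwk1, hu, ?_, ?_, ?_, ?_, ?_⟩
  · intro ρ t hρ ht
    have hanti : AntitoneOn (fun r => -decaySolDeriv d l r * Real.exp (l * r)) (Ioi 0) := by
      refine antitoneOn_of_hasDerivAt_nonpos (convex_Ioi 0) (f' := fun r =>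
        (l ^ 2 * (besselMoment d 1 (l * r) - besselMoment d 2 (l * r))) * Real.exp (l * r)) ?_ ?_
      · intro r hr
        have e4 : HasDerivAt (fun r : ℝ => Real.exp (l * r)) (Real.exp (l * r) * l) r :=
          (hmul r).exp
        refine ((hk1 r hr).neg.mul e4).congr_deriv ?_
        simp only [decaySolDeriv, Pi.neg_apply]; ring
      · intro r hr
        have := besselMoment_le_succ hd 1 (mul_pos hl hr)
        exact mul_nonpos_of_nonpos_of_nonneg
          (mul_nonpos_of_nonneg_of_nonpos (by positivity) (by linarith)) (by positivity)
    have h := hanti (mem_Ioi.2 hρ) (mem_Ioi.2 (hρ.trans_le ht)) ht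
    simp only at h
    have e : Real.exp (-(l * (t - ρ))) = Real.exp (l * ρ) * Real.exp (-(l * t)) := by
      rw [← Real.exp_add]; congr 1; ring
    rw [e, ← mul_assoc]
    calc -decaySolDeriv d l t
        = -decaySolDeriv d l t * Real.exp (l * t) * Real.exp (-(l * t)) := by
          rw [mul_assoc, ← Real.exp_add]; simp
      _ ≤ _ := by gcongr
  · intro r hr
    have h0 := hpos r hr
    have h1 : HasDerivAt (fun r => r ^ (d - 1) * decaySolDeriv d l r * J r + (decaySol d l r)⁻¹)
        (l ^ 2 * (r ^ (d - 1) * growSol d l r)) r := by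
      refine (((hwk1 r hr).mul (hJd r hr)).add ((hk r hr).inv h0.ne')).congr_deriv ?_
      rw [hgu]
      field_simp
      ring
    refine h1.congr_of_eventuallyEq ?_
    filter_upwards [Ioi_mem_nhds hr] with x hx
    have hx0 : 0 < x := hx
    have := hpos x hx
    rw [hgu1]
    field_simp
  · intro r hr
    have := hpos r hr
    rw [hgu, hgu1]
    field_simp
    ring
  · rw [hgu, hJ1, mul_comm]
  · rw [hgu1, hJ1, Real.one_rpow, one_mul]
    have := hpos 1 one_pos
    field_simp
    linarith
  · intro r hr
    have := hpos r (by linarith)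
    rw [hgu, mul_comm]
    exact mul_le_mul_of_nonneg_left (hJge r hr) this.le

/-! ### Minkowski's inequality, homogeneous kernels and convolutions -/

open scoped ENNReal

/-- Minkowski's integral inequality, for a family of functions with `∫ G(s, ·)^p ≤ C m(s)^p`. -/
theorem lintegral_rpow_lintegral_le {α β : Type*} [MeasurableSpace α] [MeasurableSpace β]
    (μ : Measure α) (ν : Measure β) [SFinite μ] [SFinite ν] {p : ℝ} (hp : 1 < p)
    {G : β → α → ℝ≥0∞} (hG : Measurable (Function.uncurry G)) {m : β → ℝ≥0∞} (hm : Measurable m)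
    (hm0 : ∀ᵐ s ∂ν, m s ≠ 0) (hm1 : ∀ᵐ s ∂ν, m s ≠ ⊤) (C : ℝ≥0∞)
    (h : ∀ᵐ s ∂ν, ∫⁻ r, G s r ^ p ∂μ ≤ C * m s ^ p) :
    ∫⁻ r, (∫⁻ s, G s r ∂ν) ^ p ∂μ ≤ C * (∫⁻ s, m s ∂ν) ^ p := by
  have hp0 : 0 < p := by linarith
  set q := p / (p - 1) with hq
  have hpq : p.HolderConjugate q := Real.HolderConjugate.conjExponent hp
  have hq0 : 0 < q := hpq.symm.pos
  have e1 : ∀ r, (∫⁻ s, G s r ∂ν) ^ p ≤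
      (∫⁻ s, m s ∂ν) ^ (p - 1) * ∫⁻ s, G s r ^ p * m s ^ (-(p - 1)) ∂ν := by
    intro r
    -- Hölder for G = (G·m^(-1/q))·m^(1/q). After Tonelli the hypothesis bounds the slice at s by
    -- C·m(s)^p·m(s)^(-(p-1)) = C·m(s).
    have h1 := ENNReal.lintegral_mul_le_Lp_mul_Lq ν hpq
      (f := fun s => G s r * m s ^ (-(1 / q))) (g := fun s => m s ^ (1 / q))
      ((hG.of_uncurry_right.mul (hm.pow_const _)).aemeasurable) (hm.pow_const _).aemeasurable
    have h2 : ∫⁻ s, G s r ∂ν = ∫⁻ s, ((fun s => G s r * m s ^ (-(1 / q))) *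
        fun s => m s ^ (1 / q)) s ∂ν := by
      refine lintegral_congr_ae ?_
      filter_upwards [hm0, hm1] with s h0 h1
      simp only [Pi.mul_apply]
      rw [mul_assoc, ← ENNReal.rpow_add _ _ h0 h1]
      simp
    rw [← h2] at h1
    have h3 : ∫⁻ s, (m s ^ (1 / q)) ^ q ∂ν = ∫⁻ s, m s ∂ν := by
      refine lintegral_congr fun s => ?_
      rw [← ENNReal.rpow_mul, one_div_mul_cancel hq0.ne', ENNReal.rpow_one]
    have h4 : ∫⁻ s, (G s r * m s ^ (-(1 / q))) ^ p ∂ν =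
        ∫⁻ s, G s r ^ p * m s ^ (-(p - 1)) ∂ν := by
      refine lintegral_congr fun s => ?_
      rw [ENNReal.mul_rpow_of_nonneg _ _ hp0.le, ← ENNReal.rpow_mul]
      congr 2
      rw [hq]; field_simp
    rw [h3, h4] at h1
    calc (∫⁻ s, G s r ∂ν) ^ p ≤ ((∫⁻ s, G s r ^ p * m s ^ (-(p - 1)) ∂ν) ^ (1 / p) *
          (∫⁻ s, m s ∂ν) ^ (1 / q)) ^ p := by gcongr
      _ = _ := by
        rw [ENNReal.mul_rpow_of_nonneg _ _ hp0.le, ← ENNReal.rpow_mul, ← ENNReal.rpow_mul,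
          one_div_mul_cancel hp0.ne', ENNReal.rpow_one, mul_comm]
        congr 2
        rw [hq]; field_simp
  have hmeas : Measurable (Function.uncurry fun r s => G s r ^ p * m s ^ (-(p - 1))) := by
    have : Measurable fun x : α × β => Function.uncurry G (x.2, x.1) :=
      hG.comp (measurable_snd.prodMk measurable_fst)
    exact (this.pow_const p).mul ((hm.comp measurable_snd).pow_const _)
  calc ∫⁻ r, (∫⁻ s, G s r ∂ν) ^ p ∂μ
      ≤ ∫⁻ r, (∫⁻ s, m s ∂ν) ^ (p - 1) * ∫⁻ s, G s r ^ p * m s ^ (-(p - 1)) ∂ν ∂μ :=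
        lintegral_mono e1
    _ = (∫⁻ s, m s ∂ν) ^ (p - 1) * ∫⁻ r, ∫⁻ s, G s r ^ p * m s ^ (-(p - 1)) ∂ν ∂μ :=
        lintegral_const_mul _ hmeas.lintegral_prod_right'
    _ = (∫⁻ s, m s ∂ν) ^ (p - 1) * ∫⁻ s, ∫⁻ r, G s r ^ p * m s ^ (-(p - 1)) ∂μ ∂ν := by
        rw [lintegral_lintegral_swap hmeas.aemeasurable]
    _ ≤ (∫⁻ s, m s ∂ν) ^ (p - 1) * ∫⁻ s, C * m s ∂ν := by
        refine mul_le_mul_right (lintegral_mono_ae ?_) _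
        filter_upwards [h, hm0, hm1] with s hs h0 h1
        rw [lintegral_mul_const _ (hG.of_uncurry_left.pow_const _)]
        calc _ ≤ C * m s ^ p * m s ^ (-(p - 1)) := by gcongr
          _ = C * m s := by
            rw [mul_assoc, ← ENNReal.rpow_add _ _ h0 h1]
            simp
    _ = _ := by
        rw [lintegral_const_mul _ hm]
        have : (∫⁻ s, m s ∂ν) ^ p = (∫⁻ s, m s ∂ν) ^ (p - 1) * (∫⁻ s, m s ∂ν) := by
          conv_rhs => rw [← ENNReal.rpow_one (∫⁻ s, m s ∂ν), ← ENNReal.rpow_mul,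
            one_mul, ← ENNReal.rpow_add_of_nonneg _ _ (by linarith) zero_le_one]
          simp
        rw [this]; ring

theorem lintegral_Ioi_scale {r : ℝ} (hr : 0 < r) (F : ℝ → ℝ≥0∞) :
    ∫⁻ t in Ioi 0, F t = ENNReal.ofReal r * ∫⁻ s in Ioi 0, F (r * s) := by
  have himg : (fun s => r * s) '' Ioi 0 = Ioi 0 := by
    ext t
    constructor
    · rintro ⟨s, hs, rfl⟩; exact mul_pos hr hs
    · intro ht; exact ⟨t / r, div_pos ht hr, by field_simp⟩
  have := lintegral_image_eq_lintegral_abs_deriv_mul (measurableSet_Ioi (a := (0:ℝ)))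
    (f := fun s => r * s) (f' := fun _ => r)
    (fun x _ => by simpa using ((hasDerivAt_id x).const_mul r).hasDerivWithinAt)
    (fun x _ y _ h => mul_left_cancel₀ hr.ne' h) F
  rw [himg, abs_of_pos hr] at this
  rw [this, lintegral_const_mul' _ _ ENNReal.ofReal_ne_top]

/-- Integral operators with kernels homogeneous of degree `-1` on weighted spaces. -/
theorem lintegral_homogeneous_le {p : ℝ} (hp : 1 < p) (b : ℝ) {κ g : ℝ → ℝ≥0∞}
    (hκ : Measurable κ) (hg : Measurable g) :
    ∫⁻ r in Ioi 0, (∫⁻ t in Ioi 0, ENNReal.ofReal r⁻¹ * κ (t / r) * g t) ^ p *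
        ENNReal.ofReal (r ^ b) ≤
      (∫⁻ s in Ioi 0, κ s * ENNReal.ofReal (s ^ (-((b + 1) / p)))) ^ p *
        ∫⁻ t in Ioi 0, g t ^ p * ENNReal.ofReal (t ^ b) := by
  have hp0 : 0 < p := by linarith
  set ν := (volume.restrict (Ioi (0:ℝ))).withDensity κ with hν
  set μ := (volume.restrict (Ioi (0:ℝ))).withDensity fun r => ENNReal.ofReal (r ^ b) with hμ
  have hae : ∀ᵐ s ∂ν, 0 < s :=
    (withDensity_absolutelyContinuous _ _).ae_le (ae_restrict_mem measurableSet_Ioi)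
  -- The substitution t = rs exhibits the operator as a superposition, with density κ(s), of the
  -- dilations g(r) ↦ g(rs), whose norm on L^p(r^b dr) is s^(-(b+1)/p).
  have key := lintegral_rpow_lintegral_le μ ν hp (G := fun s r => g (r * s))
    (m := fun s => ENNReal.ofReal (s ^ (-((b + 1) / p))))
    (by exact hg.comp (measurable_snd.mul measurable_fst)) (by fun_prop)
    (by
      filter_upwards [hae] with s hs
      have : 0 < s ^ (-((b + 1) / p)) := by positivity
      simpa using this)
    (by simp) (∫⁻ t in Ioi 0, g t ^ p * ENNReal.ofReal (t ^ b))
    (by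
      filter_upwards [hae] with s hs
      rw [hμ, lintegral_withDensity_eq_lintegral_mul _ (by fun_prop) (by fun_prop)]
      rw [lintegral_Ioi_scale hs fun t => g t ^ p * ENNReal.ofReal (t ^ b)]
      rw [ENNReal.ofReal_rpow_of_nonneg (by positivity) hp0.le, ← Real.rpow_mul hs.le]
      rw [mul_right_comm, ← ENNReal.ofReal_mul (by positivity),
        ← lintegral_const_mul' _ _ ENNReal.ofReal_ne_top]
      refine setLIntegral_mono' measurableSet_Ioi fun r hr => ?_
      have hr0 : 0 < r := hr
      simp only [Pi.mul_apply]
      rw [Real.mul_rpow hs.le hr0.le, mul_comm (g (s * r) ^ p), ← mul_assoc,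
        ← ENNReal.ofReal_mul (by positivity), mul_comm r s]
      refine mul_le_mul_left (ENNReal.ofReal_le_ofReal (le_of_eq ?_)) _
      have e : -((b + 1) / p) * p = -(b + 1) := by field_simp
      rw [e, ← mul_assoc, Real.rpow_neg hs.le, Real.rpow_add_one hs.ne']
      field_simp)
  rw [hμ, lintegral_withDensity_eq_lintegral_mul₀] at key
  rotate_left
  · fun_prop
  · have : Measurable fun x : ℝ × ℝ => g (x.1 * x.2) := hg.comp (measurable_fst.mul measurable_snd)
    exact (this.lintegral_prod_right'.pow_const p).aemeasurable
  rw [mul_comm]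
  refine le_trans (le_of_eq ?_) (key.trans (le_of_eq ?_))
  · refine setLIntegral_congr_fun measurableSet_Ioi fun r hr => ?_
    have hr0 : 0 < r := hr
    simp only [Pi.mul_apply]
    rw [mul_comm]
    congr 2
    rw [lintegral_Ioi_scale hr0, ← lintegral_const_mul' _ _ ENNReal.ofReal_ne_top, hν,
      lintegral_withDensity_eq_lintegral_mul _ hκ (by fun_prop)]
    refine setLIntegral_congr_fun measurableSet_Ioi fun s _ => ?_
    simp only [Pi.mul_apply]
    rw [← mul_assoc, ← mul_assoc, ← ENNReal.ofReal_mul hr0.le, mul_inv_cancel₀ hr0.ne',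
      ENNReal.ofReal_one, one_mul, mul_div_cancel_left₀ _ hr0.ne']
  · rw [hν, lintegral_withDensity_eq_lintegral_mul _ hκ (by fun_prop)]
    rfl

/-- Young's inequality for convolution with an integrable kernel. -/
theorem lintegral_convolution_le {p : ℝ} (hp : 1 < p) {κ g : ℝ → ℝ≥0∞}
    (hκ : Measurable κ) (hg : Measurable g) :
    ∫⁻ x, (∫⁻ t, κ (x - t) * g t) ^ p ≤ (∫⁻ s, κ s) ^ p * ∫⁻ t, g t ^ p := by
  have key := lintegral_rpow_lintegral_le volume (volume.withDensity κ) hp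
    (G := fun s r => g (r - s)) (m := fun _ => 1)
    (by exact hg.comp (measurable_snd.sub measurable_fst)) measurable_const (by simp) (by simp)
    (∫⁻ t, g t ^ p) (by
      refine Eventually.of_forall fun s => ?_
      rw [lintegral_sub_right_eq_self (fun x => g x ^ p) s]; simp)
  rw [mul_comm]
  refine le_trans (le_of_eq ?_) (key.trans (le_of_eq ?_))
  · refine lintegral_congr fun x => ?_
    rw [lintegral_withDensity_eq_lintegral_mul _ hκ (by fun_prop),
      ← lintegral_sub_left_eq_self _ x]
    simp
  · rw [lintegral_withDensity_eq_lintegral_mul _ hκ (by fun_prop)]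
    simp

/-! ### M. Riesz' theorem by complex analysis and duality -/

/-- Bounded measurable functions with compact support. -/
structure IsBddCompact (φ : ℝ → ℝ) : Prop where
  measurable : Measurable φ
  bounded : ∃ B, ∀ t, |φ t| ≤ B
  support : ∃ M, ∀ t, M < |t| → φ t = 0

theorem IsBddCompact.integrable {φ : ℝ → ℝ} (h : IsBddCompact φ) : Integrable φ := by
  obtain ⟨B, hB⟩ := h.bounded
  obtain ⟨M, hM⟩ := h.support
  have h1 : IntegrableOn φ (Icc (-M) M) :=
    Measure.integrableOn_of_bounded (M := B) (by simp) h.measurable.aestronglyMeasurable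
      (Eventually.of_forall hB)
  rw [← integrableOn_univ]
  refine h1.of_forall_sdiff_eq_zero MeasurableSet.univ fun t ht => hM t ?_
  by_contra hcon
  exact ht.2 (abs_le.1 (not_lt.1 hcon))

/-- The conjugate Poisson integral (up to the factor `π`). -/
def conjPoisson (ε : ℝ) (φ : ℝ → ℝ) (x : ℝ) : ℝ :=
  ∫ t, (x - t) / ((x - t) ^ 2 + ε ^ 2) * φ t

theorem abs_div_sq_add_sq_le {ε : ℝ} (hε : 0 < ε) (y : ℝ) : |y / (y ^ 2 + ε ^ 2)| ≤ 1 / ε := by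
  rw [abs_div, abs_of_pos (show 0 < y ^ 2 + ε ^ 2 by positivity), div_le_div_iff₀ (by positivity) hε]
  nlinarith [sq_nonneg (|y| - ε), sq_abs y, abs_nonneg y, sq_nonneg ε]

theorem lintegral_poisson {ε : ℝ} (hε : 0 < ε) :
    ∫⁻ s : ℝ, ENNReal.ofReal (ε / (s ^ 2 + ε ^ 2)) = ENNReal.ofReal Real.pi := by
  have h1 : ∀ s : ℝ, ε / (s ^ 2 + ε ^ 2) = ε⁻¹ * (1 + (ε⁻¹ * s) ^ 2)⁻¹ := by
    intro s; field_simp; ring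
  have h2 : Integrable fun s : ℝ => (1 + (ε⁻¹ * s) ^ 2)⁻¹ :=
    integrable_inv_one_add_sq.comp_mul_left' (inv_ne_zero hε.ne')
  rw [← ofReal_integral_eq_lintegral_ofReal]
  · congr 1
    simp_rw [h1]
    rw [integral_const_mul, Measure.integral_comp_mul_left (fun y : ℝ => (1 + y ^ 2)⁻¹)]
    rw [integral_univ_inv_one_add_sq, inv_inv, abs_of_pos hε]
    simp [hε.ne']
  · simp_rw [h1]; exact h2.const_mul _
  · exact Eventually.of_forall fun s => by positivity

/-- The elementary inequality behind M. Riesz' theorem. -/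
theorem exists_abs_im_rpow_le {p : ℝ} (hp : 1 < p) (hp2 : p ≤ 2) :
    ∃ A B : ℝ, 0 ≤ A ∧ 0 ≤ B ∧ ∀ z : ℂ, 0 < z.re →
      |z.im| ^ p ≤ A * z.re ^ p - B * (z ^ (p : ℂ)).re := by
  have hpi := Real.pi_pos
  have hp0 : 0 < p := by linarith
  -- Here pθ₀ = π(p+1)/4 lies strictly between π/2 and pπ/2. For θ₀ < |θ| < π/2 one has cos(pθ) ≤
  -- cos(pθ₀) < 0, and B is chosen to make -B·cos(pθ) at least 1; monotonicity of the cosine needs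
  -- p|θ| ≤ π, hence p ≤ 2. For |θ| ≤ θ₀ the cosine of θ is bounded below and A compensates for
  -- everything.
  set θ₀ := Real.pi * (p + 1) / (4 * p) with hθ₀
  have h1 : p * θ₀ = Real.pi * (p + 1) / 4 := by rw [hθ₀]; field_simp
  have hδ : Real.cos (p * θ₀) < 0 := by
    apply Real.cos_neg_of_pi_div_two_lt_of_lt
    · rw [h1]; nlinarith
    · rw [h1]; nlinarith
  have hθ0 : 0 < θ₀ := by positivity
  have hθ1 : θ₀ < Real.pi / 2 := by
    rw [hθ₀, div_lt_div_iff₀ (by positivity) (by norm_num)]; nlinarith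
  have hc : 0 < Real.cos θ₀ := Real.cos_pos_of_mem_Ioo ⟨by linarith, hθ1⟩
  set B := 1 / -Real.cos (p * θ₀) with hB
  have hB0 : 0 < B := by rw [hB]; exact div_pos one_pos (by linarith)
  set A := (1 + B) / Real.cos θ₀ ^ p with hA
  have hA0 : 0 < A := by rw [hA]; positivity
  refine ⟨A, B, hA0.le, hB0.le, fun z hz => ?_⟩
  have hz0 : z ≠ 0 := by rintro rfl; simp at hz
  set ρ := ‖z‖ with hρ
  have hρ0 : 0 < ρ := norm_pos_iff.2 hz0
  set θ := z.arg with hθ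
  have habs : |θ| < Real.pi / 2 := Complex.abs_arg_lt_pi_div_two_iff.2 (Or.inl hz)
  have hre : z.re = ρ * Real.cos θ := (Complex.norm_mul_cos_arg z).symm
  have him : z.im = ρ * Real.sin θ := (Complex.norm_mul_sin_arg z).symm
  have hcpow : (z ^ (p : ℂ)).re = ρ ^ p * Real.cos (p * θ) := by
    rw [Complex.cpow_def_of_ne_zero hz0, Complex.exp_re]
    have e1 : (Complex.log z * (p : ℂ)).re = Real.log ρ * p := by
      rw [Complex.re_mul_ofReal, Complex.log_re]
    have e2 : (Complex.log z * (p : ℂ)).im = p * θ := by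
      rw [Complex.im_mul_ofReal, Complex.log_im, mul_comm]
    rw [e1, e2, Real.rpow_def_of_pos hρ0]
  have hcos : 0 < Real.cos θ := Real.cos_pos_of_mem_Ioo (abs_lt.1 habs)
  rw [hcpow, him, hre, abs_mul, abs_of_pos hρ0, Real.mul_rpow hρ0.le (abs_nonneg _),
    Real.mul_rpow hρ0.le hcos.le]
  suffices |Real.sin θ| ^ p ≤ A * Real.cos θ ^ p - B * Real.cos (p * θ) by
    have := mul_le_mul_of_nonneg_left this (Real.rpow_nonneg hρ0.le p)
    linarith
  have hs : |Real.sin θ| ^ p ≤ 1 :=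
    Real.rpow_le_one (abs_nonneg _) (Real.abs_sin_le_one θ) hp0.le
  rcases le_or_gt |θ| θ₀ with h | h
  · have h2 : Real.cos θ₀ ≤ Real.cos θ := by
      rw [← Real.cos_abs θ]
      exact Real.cos_le_cos_of_nonneg_of_le_pi (abs_nonneg _) (by linarith) h
    have h3 : 1 + B ≤ A * Real.cos θ ^ p := by
      calc 1 + B = A * Real.cos θ₀ ^ p := by rw [hA]; field_simp
        _ ≤ _ := by gcongr
    have h4 : B * Real.cos (p * θ) ≤ B * 1 := by gcongr; exact Real.cos_le_one _
    linarith
  · have h2 : Real.cos (p * θ) ≤ Real.cos (p * θ₀) := by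
      rw [← Real.cos_abs (p * θ), abs_mul, abs_of_pos hp0]
      refine Real.cos_le_cos_of_nonneg_of_le_pi (by positivity) ?_ (by gcongr)
      nlinarith
    have h3 : B * Real.cos (p * θ) ≤ B * Real.cos (p * θ₀) := by gcongr
    have h4 : B * Real.cos (p * θ₀) = -1 := by
      have := hδ.ne
      rw [hB]; field_simp
    have h5 : 0 ≤ A * Real.cos θ ^ p := by positivity
    linarith

/-- The holomorphic function on the upper half plane with real part the Poisson integral and
imaginary part the conjugate Poisson integral. -/
def poissonExt (φ : ℝ → ℝ) (z : ℂ) : ℂ := ∫ t : ℝ, Complex.I / (z - t) * (φ t : ℂ)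

theorem im_le_norm_sub_ofReal (z : ℂ) (t : ℝ) : |z.im| ≤ ‖z - t‖ := by
  simpa using Complex.abs_im_le_norm (z - t)

theorem poissonExt_integrable {φ : ℝ → ℝ} (h : Integrable φ) {z : ℂ} (hz : 0 < z.im) :
    Integrable fun t : ℝ => Complex.I / (z - t) * (φ t : ℂ) := by
  refine (h.ofReal (𝕜 := ℂ)).bdd_mul (c := 1 / z.im) ?_ ?_
  · exact Measurable.aestronglyMeasurable (by fun_prop)
  · refine Eventually.of_forall fun t => ?_
    rw [norm_div, Complex.norm_I]
    have := im_le_norm_sub_ofReal z t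
    rw [abs_of_pos hz] at this
    gcongr

theorem poissonExt_hasDerivAt {φ : ℝ → ℝ} (h : Integrable φ) {z : ℂ} (hz : 0 < z.im) :
    DifferentiableAt ℂ (poissonExt φ) z := by
  have hball : ∀ w ∈ Metric.ball z (z.im / 2), z.im / 2 < w.im := by
    intro w hw
    have h1 : |(w - z).im| ≤ ‖w - z‖ := Complex.abs_im_le_norm _
    rw [Metric.mem_ball, dist_eq_norm] at hw
    have := abs_le.1 h1
    rw [Complex.sub_im] at this
    linarith [this.1]
  have hne : ∀ w : ℂ, 0 < w.im → ∀ t : ℝ, w - t ≠ 0 := by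
    intro w hw t h0
    have := im_le_norm_sub_ofReal w t
    rw [h0, norm_zero, abs_of_pos hw] at this
    linarith
  refine (hasDerivAt_integral_of_dominated_loc_of_deriv_le
    (F := fun (z : ℂ) (t : ℝ) => Complex.I / (z - t) * (φ t : ℂ))
    (F' := fun (z : ℂ) (t : ℝ) => -Complex.I / (z - t) ^ 2 * (φ t : ℂ))
    (bound := fun t => 1 / (z.im / 2) ^ 2 * ‖φ t‖) (μ := volume)
    (Metric.ball_mem_nhds z (half_pos hz)) ?_ (poissonExt_integrable h hz) ?_ ?_ ?_ ?_).2
      |>.differentiableAt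
  · filter_upwards [Metric.ball_mem_nhds z (half_pos hz)] with w hw
    exact (poissonExt_integrable h ((half_pos hz).trans (hball w hw))).aestronglyMeasurable
  · refine AEStronglyMeasurable.mul (Measurable.aestronglyMeasurable (by fun_prop)) ?_
    exact (h.ofReal (𝕜 := ℂ)).aestronglyMeasurable
  · refine Eventually.of_forall fun t w hw => ?_
    have h1 := hball w hw
    have h2 := im_le_norm_sub_ofReal w t
    rw [abs_of_pos ((half_pos hz).trans h1)] at h2
    have h3 : z.im / 2 ≤ ‖w - t‖ := h1.le.trans h2
    rw [norm_mul, norm_div, norm_neg, Complex.norm_I, norm_pow, Complex.norm_real]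
    gcongr
  · exact h.norm.const_mul _
  · refine Eventually.of_forall fun t w hw => ?_
    have h0 := hne w ((half_pos hz).trans (hball w hw)) t
    have h1 : HasDerivAt (fun w : ℂ => w - t) 1 w := (hasDerivAt_id w).sub_const _
    have h2 := ((hasDerivAt_const w Complex.I).div h1 h0).mul_const (φ t : ℂ)
    refine h2.congr_deriv ?_
    simp

theorem poissonExt_apply {φ : ℝ → ℝ} (h : Integrable φ) {x y : ℝ} (hy : 0 < y) :
    (poissonExt φ (x + y * Complex.I)).re = ∫ t, y / ((x - t) ^ 2 + y ^ 2) * φ t ∧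
    (poissonExt φ (x + y * Complex.I)).im = conjPoisson y φ x := by
  have hz : 0 < ((x : ℂ) + y * Complex.I).im := by simpa using hy
  have hi := poissonExt_integrable h hz
  have key : ∀ t : ℝ, Complex.I / ((x : ℂ) + y * Complex.I - t) * (φ t : ℂ) =
      ((y / ((x - t) ^ 2 + y ^ 2) * φ t : ℝ) : ℂ) +
        (((x - t) / ((x - t) ^ 2 + y ^ 2) * φ t : ℝ) : ℂ) * Complex.I := by
    intro t
    have h1 : ((x : ℂ) + y * Complex.I - t) ≠ 0 := by
      intro h0
      have := congrArg Complex.im h0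
      simp at this; exact hy.ne' this
    have h2 : (((x - t) ^ 2 + y ^ 2 : ℝ) : ℂ) ≠ 0 := by
      exact_mod_cast (show (x - t) ^ 2 + y ^ 2 ≠ 0 by positivity)
    have h3 : Complex.I / ((x : ℂ) + y * Complex.I - t) =
        ((y : ℂ) + (x - t) * Complex.I) / (((x - t) ^ 2 + y ^ 2 : ℝ) : ℂ) := by
      rw [div_eq_div_iff h1 h2]
      push_cast
      linear_combination -((y : ℂ) * (x - t)) * Complex.I_sq
    rw [h3]
    push_cast
    ring
  constructor
  · have := integral_re hi
    rw [poissonExt]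
    refine Eq.trans this.symm ?_
    refine integral_congr_ae (Eventually.of_forall fun t => ?_)
    simp only [key t]
    generalize y / ((x - t) ^ 2 + y ^ 2) * φ t = a
    generalize (x - t) / ((x - t) ^ 2 + y ^ 2) * φ t = b
    simp
  · have := integral_im hi
    rw [poissonExt, conjPoisson]
    refine Eq.trans this.symm ?_
    refine integral_congr_ae (Eventually.of_forall fun t => ?_)
    simp only [key t]
    generalize y / ((x - t) ^ 2 + y ^ 2) * φ t = a
    generalize (x - t) / ((x - t) ^ 2 + y ^ 2) * φ t = b
    simp

theorem norm_poissonExt_le {φ : ℝ → ℝ} (h : Integrable φ) {M δ : ℝ} (hδ : 0 < δ)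
    (hM : ∀ t, M < |t| → φ t = 0) {z : ℂ} (hz : ∀ t : ℝ, |t| ≤ M → δ ≤ ‖z - t‖) :
    ‖poissonExt φ z‖ ≤ (∫ t, |φ t|) / δ := by
  rw [poissonExt]
  refine (norm_integral_le_of_norm_le (h.norm.const_mul (1 / δ))
    (Eventually.of_forall fun t => ?_)).trans (le_of_eq ?_)
  · rw [norm_mul, norm_div, Complex.norm_I, Complex.norm_real]
    rcases le_or_gt |t| M with ht | ht
    · have := hz t ht
      gcongr
    · rw [hM t ht]; simp
  · rw [integral_const_mul]; simp only [Real.norm_eq_abs]; ring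

/-- Strict positivity keeps the values of the extension in the right half-plane, where the principal
branch of the power is holomorphic. -/
theorem poissonExt_re_pos {φ : ℝ → ℝ} (h : Integrable φ) (h0 : ∀ t, 0 ≤ φ t)
    (hne : ¬ φ =ᵐ[volume] 0) {z : ℂ} (hz : 0 < z.im) : 0 < (poissonExt φ z).re := by
  rw [← Complex.re_add_im z, (poissonExt_apply h hz).1]
  have hnn : ∀ t, 0 ≤ z.im / ((z.re - t) ^ 2 + z.im ^ 2) * φ t := fun t =>
    mul_nonneg (by positivity) (h0 t)
  refine lt_of_le_of_ne (integral_nonneg hnn) fun heq => hne ?_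
  have hintg : Integrable fun t => z.im / ((z.re - t) ^ 2 + z.im ^ 2) * φ t := by
    refine h.bdd_mul (c := 1 / z.im) (Measurable.aestronglyMeasurable (by fun_prop)) ?_
    refine Eventually.of_forall fun t => ?_
    rw [Real.norm_of_nonneg (by positivity), div_le_div_iff₀ (by positivity) hz]
    nlinarith [sq_nonneg (z.re - t)]
  have := (integral_eq_zero_iff_of_nonneg hnn hintg).1 heq.symm
  filter_upwards [this] with t ht
  have hpos : 0 < z.im / ((z.re - t) ^ 2 + z.im ^ 2) := by positivity
  simpa [hpos.ne'] using ht

/-- Cauchy's theorem for F^p on the rectangle [-R, R] × [ε, R], with F = `poissonExt φ`. The other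
three sides keep distance R/2 from the support of φ, so there |F|^p = O(R^(-p)) against a length
O(R). Because p > 1, the integral of F^p along the bottom line vanishes in the limit. -/
theorem norm_integral_poissonExt_rpow_le {p : ℝ} (hp : 1 < p) {φ : ℝ → ℝ} (h : Integrable φ)
    (hre : ∀ z : ℂ, 0 < z.im → 0 < (poissonExt φ z).re) {M : ℝ} (hM0 : 0 ≤ M)
    (hM : ∀ t, M < |t| → φ t = 0) {ε R : ℝ} (hε : 0 < ε) (hR : 2 * M + ε + 1 ≤ R) :
    ‖∫ x in (-R)..R, poissonExt φ (x + ε * Complex.I) ^ (p : ℂ)‖ ≤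
      4 * (2 * ∫ t, |φ t|) ^ p * R ^ (-(p - 1)) := by
  have hp0 : 0 < p := by linarith
  have hR0 : 0 < R := by linarith
  set m := ∫ t, |φ t| with hm
  have hm0 : 0 ≤ m := integral_nonneg fun t => abs_nonneg _
  set G : ℂ → ℂ := fun z => poissonExt φ z ^ (p : ℂ) with hG
  have hdiff : DifferentiableOn ℂ G {z | 0 < z.im} := by
    intro z hz
    exact ((poissonExt_hasDerivAt h hz).cpow_const
      (Or.inl (hre z hz))).differentiableWithinAt
  have hrect := Complex.integral_boundary_rect_eq_zero_of_differentiableOn G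
    ⟨-R, ε⟩ ⟨R, R⟩ (hdiff.mono (by
      rintro z ⟨-, hz⟩
      have : z.im ∈ Icc ε R := by
        have h1 : z.im ∈ uIcc ε R := hz
        rwa [uIcc_of_le (by linarith)] at h1
      exact hε.trans_le this.1))
  simp only at hrect
  have hbound : ∀ z : ℂ, (∀ t : ℝ, |t| ≤ M → R / 2 ≤ ‖z - t‖) → ‖G z‖ ≤ (m / (R / 2)) ^ p := by
    intro z hz
    rw [hG]
    simp only [Complex.norm_cpow_real]
    gcongr
    exact norm_poissonExt_le h (by positivity) hM hz
  have b1 : ‖∫ x in (-R)..R, G (x + (R : ℝ) * Complex.I)‖ ≤ (m / (R / 2)) ^ p * |R - -R| := by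
    refine intervalIntegral.norm_integral_le_of_norm_le_const fun x _ => hbound _ fun t _ => ?_
    have := im_le_norm_sub_ofReal (x + (R : ℝ) * Complex.I) t
    simp only [Complex.add_im, Complex.ofReal_im, Complex.mul_im, Complex.ofReal_re, Complex.I_im,
      Complex.I_re, mul_one, mul_zero, add_zero, zero_add] at this
    rw [abs_of_pos hR0] at this
    linarith
  have hre' : ∀ (s y t : ℝ), |s - t| ≤ ‖(s : ℂ) + y * Complex.I - t‖ := by
    intro s y t
    simpa using Complex.abs_re_le_norm ((s : ℂ) + y * Complex.I - t)
  have b2 : ‖∫ y in ε..R, G ((R : ℝ) + y * Complex.I)‖ ≤ (m / (R / 2)) ^ p * |R - ε| := by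
    refine intervalIntegral.norm_integral_le_of_norm_le_const fun y _ => hbound _ fun t ht => ?_
    refine le_trans ?_ (hre' R y t)
    have := abs_le.1 ht
    rw [abs_of_pos (by linarith)]; linarith
  have b3 : ‖∫ y in ε..R, G ((-R : ℝ) + y * Complex.I)‖ ≤ (m / (R / 2)) ^ p * |R - ε| := by
    refine intervalIntegral.norm_integral_le_of_norm_le_const fun y _ => hbound _ fun t ht => ?_
    refine le_trans ?_ (hre' (-R) y t)
    have := abs_le.1 ht
    rw [abs_of_neg (by linarith)]; linarith
  have e : ∫ x in (-R)..R, G (x + ε * Complex.I) = (∫ x in (-R)..R, G (x + (R : ℝ) * Complex.I)) -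
      Complex.I • (∫ y in ε..R, G ((R : ℝ) + y * Complex.I)) +
      Complex.I • (∫ y in ε..R, G ((-R : ℝ) + y * Complex.I)) := by
    linear_combination hrect
  have hc : 0 ≤ (m / (R / 2)) ^ p := by positivity
  calc ‖∫ x in (-R)..R, G (x + ε * Complex.I)‖
      ≤ (m / (R / 2)) ^ p * |R - -R| + (m / (R / 2)) ^ p * |R - ε| +
          (m / (R / 2)) ^ p * |R - ε| := by
        rw [e]
        refine (norm_add_le _ _).trans (add_le_add ((norm_sub_le _ _).trans
          (add_le_add b1 ?_)) ?_)
        · rw [norm_smul, Complex.norm_I, one_mul]; exact b2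
        · rw [norm_smul, Complex.norm_I, one_mul]; exact b3
    _ ≤ (m / (R / 2)) ^ p * (4 * R) := by
        rw [abs_of_pos (by linarith : 0 < R - -R), abs_of_pos (by linarith : 0 < R - ε)]
        nlinarith
    _ = _ := by
        have e1 : m / (R / 2) = 2 * m / R := by field_simp
        rw [e1, Real.div_rpow (by positivity) hR0.le, neg_sub, Real.rpow_sub hR0, Real.rpow_one]
        ring

/-- Integrate `exists_abs_im_rpow_le` along Im z = ε. The real part of F is a Poisson integral,
controlled by convolution with a kernel of mass π, and the term Re F^p drops out as R → ∞. The case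
φ = 0 almost everywhere is separate, because then Re F is not positive. -/
theorem conjPoisson_nonneg_le {p : ℝ} (hp : 1 < p) (hp2 : p ≤ 2) :
    ∃ C : ℝ≥0∞, C ≠ ⊤ ∧ ∀ ε : ℝ, 0 < ε → ∀ φ : ℝ → ℝ, IsBddCompact φ → (∀ t, 0 ≤ φ t) →
      ∫⁻ x, ‖conjPoisson ε φ x‖ₑ ^ p ≤ C * ∫⁻ t, ‖φ t‖ₑ ^ p := by
  have hp0 : 0 < p := by linarith
  obtain ⟨A, B, hA, hB, hAB⟩ := exists_abs_im_rpow_le hp hp2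
  refine ⟨ENNReal.ofReal A * ENNReal.ofReal Real.pi ^ p, by finiteness, ?_⟩
  intro ε hε φ hφ h0
  have hintg := hφ.integrable
  by_cases hne : φ =ᵐ[volume] 0
  · have : ∀ x, conjPoisson ε φ x = 0 := by
      intro x
      rw [conjPoisson]
      refine (integral_congr_ae ?_).trans (integral_zero _ _)
      filter_upwards [hne] with t ht
      simp [ht]
    simp [this, hp0]
  have hre : ∀ z : ℂ, 0 < z.im → 0 < (poissonExt φ z).re := fun z hz =>
    poissonExt_re_pos hintg h0 hne hz
  obtain ⟨M', hM'⟩ := hφ.support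
  set M := max M' 0 with hMdef
  have hM0 : 0 ≤ M := le_max_right _ _
  have hM : ∀ t, M < |t| → φ t = 0 := fun t ht => hM' t ((le_max_left _ _).trans_lt ht)
  set F : ℝ → ℂ := fun x => poissonExt φ (x + ε * Complex.I) with hF
  have himz : ∀ x : ℝ, 0 < ((x : ℂ) + ε * Complex.I).im := fun x => by simpa using hε
  have hFc : Continuous F := by
    rw [continuous_iff_continuousAt]
    intro x
    exact ContinuousAt.comp (f := fun x : ℝ => (x : ℂ) + ε * Complex.I)
      (poissonExt_hasDerivAt hintg (himz x)).continuousAt (by fun_prop)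
  have hFpc : Continuous fun x => F x ^ (p : ℂ) :=
    hFc.cpow continuous_const fun x => Or.inl (hre _ (himz x))
  have him : ∀ x, (F x).im = conjPoisson ε φ x := fun x => (poissonExt_apply hintg hε).2
  have hFre : ∀ x, 0 < (F x).re := fun x => hre _ (himz x)
  have hc1 : Continuous fun x => |(F x).im| ^ p :=
    (Complex.continuous_im.comp hFc).abs.rpow_const fun _ => Or.inr hp0.le
  have hc2 : Continuous fun x => (F x).re ^ p :=
    (Complex.continuous_re.comp hFc).rpow_const fun _ => Or.inr hp0.le
  have hP : ∫⁻ x, ENNReal.ofReal ((F x).re ^ p) ≤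
      ENNReal.ofReal Real.pi ^ p * ∫⁻ t, ‖φ t‖ₑ ^ p := by
    have hy := lintegral_convolution_le hp
      (κ := fun s => ENNReal.ofReal (ε / (s ^ 2 + ε ^ 2))) (g := fun t => ‖φ t‖ₑ)
      (by fun_prop) hφ.measurable.enorm
    rw [lintegral_poisson hε] at hy
    refine le_trans (lintegral_mono fun x => ?_) hy
    rw [← ENNReal.ofReal_rpow_of_pos (hFre x)]
    gcongr
    have : (F x).re = ∫ t, ε / ((x - t) ^ 2 + ε ^ 2) * φ t := (poissonExt_apply hintg hε).1
    rw [this]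
    refine (ENNReal.ofReal_le_ofReal (le_abs_self _)).trans ?_
    rw [← Real.norm_eq_abs, ofReal_norm]
    refine (enorm_integral_le_lintegral_enorm _).trans (lintegral_mono fun t => ?_)
    rw [enorm_mul, ← ofReal_norm (ε / _), Real.norm_of_nonneg (by positivity)]
  have hstep : ∀ R : ℝ, 2 * M + ε + 1 ≤ R → ∫⁻ x in Icc (-R) R, ‖conjPoisson ε φ x‖ₑ ^ p ≤
      ENNReal.ofReal A * ENNReal.ofReal Real.pi ^ p * (∫⁻ t, ‖φ t‖ₑ ^ p) +
        ENNReal.ofReal (B * (4 * (2 * ∫ t, |φ t|) ^ p * R ^ (-(p - 1)))) := by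
    intro R hR
    have hRR : -R ≤ R := by linarith
    have hb := norm_integral_poissonExt_rpow_le hp hintg hre hM0 hM hε hR
    have e1 : ∫⁻ x in Icc (-R) R, ‖conjPoisson ε φ x‖ₑ ^ p =
        ENNReal.ofReal (∫ x in (-R)..R, |(F x).im| ^ p) := by
      rw [intervalIntegral.integral_of_le hRR, ← integral_Icc_eq_integral_Ioc,
        ofReal_integral_eq_lintegral_ofReal (hc1.continuousOn.integrableOn_Icc)
          (Eventually.of_forall fun x => by positivity)]
      refine lintegral_congr fun x => ?_
      rw [him, ← ENNReal.ofReal_rpow_of_nonneg (abs_nonneg _) hp0.le, ← Real.norm_eq_abs,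
        ofReal_norm]
    have i1 := hc1.intervalIntegrable (μ := volume) (-R) R
    have i2 := hc2.intervalIntegrable (μ := volume) (-R) R
    have i3 := hFpc.intervalIntegrable (μ := volume) (-R) R
    have i4 : IntervalIntegrable (fun x => (F x ^ (p : ℂ)).re) volume (-R) R :=
      (Complex.continuous_re.comp hFpc).intervalIntegrable _ _
    have e2 : ∫ x in (-R)..R, |(F x).im| ^ p ≤
        A * (∫ x in (-R)..R, (F x).re ^ p) - B * ∫ x in (-R)..R, (F x ^ (p : ℂ)).re := by
      rw [← intervalIntegral.integral_const_mul, ← intervalIntegral.integral_const_mul,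
        ← intervalIntegral.integral_sub (i2.const_mul A) (i4.const_mul B)]
      exact intervalIntegral.integral_mono_on hRR i1 ((i2.const_mul A).sub (i4.const_mul B))
        fun x _ => hAB (F x) (hFre x)
    have e3 : ∫ x in (-R)..R, (F x ^ (p : ℂ)).re = (∫ x in (-R)..R, F x ^ (p : ℂ)).re := by
      have := Complex.reCLM.intervalIntegral_comp_comm i3
      simpa using this
    have e4 : -(∫ x in (-R)..R, (F x ^ (p : ℂ)).re) ≤
        4 * (2 * ∫ t, |φ t|) ^ p * R ^ (-(p - 1)) := by
      rw [e3]
      refine le_trans ?_ hb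
      exact (neg_le_abs _).trans (Complex.abs_re_le_norm _)
    have e5 : ENNReal.ofReal (∫ x in (-R)..R, (F x).re ^ p) ≤
        ∫⁻ x, ENNReal.ofReal ((F x).re ^ p) := by
      rw [intervalIntegral.integral_of_le hRR, ← integral_Icc_eq_integral_Ioc,
        ofReal_integral_eq_lintegral_ofReal (hc2.continuousOn.integrableOn_Icc)
          (Eventually.of_forall fun x => Real.rpow_nonneg (hFre x).le _)]
      exact setLIntegral_le_lintegral _ _
    rw [e1]
    have e6 : B * -(∫ x in (-R)..R, (F x ^ (p : ℂ)).re) ≤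
        B * (4 * (2 * ∫ t, |φ t|) ^ p * R ^ (-(p - 1))) := mul_le_mul_of_nonneg_left e4 hB
    calc ENNReal.ofReal (∫ x in (-R)..R, |(F x).im| ^ p)
        ≤ ENNReal.ofReal (A * (∫ x in (-R)..R, (F x).re ^ p) +
            B * (4 * (2 * ∫ t, |φ t|) ^ p * R ^ (-(p - 1)))) :=
          ENNReal.ofReal_le_ofReal (by linarith)
      _ ≤ ENNReal.ofReal (A * (∫ x in (-R)..R, (F x).re ^ p)) +
            ENNReal.ofReal (B * (4 * (2 * ∫ t, |φ t|) ^ p * R ^ (-(p - 1)))) :=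
          ENNReal.ofReal_add_le
      _ ≤ _ := by
          gcongr
          rw [ENNReal.ofReal_mul hA, mul_assoc]
          gcongr
          exact e5.trans hP
  have hcover : AECover (volume : Measure ℝ) atTop fun R : ℝ => Icc (-R) R :=
    aecover_Icc tendsto_neg_atTop_atBot tendsto_id
  have hmeas : AEMeasurable (fun x => ‖conjPoisson ε φ x‖ₑ ^ p) := by
    simp_rw [← him]
    exact ((Complex.continuous_im.comp hFc).measurable.enorm.pow_const p).aemeasurable
  have hlim := hcover.lintegral_tendsto_of_countably_generated hmeas
  have hlim2 : Tendsto (fun R : ℝ => ENNReal.ofReal A * ENNReal.ofReal Real.pi ^ p *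
      (∫⁻ t, ‖φ t‖ₑ ^ p) + ENNReal.ofReal (B * (4 * (2 * ∫ t, |φ t|) ^ p * R ^ (-(p - 1)))))
      atTop (𝓝 (ENNReal.ofReal A * ENNReal.ofReal Real.pi ^ p * (∫⁻ t, ‖φ t‖ₑ ^ p) + 0)) := by
    refine Tendsto.const_add _ ?_
    have h1 := tendsto_rpow_neg_atTop (y := p - 1) (by linarith)
    have h2 := ENNReal.tendsto_ofReal ((h1.const_mul (4 * (2 * ∫ t, |φ t|) ^ p)).const_mul B)
    simpa using h2
  rw [add_zero] at hlim2
  exact le_of_tendsto_of_tendsto hlim hlim2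
    ((eventually_ge_atTop (2 * M + ε + 1)).mono hstep)

theorem integrable_conjPoisson {ε : ℝ} (hε : 0 < ε) {φ : ℝ → ℝ} (h : Integrable φ) (x : ℝ) :
    Integrable fun t => (x - t) / ((x - t) ^ 2 + ε ^ 2) * φ t :=
  h.bdd_mul (c := 1 / ε) (Measurable.aestronglyMeasurable (by fun_prop))
    (Eventually.of_forall fun t => abs_div_sq_add_sq_le hε (x - t))

theorem measurable_conjPoisson (ε : ℝ) {φ : ℝ → ℝ} (h : Measurable φ) :
    Measurable (conjPoisson ε φ) := by
  have : StronglyMeasurable fun z : ℝ × ℝ => (z.1 - z.2) / ((z.1 - z.2) ^ 2 + ε ^ 2) * φ z.2 :=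
    Measurable.stronglyMeasurable (by fun_prop)
  exact this.integral_prod_right.measurable

theorem abs_conjPoisson_le {ε : ℝ} (hε : 0 < ε) {φ : ℝ → ℝ} (h : Integrable φ) (x : ℝ) :
    |conjPoisson ε φ x| ≤ 1 / ε * ∫ t, |φ t| := by
  rw [conjPoisson, ← integral_const_mul]
  rw [← Real.norm_eq_abs]
  refine norm_integral_le_of_norm_le (h.norm.const_mul (1 / ε))
    (Eventually.of_forall fun t => ?_)
  rw [norm_mul]
  exact mul_le_mul_of_nonneg_right (abs_div_sq_add_sq_le hε (x - t)) (norm_nonneg _)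

/-- M. Riesz' theorem for `1 < p ≤ 2`, in terms of conjugate Poisson integrals. -/
theorem conjPoisson_le_of_le_two {p : ℝ} (hp : 1 < p) (hp2 : p ≤ 2) :
    ∃ C : ℝ≥0∞, C ≠ ⊤ ∧ ∀ ε : ℝ, 0 < ε → ∀ φ : ℝ → ℝ, IsBddCompact φ →
      ∫⁻ x, ‖conjPoisson ε φ x‖ₑ ^ p ≤ C * ∫⁻ t, ‖φ t‖ₑ ^ p := by
  have hp0 : 0 < p := by linarith
  obtain ⟨C, hC, h⟩ := conjPoisson_nonneg_le hp hp2
  refine ⟨2 ^ (p - 1) * (C + C), by finiteness, fun ε hε φ hφ => ?_⟩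
  have hpart : ∀ s : ℝ, |s| = 1 → IsBddCompact (fun t => max (s * φ t) 0) ∧
      ∀ t, ‖max (s * φ t) 0‖ₑ ≤ ‖φ t‖ₑ := by
    intro s hs
    have hle : ∀ t, |max (s * φ t) 0| ≤ |φ t| := by
      intro t
      rw [abs_of_nonneg (le_max_right _ _)]
      refine max_le ((le_abs_self _).trans ?_) (abs_nonneg _)
      rw [abs_mul, hs, one_mul]
    refine ⟨⟨(hφ.measurable.const_mul s).max measurable_const, ?_, ?_⟩, ?_⟩
    · obtain ⟨B, hB⟩ := hφ.bounded
      exact ⟨B, fun t => (hle t).trans (hB t)⟩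
    · obtain ⟨M, hM⟩ := hφ.support
      exact ⟨M, fun t ht => by simp [hM t ht]⟩
    · intro t
      rw [← ofReal_norm, ← ofReal_norm]
      exact ENNReal.ofReal_le_ofReal (hle t)
  obtain ⟨n1, l1⟩ := hpart 1 (by simp)
  obtain ⟨n2, l2⟩ := hpart (-1) (by simp)
  have h1 := h ε hε _ n1 fun t => le_max_right _ _
  have h2 := h ε hε _ n2 fun t => le_max_right _ _
  have hsplit : ∀ x, conjPoisson ε φ x = conjPoisson ε (fun t => max (1 * φ t) 0) x -
      conjPoisson ε (fun t => max (-1 * φ t) 0) x := by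
    intro x
    rw [conjPoisson, conjPoisson, conjPoisson, ← integral_sub
      (integrable_conjPoisson hε n1.integrable x) (integrable_conjPoisson hε n2.integrable x)]
    refine integral_congr_ae (Eventually.of_forall fun t => ?_)
    simp only
    rw [← mul_sub]
    congr 1
    rcases le_total 0 (φ t) with h | h
    · rw [max_eq_left (by linarith), max_eq_right (by linarith)]; ring
    · rw [max_eq_right (by linarith), max_eq_left (by linarith)]; ring
  calc ∫⁻ x, ‖conjPoisson ε φ x‖ₑ ^ p
      ≤ ∫⁻ x, 2 ^ (p - 1) * (‖conjPoisson ε (fun t => max (1 * φ t) 0) x‖ₑ ^ p +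
          ‖conjPoisson ε (fun t => max (-1 * φ t) 0) x‖ₑ ^ p) := by
        refine lintegral_mono fun x => ?_
        rw [hsplit x]
        refine le_trans ?_ (ENNReal.rpow_add_le_mul_rpow_add_rpow _ _ hp.le)
        gcongr
        exact enorm_sub_le
    _ = 2 ^ (p - 1) * ((∫⁻ x, ‖conjPoisson ε (fun t => max (1 * φ t) 0) x‖ₑ ^ p) +
          ∫⁻ x, ‖conjPoisson ε (fun t => max (-1 * φ t) 0) x‖ₑ ^ p) := by
        rw [lintegral_const_mul' _ _ (by finiteness), lintegral_add_left]
        exact (measurable_conjPoisson ε n1.measurable).enorm.pow_const p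
    _ ≤ 2 ^ (p - 1) * (C * (∫⁻ t, ‖φ t‖ₑ ^ p) + C * ∫⁻ t, ‖φ t‖ₑ ^ p) := by
        gcongr
        · refine h1.trans ?_
          gcongr
          exact l1 _
        · refine h2.trans ?_
          gcongr
          exact l2 _
    _ = _ := by ring

/-- The kernel is odd, so the operator is antisymmetric; this transfers the bound to the dual
exponent. -/
theorem integral_mul_conjPoisson {ε : ℝ} (hε : 0 < ε) {φ g : ℝ → ℝ} (hφ : IsBddCompact φ)
    (hg : IsBddCompact g) :
    ∫ x, conjPoisson ε φ x * g x = -∫ t, φ t * conjPoisson ε g t := by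
  have hintg : Integrable (fun z : ℝ × ℝ =>
      (z.1 - z.2) / ((z.1 - z.2) ^ 2 + ε ^ 2) * (g z.1 * φ z.2)) (volume.prod volume) := by
    refine (hg.integrable.mul_prod hφ.integrable).bdd_mul (c := 1 / ε)
      (Measurable.aestronglyMeasurable (by fun_prop))
      (Eventually.of_forall fun z => abs_div_sq_add_sq_le hε (z.1 - z.2))
  calc ∫ x, conjPoisson ε φ x * g x
      = ∫ x, ∫ t, (x - t) / ((x - t) ^ 2 + ε ^ 2) * (g x * φ t) := by
        refine integral_congr_ae (Eventually.of_forall fun x => ?_)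
        simp only [conjPoisson]
        rw [← integral_mul_const]
        refine integral_congr_ae (Eventually.of_forall fun t => ?_)
        simp only; ring
    _ = ∫ t, ∫ x, (x - t) / ((x - t) ^ 2 + ε ^ 2) * (g x * φ t) := integral_integral_swap hintg
    _ = _ := by
        rw [← integral_neg]
        refine integral_congr_ae (Eventually.of_forall fun t => ?_)
        simp only [conjPoisson]
        rw [← integral_const_mul, ← integral_neg]
        refine integral_congr_ae (Eventually.of_forall fun x => ?_)
        simp only
        rw [show (x - t) ^ 2 = (t - x) ^ 2 by ring]
        ring

theorem le_of_le_mul_rpow {I c : ℝ≥0∞} {p q : ℝ} (hpq : p.HolderConjugate q) (hI : I ≠ ⊤)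
    (h : I ≤ c * I ^ (1 / q)) : I ≤ c ^ p := by
  have hp0 := hpq.pos
  rcases eq_or_ne I 0 with h0 | h0
  · rw [h0]; exact bot_le
  have hne : I ^ (1 / q) ≠ 0 := by
    rw [Ne, ENNReal.rpow_eq_zero_iff]; rintro (⟨h1, -⟩ | ⟨h1, -⟩)
    · exact h0 h1
    · exact hI h1
  have hnt : I ^ (1 / q) ≠ ⊤ := ENNReal.rpow_ne_top_of_nonneg (by
    have := hpq.symm.pos; positivity) hI
  have e : I = I ^ (1 / p) * I ^ (1 / q) := by
    rw [← ENNReal.rpow_add _ _ h0 hI, one_div, one_div, hpq.inv_add_inv_eq_one, ENNReal.rpow_one]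
  have h2 : I ^ (1 / p) ≤ c := by
    rw [e] at h
    conv at h => rhs; rw [← e]
    exact (ENNReal.mul_le_mul_iff_left hne hnt).1 h
  calc I = (I ^ (1 / p)) ^ p := by
        rw [← ENNReal.rpow_mul, one_div_mul_cancel hp0.ne', ENNReal.rpow_one]
    _ ≤ c ^ p := by gcongr

/-- M. Riesz' theorem in terms of conjugate Poisson integrals. -/
theorem conjPoisson_le {p : ℝ} (hp : 1 < p) :
    ∃ C : ℝ≥0∞, C ≠ ⊤ ∧ ∀ ε : ℝ, 0 < ε → ∀ φ : ℝ → ℝ, IsBddCompact φ →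
      ∫⁻ x, ‖conjPoisson ε φ x‖ₑ ^ p ≤ C * ∫⁻ t, ‖φ t‖ₑ ^ p := by
  rcases le_or_gt p 2 with hp2 | hp2
  · exact conjPoisson_le_of_le_two hp hp2
  have hp0 : 0 < p := by linarith
  set q := p / (p - 1) with hq
  have hpq : p.HolderConjugate q := Real.HolderConjugate.conjExponent hp
  have hq1 : 1 < q := hpq.symm.lt
  have hq0 : 0 < q := by linarith
  have hq2 : q ≤ 2 := by rw [hq, div_le_iff₀ (by linarith)]; linarith
  obtain ⟨C, hC, h⟩ := conjPoisson_le_of_le_two hq1 hq2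
  refine ⟨C ^ (p / q), by
    refine ENNReal.rpow_ne_top_of_nonneg (by positivity) hC, fun ε hε φ hφ => ?_⟩
  set f := conjPoisson ε φ with hf
  have hfm : Measurable f := measurable_conjPoisson ε hφ.measurable
  have hstep : ∀ R : ℝ, ∫⁻ x in Icc (-R) R, ‖f x‖ₑ ^ p ≤ C ^ (p / q) * ∫⁻ t, ‖φ t‖ₑ ^ p := by
    intro R
    -- The extremal function for the duality pairing: f·g = |f|^p and |g|^q = |f|^p on [-R, R]. The
    -- truncation makes g admissible and the integral I finite, so that I^(1/q) can be cancelled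
    -- from both sides.
    set g : ℝ → ℝ := (Icc (-R) R).indicator fun x => |f x| ^ (p - 2) * f x with hg
    have habs : ∀ x, |(|f x| ^ (p - 2) * f x)| = |f x| ^ (p - 1) := by
      intro x
      rw [abs_mul, abs_of_nonneg (Real.rpow_nonneg (abs_nonneg _) _)]
      rcases eq_or_ne (f x) 0 with h0 | h0
      · rw [h0, abs_zero, mul_zero, Real.zero_rpow (by linarith)]
      · rw [← Real.rpow_add_one (abs_ne_zero.2 h0)]; congr 1; ring
    have hgn : IsBddCompact g := by
      refine ⟨?_, ⟨(1 / ε * ∫ t, |φ t|) ^ (p - 1), fun t => ?_⟩, ⟨R, fun t ht => ?_⟩⟩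
      · exact ((hfm.norm.pow_const _).mul hfm).indicator measurableSet_Icc
      · rw [hg, indicator_apply]
        split_ifs
        · rw [habs]
          gcongr
          · exact abs_conjPoisson_le hε hφ.integrable t
        · rw [abs_zero]
          have : 0 ≤ ∫ t, |φ t| := integral_nonneg fun t => abs_nonneg _
          positivity
      · rw [hg, indicator_of_notMem]
        intro hmem
        exact absurd (abs_le.2 hmem) (not_le.2 ht)
    have e1 : ∫⁻ x in Icc (-R) R, ‖f x‖ₑ ^ p = ENNReal.ofReal (∫ x, f x * g x) := by
      rw [ofReal_integral_eq_lintegral_ofReal]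
      · rw [← lintegral_indicator measurableSet_Icc]
        refine lintegral_congr fun x => ?_
        rw [hg, indicator_apply, indicator_apply]
        split_ifs
        · have : f x * (|f x| ^ (p - 2) * f x) = |f x| ^ p := by
            rcases eq_or_ne (f x) 0 with h0 | h0
            · rw [h0, abs_zero, zero_mul, Real.zero_rpow hp0.ne']
            · have e2 : |f x| ^ p = |f x| ^ (p - 2) * |f x| ^ 2 := by
                rw [← Real.rpow_natCast, ← Real.rpow_add (abs_pos.2 h0)]; congr 1; push_cast; ring
              rw [e2, sq_abs]; ring
          rw [this, ← ENNReal.ofReal_rpow_of_nonneg (abs_nonneg _) hp0.le, ← Real.norm_eq_abs,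
            ofReal_norm]
        · simp
      · exact hgn.integrable.bdd_mul hfm.aestronglyMeasurable
          (Eventually.of_forall fun x => abs_conjPoisson_le hε hφ.integrable x)
      · refine Eventually.of_forall fun x => ?_
        simp only [hg, indicator_apply, Pi.zero_apply]
        split_ifs
        · have : f x * (|f x| ^ (p - 2) * f x) = |f x| ^ (p - 2) * f x ^ 2 := by ring
          rw [this]; positivity
        · simp
    have e3 : ∫⁻ x, ‖g x‖ₑ ^ q = ∫⁻ x in Icc (-R) R, ‖f x‖ₑ ^ p := by
      rw [← lintegral_indicator measurableSet_Icc]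
      refine lintegral_congr fun x => ?_
      rw [hg, indicator_apply, indicator_apply]
      split_ifs
      · rw [← ofReal_norm, Real.norm_eq_abs, habs,
          ENNReal.ofReal_rpow_of_nonneg (by positivity) hq0.le, ← Real.rpow_mul (abs_nonneg _),
          ← ofReal_norm, Real.norm_eq_abs, ENNReal.ofReal_rpow_of_nonneg (abs_nonneg _) hp0.le]
        congr 2
        have : p - 1 ≠ 0 := by linarith
        rw [hq]; field_simp
      · simp [hq0]
    have hfin : ∫⁻ x in Icc (-R) R, ‖f x‖ₑ ^ p ≠ ⊤ := by rw [e1]; exact ENNReal.ofReal_ne_top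
    set I := ∫⁻ x in Icc (-R) R, ‖f x‖ₑ ^ p with hI
    have key : I ≤ ((∫⁻ t, ‖φ t‖ₑ ^ p) ^ (1 / p) * C ^ (1 / q)) * I ^ (1 / q) := by
      calc I = ENNReal.ofReal (∫ x, f x * g x) := e1
        _ ≤ ‖∫ t, φ t * conjPoisson ε g t‖ₑ := by
          rw [hf, integral_mul_conjPoisson hε hφ hgn, ← ofReal_norm, Real.norm_eq_abs]
          exact ENNReal.ofReal_le_ofReal (neg_le_abs _)
        _ ≤ ∫⁻ t, ‖φ t * conjPoisson ε g t‖ₑ := enorm_integral_le_lintegral_enorm _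
        _ = ∫⁻ t, ((fun t => ‖φ t‖ₑ) * fun t => ‖conjPoisson ε g t‖ₑ) t := by
          simp only [enorm_mul, Pi.mul_apply]
        _ ≤ (∫⁻ t, ‖φ t‖ₑ ^ p) ^ (1 / p) * (∫⁻ t, ‖conjPoisson ε g t‖ₑ ^ q) ^ (1 / q) :=
          ENNReal.lintegral_mul_le_Lp_mul_Lq volume hpq hφ.measurable.enorm.aemeasurable
            (measurable_conjPoisson ε hgn.measurable).enorm.aemeasurable
        _ ≤ (∫⁻ t, ‖φ t‖ₑ ^ p) ^ (1 / p) * (C * I) ^ (1 / q) := by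
          gcongr
          rw [← e3]
          exact h ε hε g hgn
        _ = _ := by rw [ENNReal.mul_rpow_of_nonneg _ _ (by positivity)]; ring
    refine (le_of_le_mul_rpow hpq hfin key).trans (le_of_eq ?_)
    rw [ENNReal.mul_rpow_of_nonneg _ _ hp0.le, ← ENNReal.rpow_mul, ← ENNReal.rpow_mul,
      one_div_mul_cancel hp0.ne', ENNReal.rpow_one, mul_comm]
    congr 2
    ring
  have hcover : AECover (volume : Measure ℝ) atTop fun R : ℝ => Icc (-R) R :=
    aecover_Icc tendsto_neg_atTop_atBot tendsto_id
  exact le_of_tendsto' (hcover.lintegral_tendsto_of_countably_generated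
    (hfm.enorm.pow_const p).aemeasurable) hstep

/-! ### The regularized Hilbert transform -/

/-- The Hilbert kernel `1/y`, regularized. -/
def hilbertKernel (ε y : ℝ) : ℝ := SignType.sign y / (|y| + ε)

theorem measurable_hilbertKernel (ε : ℝ) : Measurable (hilbertKernel ε) := by
  have h1 : Measurable fun y : ℝ => ((SignType.sign y : SignType) : ℝ) := by
    have : (fun y : ℝ => ((SignType.sign y : SignType) : ℝ)) =
        fun y => if 0 < y then 1 else if y < 0 then -1 else 0 := by
      funext y
      rcases lt_trichotomy y 0 with h | h | h
      · simp [h, h.le.not_gt]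
      · simp [h]
      · simp [h]
    rw [this]
    exact Measurable.ite measurableSet_Ioi measurable_const
      (Measurable.ite measurableSet_Iio measurable_const measurable_const)
  exact h1.div (by fun_prop)

/-- For y > 0 the difference is the Poisson kernel times (ε-y)/(ε+y), a factor of modulus at most
one. This regularization, unlike the conjugate Poisson kernel, is what the integral of
e^(-lε)·sgn(y)·e^(-l|y|) in l produces. -/
theorem abs_hilbertKernel_sub_le {ε : ℝ} (hε : 0 < ε) (y : ℝ) :
    |hilbertKernel ε y - y / (y ^ 2 + ε ^ 2)| ≤ ε / (y ^ 2 + ε ^ 2) := by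
  have hpos : ∀ y : ℝ, 0 < y → |1 / (y + ε) - y / (y ^ 2 + ε ^ 2)| ≤ ε / (y ^ 2 + ε ^ 2) := by
    intro y hy
    have e : 1 / (y + ε) - y / (y ^ 2 + ε ^ 2) = ε / (y ^ 2 + ε ^ 2) * ((ε - y) / (y + ε)) := by
      field_simp; ring
    rw [e, abs_mul, abs_of_pos (show 0 < ε / (y ^ 2 + ε ^ 2) by positivity)]
    refine mul_le_of_le_one_right (by positivity) ?_
    rw [abs_div, abs_of_pos (show 0 < y + ε by positivity), div_le_one (by positivity)]
    rw [abs_le]; constructor <;> linarith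
  rcases lt_trichotomy y 0 with h | h | h
  · have := hpos (-y) (by linarith)
    rw [hilbertKernel, sign_neg h, abs_of_neg h, ← abs_neg]
    convert this using 2
    · simp; ring
    · ring
  · subst h; simp [hilbertKernel]; positivity
  · have := hpos y h
    rw [hilbertKernel, sign_pos h, abs_of_pos h]
    simpa using this

theorem abs_hilbertKernel_le {ε : ℝ} (hε : 0 < ε) (y : ℝ) : |hilbertKernel ε y| ≤ 1 / ε := by
  rw [hilbertKernel, abs_div, abs_of_pos (show 0 < |y| + ε by positivity)]
  have : |((SignType.sign y : SignType) : ℝ)| ≤ 1 := by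
    rcases lt_trichotomy y 0 with h | h | h
    · simp [h]
    · simp [h]
    · simp [h]
  gcongr
  linarith [abs_nonneg y]

theorem integrable_hilbertKernel_mul {ε : ℝ} (hε : 0 < ε) {φ : ℝ → ℝ} (h : Integrable φ) (x : ℝ) :
    Integrable fun t => hilbertKernel ε (x - t) * φ t :=
  h.bdd_mul (c := 1 / ε) (((measurable_hilbertKernel ε).comp
    (measurable_const.sub measurable_id)).aestronglyMeasurable)
    (Eventually.of_forall fun t => abs_hilbertKernel_le hε (x - t))

/-- The regularized Hilbert transforms are bounded on `L^p`, uniformly. -/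
theorem hilbert_le {p : ℝ} (hp : 1 < p) :
    ∃ C : ℝ≥0∞, C ≠ ⊤ ∧ ∀ ε : ℝ, 0 < ε → ∀ φ : ℝ → ℝ, IsBddCompact φ →
      ∫⁻ x, ‖∫ t, hilbertKernel ε (x - t) * φ t‖ₑ ^ p ≤ C * ∫⁻ t, ‖φ t‖ₑ ^ p := by
  obtain ⟨C, hC, h⟩ := conjPoisson_le hp
  have hp0 : 0 < p := by linarith
  refine ⟨2 ^ (p - 1) * (C + ENNReal.ofReal Real.pi ^ p), by finiteness, fun ε hε φ hφ => ?_⟩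
  have h1 := h ε hε φ hφ
  have h2 := lintegral_convolution_le hp
    (κ := fun s => ENNReal.ofReal (ε / (s ^ 2 + ε ^ 2))) (g := fun t => ‖φ t‖ₑ)
    (by fun_prop) hφ.measurable.enorm
  rw [lintegral_poisson hε] at h2
  calc ∫⁻ x, ‖∫ t, hilbertKernel ε (x - t) * φ t‖ₑ ^ p
      ≤ ∫⁻ x, 2 ^ (p - 1) * (‖conjPoisson ε φ x‖ₑ ^ p +
          (∫⁻ t, ENNReal.ofReal (ε / ((x - t) ^ 2 + ε ^ 2)) * ‖φ t‖ₑ) ^ p) := by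
        refine lintegral_mono fun x => ?_
        refine le_trans ?_ (ENNReal.rpow_add_le_mul_rpow_add_rpow _ _ hp.le)
        gcongr
        have e : ∫ t, hilbertKernel ε (x - t) * φ t = conjPoisson ε φ x +
            ∫ t, (hilbertKernel ε (x - t) - (x - t) / ((x - t) ^ 2 + ε ^ 2)) * φ t := by
          rw [conjPoisson, ← integral_add (integrable_conjPoisson hε hφ.integrable x)]
          · refine integral_congr_ae (Eventually.of_forall fun t => ?_)
            simp only; ring
          · refine ((integrable_hilbertKernel_mul hε hφ.integrable x).sub
              (integrable_conjPoisson hε hφ.integrable x)).congr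
              (Eventually.of_forall fun t => ?_)
            simp only [Pi.sub_apply]; ring
        rw [e]
        refine (enorm_add_le _ _).trans ?_
        gcongr
        refine (enorm_integral_le_lintegral_enorm _).trans (lintegral_mono fun t => ?_)
        rw [enorm_mul, ← ofReal_norm, Real.norm_eq_abs]
        gcongr
        exact abs_hilbertKernel_sub_le hε _
    _ = 2 ^ (p - 1) * ((∫⁻ x, ‖conjPoisson ε φ x‖ₑ ^ p) +
          ∫⁻ x, (∫⁻ t, ENNReal.ofReal (ε / ((x - t) ^ 2 + ε ^ 2)) * ‖φ t‖ₑ) ^ p) := by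
        rw [lintegral_const_mul' _ _ (by finiteness), lintegral_add_left]
        exact (measurable_conjPoisson ε hφ.measurable).enorm.pow_const p
    _ ≤ 2 ^ (p - 1) * (C * (∫⁻ t, ‖φ t‖ₑ ^ p) +
          ENNReal.ofReal Real.pi ^ p * ∫⁻ t, ‖φ t‖ₑ ^ p) := by gcongr
    _ = _ := by ring

/-! ### The kernels of Δ (Δ + l²)⁻¹ and their measurability -/

instance (d : ℝ) : SFinite (besselMeasure d) := by
  unfold besselMeasure; infer_instance

theorem measurable_besselMoment (d : ℝ) (n : ℕ) : Measurable (besselMoment d n) := by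
  have : StronglyMeasurable fun x : ℝ × ℝ => x.2 ^ n * Real.exp (-x.1 * x.2) :=
    Measurable.stronglyMeasurable (by fun_prop)
  exact (this.integral_prod_right (ν := besselMeasure d)).measurable

theorem measurable_besselPrimitive (d : ℝ) : Measurable (besselPrimitive d) := by
  have hm : Measurable fun y : ℝ => y ^ (1 - d) / besselMoment d 0 y ^ 2 :=
    Measurable.div (by fun_prop) ((measurable_besselMoment d 0).pow_const 2)
  have h1 : Measurable fun z : ℝ => ∫ y in Ioc 1 z, y ^ (1 - d) / besselMoment d 0 y ^ 2 := by
    have hs : MeasurableSet {x : ℝ × ℝ | x.2 ∈ Ioc 1 x.1} :=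
      (measurableSet_lt measurable_const measurable_snd).inter
        (measurableSet_le measurable_snd measurable_fst)
    have := ((hm.comp measurable_snd).indicator hs).stronglyMeasurable.integral_prod_right'
      (ν := (volume : Measure ℝ))
    convert! this.measurable using 1
    funext z
    rw [← integral_indicator measurableSet_Ioc]
    rfl
  have h2 : Measurable fun z : ℝ => ∫ y in Ioc z 1, y ^ (1 - d) / besselMoment d 0 y ^ 2 := by
    have hs : MeasurableSet {x : ℝ × ℝ | x.2 ∈ Ioc x.1 1} :=
      (measurableSet_lt measurable_fst measurable_snd).inter
        (measurableSet_le measurable_snd measurable_const)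
    have := ((hm.comp measurable_snd).indicator hs).stronglyMeasurable.integral_prod_right'
      (ν := (volume : Measure ℝ))
    convert! this.measurable using 1
    funext z
    rw [← integral_indicator measurableSet_Ioc]
    rfl
  exact h1.sub h2

theorem measurable_decaySol (d : ℝ) : Measurable fun x : ℝ × ℝ => decaySol d x.1 x.2 :=
  (measurable_besselMoment d 0).comp (measurable_fst.mul measurable_snd)

theorem measurable_decaySolDeriv (d : ℝ) : Measurable fun x : ℝ × ℝ => decaySolDeriv d x.1 x.2 :=
  (measurable_fst.mul
    ((measurable_besselMoment d 1).comp (measurable_fst.mul measurable_snd))).neg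

theorem measurable_gluing (d : ℝ) : Measurable (gluing d) := by
  have h1 : Measurable fun l : ℝ => decaySol d l 1 :=
    (measurable_decaySol d).comp (measurable_id.prodMk measurable_const)
  have h2 : Measurable fun l : ℝ => decaySolDeriv d l 1 :=
    (measurable_decaySolDeriv d).comp (measurable_id.prodMk measurable_const)
  exact measurable_const.div ((h1.mul h2.neg).const_mul 2)

theorem measurable_growFactor (d : ℝ) : Measurable fun x : ℝ × ℝ => gluing d x.1 +
    x.1 ^ (d - 2) * (besselPrimitive d (x.1 * x.2) - besselPrimitive d x.1) :=
  ((measurable_gluing d).comp measurable_fst).add ((measurable_fst.pow_const _).mul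
    (((measurable_besselPrimitive d).comp (measurable_fst.mul measurable_snd)).sub
      ((measurable_besselPrimitive d).comp measurable_fst)))

theorem measurable_growSol (d : ℝ) : Measurable fun x : ℝ × ℝ => growSol d x.1 x.2 :=
  (measurable_decaySol d).mul (measurable_growFactor d)

theorem measurable_growSolDeriv (d : ℝ) : Measurable fun x : ℝ × ℝ => growSolDeriv d x.1 x.2 :=
  ((measurable_decaySolDeriv d).mul (measurable_growFactor d)).add
    ((measurable_snd.pow_const _).mul (measurable_decaySol d)).inv

/-- The kernel of `Δ (Δ + l²)⁻¹`, as an operator on derivatives, for points on the same side. -/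
def sameKernel (d l r t : ℝ) : ℝ :=
  if t ≤ r then decaySol d l r * (t ^ (d - 1) * growSolDeriv d l t)
  else growSol d l r * (t ^ (d - 1) * decaySolDeriv d l t)

/-- The kernel of `Δ (Δ + l²)⁻¹`, as an operator on derivatives, for points on opposite sides. -/
def crossKernel (d l r t : ℝ) : ℝ :=
  gluing d l * decaySol d l r * (t ^ (d - 1) * decaySolDeriv d l t)

/-- The limit of the kernels far below the diagonal. -/
def tailKernel (d l r : ℝ) : ℝ := decaySol d l r * growSolDeriv d l 1

theorem measurable_sameKernel (d : ℝ) :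
    Measurable fun x : ℝ × ℝ × ℝ => sameKernel d x.1 x.2.1 x.2.2 := by
  have m1 : Measurable fun x : ℝ × ℝ × ℝ => (x.1, x.2.1) := by fun_prop
  have m2 : Measurable fun x : ℝ × ℝ × ℝ => (x.1, x.2.2) := by fun_prop
  have m3 : Measurable fun x : ℝ × ℝ × ℝ => x.2.2 ^ (d - 1) := by fun_prop
  refine Measurable.ite (measurableSet_le (by fun_prop) (by fun_prop)) ?_ ?_
  · exact ((measurable_decaySol d).comp m1).mul (m3.mul ((measurable_growSolDeriv d).comp m2))
  · exact ((measurable_growSol d).comp m1).mul (m3.mul ((measurable_decaySolDeriv d).comp m2))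

theorem measurable_crossKernel (d : ℝ) :
    Measurable fun x : ℝ × ℝ × ℝ => crossKernel d x.1 x.2.1 x.2.2 := by
  have m1 : Measurable fun x : ℝ × ℝ × ℝ => (x.1, x.2.1) := by fun_prop
  have m2 : Measurable fun x : ℝ × ℝ × ℝ => (x.1, x.2.2) := by fun_prop
  have m3 : Measurable fun x : ℝ × ℝ × ℝ => x.2.2 ^ (d - 1) := by fun_prop
  exact (((measurable_gluing d).comp measurable_fst).mul ((measurable_decaySol d).comp m1)).mul
    (m3.mul ((measurable_decaySolDeriv d).comp m2))

theorem measurable_tailKernel (d : ℝ) :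
    Measurable fun x : ℝ × ℝ => tailKernel d x.1 x.2 :=
  (measurable_decaySol d).mul
    ((measurable_growSolDeriv d).comp (measurable_fst.prodMk measurable_const))

theorem abs_sameKernel_le {d : ℝ} (hd : 1 < d) {l r t : ℝ} (hl : 0 < l) (hr : 1 ≤ r) (ht : 1 ≤ t) :
    |sameKernel d l r t| ≤ 1 := by
  have S := solutionPair hd hl
  rw [sameKernel]
  split_ifs with h
  · exact S.left_le_one hl ht h
  · exact S.right_le_one hl hr (not_le.1 h).le

theorem abs_crossKernel_le {d : ℝ} (hd : 1 < d) {l r t : ℝ} (hl : 0 < l) (hr : 1 ≤ r)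
    (ht : 1 ≤ t) : |crossKernel d l r t| ≤ 1 := by
  refine ((solutionPair hd hl).cross_le' hl hr ht).trans ?_
  rw [Real.exp_le_one_iff]; nlinarith

theorem tailKernel_nonneg {d : ℝ} (hd : 1 < d) {l r : ℝ} (hl : 0 < l) (hr : 1 ≤ r) :
    0 ≤ tailKernel d l r := by
  have S := solutionPair hd hl
  exact mul_nonneg (S.pos r (by linarith)).le (S.u₁_one_pos hl).le

theorem tailKernel_le {d : ℝ} (hd : 1 < d) {l r : ℝ} (hl : 0 < l) (hr : 1 ≤ r) :
    tailKernel d l r ≤ Real.exp (-(l * (r - 1))) := by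
  have S := solutionPair hd hl
  rw [tailKernel, S.k_mul_u₁_one]
  have h1 := S.k_le_exp one_pos hr
  have h2 := S.pos 1 one_pos
  rw [div_le_iff₀ (by positivity)]
  nlinarith [mul_pos h2 (Real.exp_pos (-(l * (r - 1))))]

/-! ### Kernels integrated over the spectral parameter -/

theorem integral_exp_neg_mul {c : ℝ} (hc : 0 < c) :
    ∫ l in Ioi (0:ℝ), Real.exp (-(l * c)) = 1 / c := by
  have := integral_exp_mul_Ioi (a := -c) (by linarith) 0
  simp only [mul_zero, Real.exp_zero] at this
  rw [show 1 / c = -1 / -c by rw [neg_div_neg_eq], ← this]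
  refine integral_congr_ae (Eventually.of_forall fun l => ?_)
  simp only; congr 1; ring

theorem integrableOn_exp_neg_mul {c : ℝ} (hc : 0 < c) :
    IntegrableOn (fun l : ℝ => Real.exp (-(l * c))) (Ioi 0) := by
  refine (exp_neg_integrableOn_Ioi 0 hc).congr_fun (fun l _ => ?_) measurableSet_Ioi
  simp only; congr 1; ring

theorem abs_exp_mul_le {ε l x y : ℝ} (hε : 0 < ε) (hl : 0 < l) (h : |x| ≤ y) :
    |Real.exp (-(l * ε)) * x| ≤ y := by
  rw [abs_mul, abs_of_pos (Real.exp_pos _)]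
  have : Real.exp (-(l * ε)) ≤ 1 := by rw [Real.exp_le_one_iff]; nlinarith
  exact (mul_le_of_le_one_left (abs_nonneg _) this).trans h

theorem integrableOn_exp_mul {ε : ℝ} (hε : 0 < ε) {F : ℝ → ℝ} (hF : Measurable F)
    (h : ∀ l, 0 < l → |F l| ≤ 1) :
    IntegrableOn (fun l => Real.exp (-(l * ε)) * F l) (Ioi 0) := by
  refine (integrableOn_exp_neg_mul hε).mono' (by fun_prop) ?_
  filter_upwards [ae_restrict_mem measurableSet_Ioi] with l hl
  rw [norm_mul, Real.norm_of_nonneg (Real.exp_pos _).le]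
  exact mul_le_of_le_one_right (Real.exp_pos _).le (h l hl)

theorem abs_integral_exp_mul_le {ε : ℝ} (hε : 0 < ε) {F G : ℝ → ℝ}
    (hG : IntegrableOn G (Ioi 0)) (h : ∀ l, 0 < l → |F l| ≤ G l) :
    |∫ l in Ioi 0, Real.exp (-(l * ε)) * F l| ≤ ∫ l in Ioi 0, G l := by
  rw [← Real.norm_eq_abs]
  refine norm_integral_le_of_norm_le hG ?_
  filter_upwards [ae_restrict_mem measurableSet_Ioi] with l hl
  exact abs_exp_mul_le hε hl (h l hl)

/-- `∫ e^(-lε) K_l(r, t) dl` for the same-side kernel. -/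
def sameInt (d ε r t : ℝ) : ℝ := ∫ l in Ioi 0, Real.exp (-(l * ε)) * sameKernel d l r t

/-- `∫ e^(-lε) K_l(r, t) dl` for the opposite-side kernel. -/
def crossInt (d ε r t : ℝ) : ℝ := ∫ l in Ioi 0, Real.exp (-(l * ε)) * crossKernel d l r t

/-- `∫ e^(-lε) c_l(r) dl` for the limiting kernel. -/
def tailInt (d ε r : ℝ) : ℝ := ∫ l in Ioi 0, Real.exp (-(l * ε)) * tailKernel d l r

theorem integrableOn_sameInt {d : ℝ} (hd : 1 < d) {ε r t : ℝ} (hε : 0 < ε) (hr : 1 ≤ r)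
    (ht : 1 ≤ t) :
    IntegrableOn (fun l => Real.exp (-(l * ε)) * sameKernel d l r t) (Ioi 0) :=
  integrableOn_exp_mul hε (F := fun l => sameKernel d l r t) ((measurable_sameKernel d).comp
    (measurable_id.prodMk (measurable_const (a := (r, t)))))
    fun _ hl => abs_sameKernel_le hd hl hr ht

theorem measurable_crossKernel_left (d r t : ℝ) : Measurable fun l => crossKernel d l r t := by
  have h1 : Measurable fun l : ℝ => decaySol d l r :=
    (measurable_decaySol d).comp (measurable_id.prodMk measurable_const)
  have h2 : Measurable fun l : ℝ => decaySolDeriv d l t :=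
    (measurable_decaySolDeriv d).comp (measurable_id.prodMk measurable_const)
  exact ((measurable_gluing d).mul h1).mul (h2.const_mul _)

theorem integrableOn_crossInt {d : ℝ} (hd : 1 < d) {ε r t : ℝ} (hε : 0 < ε) (hr : 1 ≤ r)
    (ht : 1 ≤ t) :
    IntegrableOn (fun l => Real.exp (-(l * ε)) * crossKernel d l r t) (Ioi 0) := by
  have := integrableOn_exp_mul hε (measurable_crossKernel_left d r t)
    fun _ hl => abs_crossKernel_le hd hl hr ht
  exact this

theorem integrableOn_tailInt {d : ℝ} (hd : 1 < d) {ε r : ℝ} (hε : 0 < ε) (hr : 1 ≤ r) :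
    IntegrableOn (fun l => Real.exp (-(l * ε)) * tailKernel d l r) (Ioi 0) :=
  integrableOn_exp_mul hε (F := fun l => tailKernel d l r) ((measurable_tailKernel d).comp
    (measurable_id.prodMk measurable_const))
    fun l hl => by
      rw [abs_of_nonneg (tailKernel_nonneg hd hl hr)]
      refine (tailKernel_le hd hl hr).trans ?_
      rw [Real.exp_le_one_iff]; nlinarith

theorem sameInt_far_right {d : ℝ} (hd : 1 < d) {ε r t : ℝ} (hε : 0 < ε) (hr : 1 ≤ r)
    (ht : 2 * r ≤ t) :
    |sameInt d ε r t| ≤ 2 ^ (d + 3) / t ∧ |crossInt d ε r t| ≤ 2 ^ (d + 3) / t := by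
  have htr : 0 < t - r := by linarith
  have hG := ((integrableOn_exp_neg_mul (c := (t - r) / 2) (by positivity)).const_mul
    ((2:ℝ) ^ (d + 1)))
  have hval : ∫ l in Ioi (0:ℝ), 2 ^ (d + 1) * Real.exp (-(l * ((t - r) / 2))) ≤
      2 ^ (d + 3) / t := by
    rw [integral_const_mul, integral_exp_neg_mul (by positivity),
      show d + 3 = (d + 1) + 2 by ring, Real.rpow_add (by norm_num : (0:ℝ) < 2) (d + 1) 2]
    have : 1 / ((t - r) / 2) ≤ 4 / t := by
      rw [div_le_div_iff₀ (by positivity) (by linarith)]; linarith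
    calc (2:ℝ) ^ (d + 1) * (1 / ((t - r) / 2)) ≤ 2 ^ (d + 1) * (4 / t) := by gcongr
      _ = _ := by norm_num; ring
  have hb : ∀ l, 0 < l → |growSol d l r * (t ^ (d - 1) * decaySolDeriv d l t)| ≤
      2 ^ (d + 1) * Real.exp (-(l * ((t - r) / 2))) := by
    intro l hl
    have := (solutionPair hd hl).far_right hd hl hr (by linarith : r ≤ t)
    rwa [mul_div_assoc] at this
  constructor
  · refine (abs_integral_exp_mul_le hε hG fun l hl => ?_).trans hval
    rw [sameKernel, if_neg (by linarith)]
    exact hb l hl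
  · refine (abs_integral_exp_mul_le hε hG fun l hl => ?_).trans hval
    exact ((solutionPair hd hl).cross_le_right hl hr t).trans (hb l hl)

/-- At t = 1 the same-side kernel is k(r)u₁(1) and, by the gluing of derivatives, the opposite-side
kernel is -k(r)u₁(1); hence the opposite signs of `tailInt`. This common part does not depend on t
and has to be removed before any power of t/r is gained. -/
theorem sameInt_far_left {d : ℝ} (hd : 1 < d) {ε r t : ℝ} (hε : 0 < ε) (ht : 1 ≤ t)
    (htr : t ≤ r / 2) :
    |sameInt d ε r t - tailInt d ε r| ≤ 2 ^ (d + 4) * (r⁻¹ * (t / r) ^ d) ∧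
      |crossInt d ε r t + tailInt d ε r| ≤ 2 ^ (d + 4) * (r⁻¹ * (t / r) ^ d) := by
  have hr : 1 ≤ r := by linarith
  have hr0 : 0 < r := by linarith
  have hG := ((integrableOn_exp_neg_mul (c := r / 4) (by positivity)).const_mul
    ((2:ℝ) ^ (d + 2) * (t / r) ^ d))
  have hval : ∫ l in Ioi (0:ℝ), 2 ^ (d + 2) * (t / r) ^ d * Real.exp (-(l * (r / 4))) =
      2 ^ (d + 4) * (r⁻¹ * (t / r) ^ d) := by
    rw [integral_const_mul, integral_exp_neg_mul (by positivity),
      show d + 4 = (d + 2) + 2 by ring, Real.rpow_add (by norm_num : (0:ℝ) < 2) (d + 2) 2]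
    norm_num
    field_simp
  have hb : ∀ l, 0 < l → decaySol d l r * (t ^ (d - 1) * growSolDeriv d l t - growSolDeriv d l 1) ≤
      2 ^ (d + 2) * (t / r) ^ d * Real.exp (-(l * (r / 4))) := by
    intro l hl
    have := (solutionPair hd hl).far_left hd hl ht htr
    rwa [mul_div_assoc] at this
  rw [← hval]
  constructor
  · rw [sameInt, tailInt, ← integral_sub (integrableOn_sameInt hd hε hr ht)
      (integrableOn_tailInt hd hε hr)]
    simp_rw [← mul_sub]
    refine abs_integral_exp_mul_le hε hG fun l hl => ?_
    have S := solutionPair hd hl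
    rw [sameKernel, if_pos (by linarith), tailKernel, ← mul_sub, abs_of_nonneg]
    · exact hb l hl
    · exact mul_nonneg (S.pos r hr0).le (S.far_left_nonneg hl ht)
  · rw [crossInt, tailInt, ← integral_add (integrableOn_crossInt hd hε hr ht)
      (integrableOn_tailInt hd hε hr)]
    simp_rw [← mul_add]
    refine abs_integral_exp_mul_le hε hG fun l hl => ?_
    have S := solutionPair hd hl
    have e : crossKernel d l r t + tailKernel d l r = decaySol d l r *
        (gluing d l * (t ^ (d - 1) * decaySolDeriv d l t) + growSolDeriv d l 1) := by
      rw [crossKernel, tailKernel]; ring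
    rw [e, abs_of_nonneg (mul_nonneg (S.pos r hr0).le (S.cross_nonneg_left hl ht))]
    exact (mul_le_mul_of_nonneg_left (S.cross_le_left hl ht) (S.pos r hr0).le).trans (hb l hl)

/-- The first bound serves for r away from the gluing point, the second for r and t both near it. -/
theorem abs_crossInt_le {d : ℝ} (hd : 1 < d) {ε r t : ℝ} (hε : 0 < ε) (hr : 1 < r) (ht : 1 ≤ t) :
    |crossInt d ε r t| ≤ 1 / (r - 1) ∧
      |crossInt d ε r t| ≤ t ^ (d - 1) / ((r - 1) + (t - 1)) := by
  have hr0 : 0 < r - 1 := by linarith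
  constructor
  · rw [← integral_exp_neg_mul hr0]
    exact abs_integral_exp_mul_le hε (integrableOn_exp_neg_mul hr0) fun l hl =>
      (solutionPair hd hl).cross_le' hl hr.le ht
  · have h0 : 0 < (r - 1) + (t - 1) := by linarith
    have : t ^ (d - 1) / ((r - 1) + (t - 1)) =
        ∫ l in Ioi (0:ℝ), t ^ (d - 1) * Real.exp (-(l * ((r - 1) + (t - 1)))) := by
      rw [integral_const_mul, integral_exp_neg_mul h0]; ring
    rw [this]
    exact abs_integral_exp_mul_le hε ((integrableOn_exp_neg_mul h0).const_mul _) fun l hl =>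
      (solutionPair hd hl).cross_le hl hr.le ht

theorem abs_tailInt_le {d : ℝ} (hd : 1 < d) {ε r : ℝ} (hε : 0 < ε) (hr : 1 < r) :
    |tailInt d ε r| ≤ 1 / (r - 1) := by
  have hr0 : 0 < r - 1 := by linarith
  rw [← integral_exp_neg_mul hr0]
  refine abs_integral_exp_mul_le hε (integrableOn_exp_neg_mul hr0) fun l hl => ?_
  rw [abs_of_nonneg (tailKernel_nonneg hd hl hr.le)]
  exact tailKernel_le hd hl hr.le

theorem integrableOn_rpow_neg_half {δ : ℝ} (hδ : 0 < δ) :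
    IntegrableOn (fun l : ℝ => l ^ (-(1 / 2) : ℝ) * Real.exp (-(l * δ))) (Ioi 0) := by
  have h0 := integrableOn_rpow_mul_exp_neg_mul_rpow (s := -(1 / 2)) (by norm_num)
    (one_pos (α := ℝ)) hδ
  refine h0.congr_fun (fun l hl => ?_) measurableSet_Ioi
  simp only [Real.rpow_one]
  congr 2; ring

theorem integral_rpow_neg_half {δ : ℝ} (hδ : 0 < δ) :
    ∫ l in Ioi (0:ℝ), l ^ (-(1 / 2) : ℝ) * Real.exp (-(l * δ)) =
      Real.Gamma (1 / 2) * δ ^ (-(1 / 2) : ℝ) := by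
  have := Real.integral_rpow_mul_exp_neg_mul_Ioi (a := 1 / 2) (r := δ) (by norm_num) hδ
  rw [show (1 / 2 : ℝ) - 1 = -(1 / 2) by norm_num] at this
  rw [one_div δ, Real.inv_rpow hδ.le, ← Real.rpow_neg hδ.le, mul_comm] at this
  rw [← this]
  refine integral_congr_ae (Eventually.of_forall fun l => ?_)
  simp only [mul_comm δ l]

/-- With δ = |r-t|, the main term sgn(r-t)e^(-lδ)/2 integrates to half the regularized Hilbert
kernel. Of the two errors, (lr)^(-1/2)e^(-lδ) integrates to Γ(1/2)(rδ)^(-1/2), and (δ/r)e^(-lδ) to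
1/r ≤ (rδ)^(-1/2), because δ ≤ r. -/
theorem sameInt_near {d : ℝ} (hd : 1 < d) {ε r t : ℝ} (hε : 0 < ε) (hr : 1 ≤ r) (ht : 1 ≤ t)
    (h1 : r / 2 ≤ t) (h2 : t ≤ 2 * r) (hne : t ≠ r) :
    |sameInt d ε r t - 1 / 2 * hilbertKernel ε (r - t)| ≤
      2 ^ (d + 1) * (2 * (d + 1)) * (Real.Gamma (1 / 2) + 1) * (r * |r - t|) ^ (-(1 / 2) : ℝ) := by
  have hr0 : 0 < r := by linarith
  set δ := |r - t| with hδdef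
  have hδ : 0 < δ := abs_pos.2 (sub_ne_zero.2 (Ne.symm hne))
  have hδr : δ ≤ r := by
    rw [hδdef, abs_le]; constructor <;> linarith
  set σ : ℝ := ((SignType.sign (r - t) : SignType) : ℝ) with hσ
  set D : ℝ := 2 ^ (d + 1) * (2 * (d + 1)) with hD
  have hD0 : 0 < D := by positivity
  have hk : ∀ l, 0 < l → |sameKernel d l r t - 1 / 2 * (σ * Real.exp (-(l * δ)))| ≤
      D * (r ^ (-(1 / 2) : ℝ) * (l ^ (-(1 / 2) : ℝ) * Real.exp (-(l * δ))) +
        δ / r * Real.exp (-(l * δ))) := by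
    intro l hl
    have S := solutionPair hd hl
    have e : D * (r ^ (-(1 / 2) : ℝ) * (l ^ (-(1 / 2) : ℝ) * Real.exp (-(l * δ))) +
        δ / r * Real.exp (-(l * δ))) = D * ((l * r) ^ (-(1 / 2) : ℝ) + δ / r) *
        Real.exp (-(l * δ)) := by
      rw [Real.mul_rpow hl.le hr0.le]; ring
    rw [e]
    rcases lt_or_gt_of_ne hne with h | h
    · have hσ1 : σ = 1 := by rw [hσ, sign_pos (by linarith)]; simp
      have hδ1 : δ = r - t := abs_of_pos (by linarith)
      have := S.near_left hd hl ht h.le h1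
      rw [sameKernel, if_pos h.le, hσ1, hδ1]
      convert this using 2
      ring
    · have hσ1 : σ = -1 := by rw [hσ, sign_neg (by linarith)]; simp
      have hδ1 : δ = t - r := by rw [hδdef, abs_of_neg (by linarith)]; ring
      have := S.near_right hd hl hr h.le h2
      rw [sameKernel, if_neg (not_le.2 h), hσ1, hδ1]
      convert this using 2
      ring
  have hmain : 1 / 2 * hilbertKernel ε (r - t) =
      ∫ l in Ioi 0, Real.exp (-(l * ε)) * (1 / 2 * (σ * Real.exp (-(l * δ)))) := by
    have : ∀ l : ℝ, Real.exp (-(l * ε)) * (1 / 2 * (σ * Real.exp (-(l * δ)))) =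
        1 / 2 * σ * Real.exp (-(l * (δ + ε))) := by
      intro l
      rw [show -(l * (δ + ε)) = -(l * ε) + -(l * δ) by ring, Real.exp_add]; ring
    simp_rw [this]
    rw [integral_const_mul, integral_exp_neg_mul (by positivity), hilbertKernel]
    ring
  have hintg : IntegrableOn (fun l => Real.exp (-(l * ε)) * (1 / 2 * (σ * Real.exp (-(l * δ)))))
      (Ioi 0) := by
    refine integrableOn_exp_mul hε (by fun_prop) fun l hl => ?_
    have h3 : |σ| = 1 := by
      rcases lt_or_gt_of_ne hne with h | h
      · rw [hσ, sign_pos (by linarith)]; simp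
      · rw [hσ, sign_neg (by linarith)]; simp
    have h4 : Real.exp (-(l * δ)) ≤ 1 := by rw [Real.exp_le_one_iff]; nlinarith
    rw [abs_mul, abs_mul, h3, abs_of_pos (Real.exp_pos _), abs_of_pos (by norm_num : (0:ℝ) < 1 / 2)]
    linarith
  have hG : IntegrableOn (fun l : ℝ => D * (r ^ (-(1 / 2) : ℝ) *
      (l ^ (-(1 / 2) : ℝ) * Real.exp (-(l * δ))) + δ / r * Real.exp (-(l * δ)))) (Ioi 0) :=
    (((integrableOn_rpow_neg_half hδ).const_mul _).add
      ((integrableOn_exp_neg_mul hδ).const_mul _)).const_mul _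
  rw [sameInt, hmain, ← integral_sub (integrableOn_sameInt hd hε hr ht) hintg]
  simp_rw [← mul_sub]
  refine (abs_integral_exp_mul_le hε hG hk).trans ?_
  rw [integral_const_mul, integral_add ((integrableOn_rpow_neg_half hδ).const_mul _)
      ((integrableOn_exp_neg_mul hδ).const_mul _), integral_const_mul, integral_const_mul,
    integral_rpow_neg_half hδ, integral_exp_neg_mul hδ, Real.mul_rpow hr0.le hδ.le, mul_assoc D]
  refine mul_le_mul_of_nonneg_left ?_ hD0.le
  have h5 : δ / r * (1 / δ) ≤ r ^ (-(1 / 2) : ℝ) * δ ^ (-(1 / 2) : ℝ) := by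
    have e1 : δ / r * (1 / δ) = r ^ (-(1 / 2) : ℝ) * r ^ (-(1 / 2) : ℝ) := by
      rw [← Real.rpow_add hr0]; norm_num; rw [Real.rpow_neg_one]; field_simp
    rw [e1]
    gcongr ?_ * ?_
    exact Real.rpow_le_rpow_of_nonpos hδ hδr (by norm_num)
  linarith

/-- In dimension at least two, the limiting kernel decays logarithmically faster than `1/r`. -/
theorem abs_tailInt_log_le {d : ℝ} (hd : 2 ≤ d) {ε r : ℝ} (hε : 0 < ε) (hr : 4 ≤ r) :
    |tailInt d ε r| ≤ 4 * Real.Gamma (1 / 2) / (r * Real.log r) := by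
  have hd1 : 1 < d := by linarith
  have hr0 : 0 < r := by linarith
  have hlog : 0 < Real.log r := Real.log_pos (by linarith)
  have hb : ∀ l, 0 < l → |tailKernel d l r| ≤ 2 * r ^ (-(1 / 2) : ℝ) / Real.log r *
      (l ^ (-(1 / 2) : ℝ) * Real.exp (-(l * (r / 2)))) := by
    intro l hl
    have S := solutionPair hd1 hl
    have h1 := S.k_mul_log_le hd hl hr
    have h2 := S.pos 1 one_pos
    rw [abs_of_nonneg (tailKernel_nonneg hd1 hl (by linarith)), tailKernel, S.k_mul_u₁_one,
      div_le_iff₀ (by positivity)]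
    rw [Real.mul_rpow hl.le hr0.le] at h1
    rw [← le_div_iff₀ hlog] at h1
    refine h1.trans (le_of_eq ?_)
    field_simp
    ring
  refine (abs_integral_exp_mul_le hε
    ((integrableOn_rpow_neg_half (half_pos hr0)).const_mul _) hb).trans ?_
  rw [integral_const_mul, integral_rpow_neg_half (half_pos hr0), Real.div_rpow hr0.le (by norm_num)]
  have e1 : r ^ (-(1 / 2) : ℝ) * r ^ (-(1 / 2) : ℝ) = r⁻¹ := by
    rw [← Real.rpow_add hr0, ← Real.rpow_neg_one]; norm_num
  have e2 : (1:ℝ) / 2 ≤ (2:ℝ) ^ (-(1 / 2) : ℝ) := by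
    have : (2:ℝ) ^ (-1 : ℝ) ≤ (2:ℝ) ^ (-(1 / 2) : ℝ) :=
      Real.rpow_le_rpow_of_exponent_le (by norm_num) (by norm_num)
    rw [Real.rpow_neg_one] at this
    linarith
  have hΓ : 0 < Real.Gamma (1 / 2) := Real.Gamma_pos_of_pos (by norm_num)
  calc 2 * r ^ (-(1 / 2) : ℝ) / Real.log r *
        (Real.Gamma (1 / 2) * (r ^ (-(1 / 2) : ℝ) / 2 ^ (-(1 / 2) : ℝ)))
      = 2 * Real.Gamma (1 / 2) / Real.log r * (r ^ (-(1 / 2) : ℝ) * r ^ (-(1 / 2) : ℝ)) /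
          2 ^ (-(1 / 2) : ℝ) := by ring
    _ ≤ 2 * Real.Gamma (1 / 2) / Real.log r * (r ^ (-(1 / 2) : ℝ) * r ^ (-(1 / 2) : ℝ)) /
          (1 / 2) := by gcongr
    _ = _ := by rw [e1]; field_simp; ring

/-! ### Comparison with the weighted Hilbert kernel -/

/-- The homogeneous profile that dominates the error kernels. -/
def errorProfile (α s : ℝ) : ℝ :=
  if s ≤ 1 / 2 then s ^ α else if s < 2 then |1 - s| ^ (-(1 / 2) : ℝ) else s ^ (α - 1)

theorem measurable_errorProfile (α : ℝ) : Measurable (errorProfile α) := by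
  refine Measurable.ite measurableSet_Iic (by fun_prop) ?_
  exact Measurable.ite measurableSet_Iio (by fun_prop) (by fun_prop)

theorem errorProfile_nonneg {α s : ℝ} (hs : 0 ≤ s) : 0 ≤ errorProfile α s := by
  rw [errorProfile]; split_ifs <;> positivity

theorem abs_one_sub_rpow_le {α s : ℝ} (hα : 0 ≤ α) (h1 : 1 / 2 ≤ s) (h2 : s ≤ 2) :
    |1 - s ^ α| ≤ α * 2 ^ (α + 1) * |1 - s| := by
  have := Convex.norm_image_sub_le_of_norm_hasDerivWithin_le (f := fun s : ℝ => s ^ α)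
    (f' := fun s => α * s ^ (α - 1)) (s := Icc (1 / 2) 2) (C := α * 2 ^ (α + 1)) (x := s) (y := 1)
    (fun x hx => (Real.hasDerivAt_rpow_const (Or.inl (by linarith [hx.1]))).hasDerivWithinAt)
    (fun x hx => by
      have hx0 : 0 < x := by linarith [hx.1]
      rw [Real.norm_of_nonneg (by positivity)]
      gcongr
      rw [Real.rpow_sub_one hx0.ne', Real.rpow_add_one (by norm_num), div_eq_mul_inv]
      have : x⁻¹ ≤ 2 := by rw [inv_le_comm₀ hx0 (by norm_num)]; linarith [hx.1]
      gcongr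
      exact hx.2)
    (convex_Icc _ _) ⟨h1, h2⟩ (by norm_num)
  simpa using this

theorem abs_hilbertKernel_le_inv {ε : ℝ} (hε : 0 < ε) (y : ℝ) : |hilbertKernel ε y| ≤ |y|⁻¹ := by
  rcases eq_or_ne y 0 with rfl | hy
  · simp [hilbertKernel]
  have hy0 := abs_pos.2 hy
  rw [hilbertKernel, abs_div, abs_of_pos (show 0 < |y| + ε by positivity), ← one_div]
  have : |((SignType.sign y : SignType) : ℝ)| ≤ 1 := by
    rcases lt_trichotomy y 0 with h | h | h <;> simp [h]
  gcongr
  linarith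

/-- The factor (t/r)^α is inserted because for α = (d-1)/p it conjugates L^p(r^(d-1)dr) to the
unweighted space. Near the diagonal it costs |1-(t/r)^α|/|r-t| = O(1/r); elsewhere the Hilbert term
itself fits under the profile. The condition α ≤ d lets (t/r)^α dominate the (t/r)^d of
`sameInt_far_left`. The diagonal, a null set, is excluded since the profile takes the value 0^(-1/2)
= 0 there. -/
theorem sameInt_error_le {d α : ℝ} (hd : 1 < d) (hα : 0 ≤ α) (hαd : α ≤ d) :
    ∃ C : ℝ, 0 ≤ C ∧ ∀ ε r t : ℝ, 0 < ε → 1 < r → 1 < t → t ≠ r →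
      |sameInt d ε r t - 1 / 2 * ((t / r) ^ α * hilbertKernel ε (r - t)) -
        (if t ≤ r / 2 then tailInt d ε r else 0)| ≤ C * (r⁻¹ * errorProfile α (t / r)) := by
  set A := 2 ^ (d + 1) * (2 * (d + 1)) * (Real.Gamma (1 / 2) + 1) with hA
  have hG := Real.Gamma_pos_of_pos (show (0:ℝ) < 1 / 2 by norm_num)
  have hA0 : 0 ≤ A := by positivity
  refine ⟨2 ^ (d + 4) + 1 + A + α * 2 ^ (α + 1), by positivity, fun ε r t hε hr ht hne => ?_⟩
  have hr0 : 0 < r := by linarith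
  have ht0 : 0 < t := by linarith
  have hs0 : 0 < t / r := by positivity
  have hB : 0 ≤ α * 2 ^ (α + 1) := by positivity
  have hD : (0:ℝ) ≤ 2 ^ (d + 4) := by positivity
  have hh := abs_hilbertKernel_le_inv hε (r - t)
  have hq := mul_nonneg (inv_nonneg.2 hr0.le) (errorProfile_nonneg (α := α) hs0.le)
  rw [errorProfile] at hq ⊢
  rcases le_or_gt t (r / 2) with h1 | h1
  · have hs : t / r ≤ 1 / 2 := by rw [div_le_iff₀ hr0]; linarith
    rw [if_pos h1, if_pos hs] at *
    have e1 := (sameInt_far_left hd hε ht.le h1).1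
    have e2 : (t / r) ^ d ≤ (t / r) ^ α :=
      Real.rpow_le_rpow_of_exponent_ge hs0 (by linarith) hαd
    have e3 : |1 / 2 * ((t / r) ^ α * hilbertKernel ε (r - t))| ≤ r⁻¹ * (t / r) ^ α := by
      rw [abs_mul, abs_mul, abs_of_pos (show (0:ℝ) < (t / r) ^ α by positivity),
        abs_of_pos (show (0:ℝ) < 1 / 2 by norm_num)]
      have : |r - t|⁻¹ ≤ 2 * r⁻¹ := by
        rw [abs_of_pos (by linarith), ← div_eq_mul_inv, inv_eq_one_div,
          div_le_div_iff₀ (by linarith) hr0]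
        linarith
      calc 1 / 2 * ((t / r) ^ α * |hilbertKernel ε (r - t)|)
          ≤ 1 / 2 * ((t / r) ^ α * (2 * r⁻¹)) := by gcongr; exact hh.trans this
        _ = _ := by ring
    have e4 : r⁻¹ * (t / r) ^ d ≤ r⁻¹ * (t / r) ^ α := by gcongr
    calc _ = |(sameInt d ε r t - tailInt d ε r) -
          1 / 2 * ((t / r) ^ α * hilbertKernel ε (r - t))| := by ring_nf
      _ ≤ 2 ^ (d + 4) * (r⁻¹ * (t / r) ^ α) + r⁻¹ * (t / r) ^ α := by
        refine (abs_sub _ _).trans (add_le_add (e1.trans ?_) e3)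
        gcongr
      _ ≤ _ := by
        nlinarith [mul_nonneg hA0 hq, mul_nonneg hB hq]
  have hs1 : ¬ t / r ≤ 1 / 2 := by rw [div_le_iff₀ hr0]; linarith
  rw [if_neg (not_le.2 h1), if_neg hs1] at *
  rw [sub_zero]
  rcases lt_or_ge t (2 * r) with h2 | h2
  · have hs2 : t / r < 2 := by rw [div_lt_iff₀ hr0]; linarith
    rw [if_pos hs2] at *
    have e1 := sameInt_near hd hε hr.le ht.le h1.le h2.le hne
    rw [← hA] at e1
    have hx : |r - t| = r * |1 - t / r| := by
      rw [← abs_of_pos hr0, ← abs_mul, abs_of_pos hr0]; congr 1; field_simp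
    have hx0 : 0 < |1 - t / r| := by
      rw [abs_pos, sub_ne_zero]; intro h; apply hne; field_simp at h; exact h.symm
    have hx1 : |1 - t / r| ≤ 1 := by rw [abs_le]; constructor <;> linarith
    have hpow : (r * |r - t|) ^ (-(1 / 2) : ℝ) = r⁻¹ * |1 - t / r| ^ (-(1 / 2) : ℝ) := by
      rw [hx, ← mul_assoc, Real.mul_rpow (by positivity) (by positivity), ← sq,
        ← Real.rpow_natCast_mul hr0.le, ← Real.rpow_neg_one]
      norm_num
    rw [hpow] at e1
    have hone : (1:ℝ) ≤ |1 - t / r| ^ (-(1 / 2) : ℝ) :=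
      Real.one_le_rpow_of_pos_of_le_one_of_nonpos hx0 hx1 (by norm_num)
    have e3 : |1 / 2 * ((1 - (t / r) ^ α) * hilbertKernel ε (r - t))| ≤
        α * 2 ^ (α + 1) * (r⁻¹ * |1 - t / r| ^ (-(1 / 2) : ℝ)) := by
      rw [abs_mul, abs_mul, abs_of_pos (show (0:ℝ) < 1 / 2 by norm_num)]
      calc 1 / 2 * (|1 - (t / r) ^ α| * |hilbertKernel ε (r - t)|)
          ≤ 1 / 2 * ((α * 2 ^ (α + 1) * |1 - t / r|) * (r * |1 - t / r|)⁻¹) := by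
            gcongr
            · exact abs_one_sub_rpow_le hα (by linarith) hs2.le
            · rwa [← hx]
        _ = 1 / 2 * (α * 2 ^ (α + 1) * (r⁻¹ * 1)) := by field_simp
        _ ≤ α * 2 ^ (α + 1) * (r⁻¹ * 1) := by
            nlinarith [mul_nonneg hB (inv_nonneg.2 hr0.le)]
        _ ≤ _ := by gcongr
    calc _ = |(sameInt d ε r t - 1 / 2 * hilbertKernel ε (r - t)) +
          1 / 2 * ((1 - (t / r) ^ α) * hilbertKernel ε (r - t))| := by ring_nf
      _ ≤ A * (r⁻¹ * |1 - t / r| ^ (-(1 / 2) : ℝ)) +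
          α * 2 ^ (α + 1) * (r⁻¹ * |1 - t / r| ^ (-(1 / 2) : ℝ)) :=
        (abs_add_le _ _).trans (add_le_add e1 e3)
      _ ≤ _ := by nlinarith [mul_nonneg hD hq]
  · have hs2 : ¬ t / r < 2 := by rw [div_lt_iff₀ hr0]; linarith
    rw [if_neg hs2] at *
    have e1 := (sameInt_far_right hd hε hr.le h2).1
    have e2 : 1 / t = r⁻¹ * (t / r) ^ (-1 : ℝ) := by
      rw [Real.rpow_neg_one]; field_simp
    have e4 : (t / r) ^ (-1 : ℝ) ≤ (t / r) ^ (α - 1) :=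
      Real.rpow_le_rpow_of_exponent_le (by linarith) (by linarith)
    have e5 : 2 ^ (d + 3) / t ≤ 2 ^ (d + 4) * (r⁻¹ * (t / r) ^ (α - 1)) := by
      rw [div_eq_mul_one_div, e2]
      have : (2:ℝ) ^ (d + 3) ≤ 2 ^ (d + 4) :=
        Real.rpow_le_rpow_of_exponent_le (by norm_num) (by linarith)
      gcongr
    have e3 : |1 / 2 * ((t / r) ^ α * hilbertKernel ε (r - t))| ≤ r⁻¹ * (t / r) ^ (α - 1) := by
      rw [abs_mul, abs_mul, abs_of_pos (show (0:ℝ) < (t / r) ^ α by positivity),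
        abs_of_pos (show (0:ℝ) < 1 / 2 by norm_num)]
      have : |r - t|⁻¹ ≤ 2 * t⁻¹ := by
        rw [abs_of_neg (by linarith), ← div_eq_mul_inv, inv_eq_one_div,
          div_le_div_iff₀ (by linarith) ht0]
        linarith
      calc 1 / 2 * ((t / r) ^ α * |hilbertKernel ε (r - t)|)
          ≤ 1 / 2 * ((t / r) ^ α * (2 * t⁻¹)) := by gcongr; exact hh.trans this
        _ = _ := by rw [Real.rpow_sub_one hs0.ne']; field_simp
    calc _ ≤ 2 ^ (d + 4) * (r⁻¹ * (t / r) ^ (α - 1)) + r⁻¹ * (t / r) ^ (α - 1) :=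
        (abs_sub _ _).trans (add_le_add (e1.trans e5) e3)
      _ ≤ _ := by nlinarith [mul_nonneg hA0 hq, mul_nonneg hB hq]

/-- There is no Hilbert term. For t comparable to r the kernel is at most 1/(r-1) ≤ 2/r when r ≥ 2,
and of Stieltjes type when r < 2, where t < 4 bounds the power of t. -/
theorem crossInt_error_le {d α : ℝ} (hd : 1 < d) (hα : 0 ≤ α) (hαd : α ≤ d) :
    ∃ C : ℝ, 0 ≤ C ∧ ∀ ε r t : ℝ, 0 < ε → 1 < r → 1 < t → t ≠ r →
      |crossInt d ε r t + (if t ≤ r / 2 then tailInt d ε r else 0)| ≤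
        C * (r⁻¹ * errorProfile α (t / r) +
          (if r < 2 then ((r - 1) + (t - 1))⁻¹ else 0)) := by
  refine ⟨2 ^ (d + 4) + 2 + 4 ^ d, by positivity, fun ε r t hε hr ht hne => ?_⟩
  have hr0 : 0 < r := by linarith
  have ht0 : 0 < t := by linarith
  have hs0 : 0 < t / r := by positivity
  have hD : (0:ℝ) ≤ 2 ^ (d + 4) := by positivity
  have hF : (0:ℝ) ≤ 4 ^ d := by positivity
  have hq := mul_nonneg (inv_nonneg.2 hr0.le) (errorProfile_nonneg (α := α) hs0.le)
  have hX : 0 ≤ (if r < 2 then ((r - 1) + (t - 1))⁻¹ else 0) := by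
    split_ifs
    · exact inv_nonneg.2 (by linarith)
    · rfl
  set X := (if r < 2 then ((r - 1) + (t - 1))⁻¹ else 0) with hXdef
  have hcr := abs_crossInt_le hd hε hr ht.le
  rw [errorProfile] at hq ⊢
  rcases le_or_gt t (r / 2) with h1 | h1
  · have hs : t / r ≤ 1 / 2 := by rw [div_le_iff₀ hr0]; linarith
    rw [if_pos h1, if_pos hs] at *
    have e1 := (sameInt_far_left hd hε ht.le h1).2
    have e2 : (t / r) ^ d ≤ (t / r) ^ α :=
      Real.rpow_le_rpow_of_exponent_ge hs0 (by linarith) hαd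
    calc _ ≤ 2 ^ (d + 4) * (r⁻¹ * (t / r) ^ α) := e1.trans (by gcongr)
      _ ≤ _ := by nlinarith [mul_nonneg hF hq, mul_nonneg hF hX, mul_nonneg hD hX]
  have hs1 : ¬ t / r ≤ 1 / 2 := by rw [div_le_iff₀ hr0]; linarith
  rw [if_neg (not_le.2 h1), if_neg hs1] at *
  rw [add_zero]
  rcases lt_or_ge t (2 * r) with h2 | h2
  · have hs2 : t / r < 2 := by rw [div_lt_iff₀ hr0]; linarith
    rw [if_pos hs2] at *
    have hx0 : 0 < |1 - t / r| := by
      rw [abs_pos, sub_ne_zero]; intro h; apply hne; field_simp at h; exact h.symm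
    have hx1 : |1 - t / r| ≤ 1 := by rw [abs_le]; constructor <;> linarith
    have hone : (1:ℝ) ≤ |1 - t / r| ^ (-(1 / 2) : ℝ) :=
      Real.one_le_rpow_of_pos_of_le_one_of_nonpos hx0 hx1 (by norm_num)
    rcases lt_or_ge r 2 with h3 | h3
    · rw [if_pos h3] at hXdef
      have e4 : t ^ (d - 1) ≤ 4 ^ d :=
        (Real.rpow_le_rpow ht0.le (by linarith) (by linarith)).trans
          (Real.rpow_le_rpow_of_exponent_le (by norm_num) (by linarith))
      have e1 : |crossInt d ε r t| ≤ 4 ^ d * X := by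
        refine hcr.2.trans ?_
        rw [hXdef, div_eq_mul_inv]
        exact mul_le_mul_of_nonneg_right e4 (by rwa [hXdef] at hX)
      nlinarith [mul_nonneg hF hq, mul_nonneg hD hX, mul_nonneg hD hq]
    · have e1 : |crossInt d ε r t| ≤ 2 * (r⁻¹ * |1 - t / r| ^ (-(1 / 2) : ℝ)) := by
        refine hcr.1.trans ?_
        calc 1 / (r - 1) ≤ 2 * (r⁻¹ * 1) := by
              rw [mul_one, ← div_eq_mul_inv, div_le_div_iff₀ (by linarith) hr0]; linarith
          _ ≤ _ := by gcongr
      nlinarith [mul_nonneg hF hq, mul_nonneg hD hX, mul_nonneg hD hq, mul_nonneg hF hX]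
  · have hs2 : ¬ t / r < 2 := by rw [div_lt_iff₀ hr0]; linarith
    rw [if_neg hs2] at *
    have e1 := (sameInt_far_right hd hε hr.le h2).2
    have e2 : 1 / t = r⁻¹ * (t / r) ^ (-1 : ℝ) := by
      rw [Real.rpow_neg_one]; field_simp
    have e4 : (t / r) ^ (-1 : ℝ) ≤ (t / r) ^ (α - 1) :=
      Real.rpow_le_rpow_of_exponent_le (by linarith) (by linarith)
    have e5 : 2 ^ (d + 3) / t ≤ 2 ^ (d + 4) * (r⁻¹ * (t / r) ^ (α - 1)) := by
      rw [div_eq_mul_one_div, e2]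
      have : (2:ℝ) ^ (d + 3) ≤ 2 ^ (d + 4) :=
        Real.rpow_le_rpow_of_exponent_le (by norm_num) (by linarith)
      gcongr
    nlinarith [mul_nonneg hF hq, mul_nonneg hD hX, mul_nonneg hF hX]

/-! ### Weighted inequalities for the error, Stieltjes and tail terms -/

theorem integrableOn_abs_one_sub_rpow : IntegrableOn (fun s : ℝ => |1 - s| ^ (-(1 / 2) : ℝ))
    (Ioo (1 / 2) 2) := by
  have h := intervalIntegral.intervalIntegrable_rpow' (r := -(1 / 2)) (by norm_num)
    (a := 0) (b := 1)
  have h1 : IntegrableOn (fun s : ℝ => |1 - s| ^ (-(1 / 2) : ℝ)) (Ioc 0 1) := by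
    have := (h.comp_sub_left 1).symm
    simp only [sub_zero, sub_self] at this
    rw [intervalIntegrable_iff_integrableOn_Ioc_of_le (by norm_num)] at this
    refine this.congr_fun (fun s hs => ?_) measurableSet_Ioc
    simp only
    rw [abs_of_nonneg (by linarith [hs.2])]
  have h2 : IntegrableOn (fun s : ℝ => |1 - s| ^ (-(1 / 2) : ℝ)) (Ioc 1 2) := by
    have := h.comp_sub_right 1
    norm_num at this
    rw [intervalIntegrable_iff_integrableOn_Ioc_of_le (by norm_num)] at this
    refine this.congr_fun (fun s hs => ?_) measurableSet_Ioc
    simp only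
    rw [abs_of_neg (by linarith [hs.1])]
    ring_nf
  refine (h1.union h2).mono_set fun s hs => ?_
  rcases le_or_gt s 1 with h | h
  · exact Or.inl ⟨by linarith [hs.1], h⟩
  · exact Or.inr ⟨h, hs.2.le⟩

/-- With α = (d-1)/p the integrand is s^(-1/p) near 0 and s^(-1/p-1) near infinity, integrable as 0
< 1/p < 1; the singularity at s = 1 is an inverse square root. The exponent d/p comes from the norm
of dilations on L^p(r^(d-1)dr). -/
theorem lintegral_errorProfile_ne_top {d p : ℝ} (hd : 1 < d) (hp : 1 < p) :
    ∫⁻ s in Ioi 0, ENNReal.ofReal (errorProfile ((d - 1) / p) s) *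
      ENNReal.ofReal (s ^ (-((d - 1 + 1) / p))) ≠ ⊤ := by
  have hp0 : 0 < p := by linarith
  have hp1 : 1 / p < 1 := by rw [div_lt_one hp0]; exact hp
  have hp2 : 0 < 1 / p := by positivity
  have e : (d - 1) / p + -((d - 1 + 1) / p) = -(1 / p) := by field_simp; ring
  set α := (d - 1) / p
  set β := (d - 1 + 1) / p
  have hβ : 0 ≤ β := by
    have : 0 ≤ d - 1 + 1 := by linarith
    positivity
  have key : IntegrableOn (fun s => errorProfile α s * s ^ (-β)) (Ioi 0) := by
    have h1 : IntegrableOn (fun s => errorProfile α s * s ^ (-β)) (Ioc 0 (1 / 2)) := by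
      have := intervalIntegral.intervalIntegrable_rpow' (r := -(1 / p)) (by linarith)
        (a := 0) (b := 1 / 2)
      rw [intervalIntegrable_iff_integrableOn_Ioc_of_le (by norm_num)] at this
      refine this.congr_fun (fun s hs => ?_) measurableSet_Ioc
      simp only [errorProfile]
      rw [if_pos hs.2, ← Real.rpow_add hs.1, e]
    have h3 : IntegrableOn (fun s => errorProfile α s * s ^ (-β)) (Ici 2) := by
      have := integrableOn_Ioi_rpow_of_lt (a := -(1 / p) - 1) (by linarith) (c := 2) (by norm_num)
      rw [← integrableOn_Ici_iff_integrableOn_Ioi] at this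
      refine this.congr_fun (fun s hs => ?_) measurableSet_Ici
      have hs' : 2 ≤ s := hs
      simp only [errorProfile]
      rw [if_neg (by linarith), if_neg (by linarith), ← Real.rpow_add (by linarith), ← e]
      ring_nf
    have h2 : IntegrableOn (fun s => errorProfile α s * s ^ (-β)) (Ioo (1 / 2) 2) := by
      refine Integrable.mono' (integrableOn_abs_one_sub_rpow.const_mul (2 ^ β))
        (((measurable_errorProfile α).mul (by fun_prop)).aestronglyMeasurable) ?_
      filter_upwards [ae_restrict_mem measurableSet_Ioo] with s hs
      have hs0 : 0 < s := by linarith [hs.1]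
      simp only [errorProfile]
      rw [if_neg (by linarith [hs.1]), if_pos hs.2, Real.norm_of_nonneg (by positivity), mul_comm]
      gcongr
      rw [Real.rpow_neg hs0.le, ← Real.inv_rpow hs0.le]
      refine Real.rpow_le_rpow (by positivity) ?_ hβ
      rw [inv_le_comm₀ hs0 (by norm_num)]; linarith [hs.1]
    refine ((h1.union h2).union h3).mono_set fun s hs => ?_
    rcases le_or_gt s (1 / 2) with h | h
    · exact Or.inl (Or.inl ⟨hs, h⟩)
    · rcases lt_or_ge s 2 with h' | h'
      · exact Or.inl (Or.inr ⟨h, h'⟩)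
      · exact Or.inr h'
  have := key.lintegral_lt_top.ne
  rwa [setLIntegral_congr_fun measurableSet_Ioi fun s (hs : 0 < s) =>
    (ENNReal.ofReal_mul (errorProfile_nonneg hs.le) : ENNReal.ofReal _ = _)] at this

theorem lintegral_homogeneous_Ioi_one_le {p : ℝ} (hp : 1 < p) (b : ℝ) {κ g : ℝ → ℝ≥0∞}
    (hκ : Measurable κ) (hg : Measurable g) :
    ∫⁻ r in Ioi 1, (∫⁻ t in Ioi 1, ENNReal.ofReal r⁻¹ * κ (t / r) * g t) ^ p *
        ENNReal.ofReal (r ^ b) ≤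
      (∫⁻ s in Ioi 0, κ s * ENNReal.ofReal (s ^ (-((b + 1) / p)))) ^ p *
        ∫⁻ t in Ioi 1, g t ^ p * ENNReal.ofReal (t ^ b) := by
  have hp0 : 0 < p := by linarith
  have hsub : Ioi (1:ℝ) ⊆ Ioi 0 := Ioi_subset_Ioi zero_le_one
  have h := lintegral_homogeneous_le hp b hκ (hg.indicator (measurableSet_Ioi (a := (1:ℝ))))
  have e1 : ∀ F : ℝ → ℝ≥0∞, ∫⁻ t in Ioi 0, (Ioi 1).indicator F t = ∫⁻ t in Ioi 1, F t := by
    intro F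
    rw [lintegral_indicator measurableSet_Ioi, Measure.restrict_restrict measurableSet_Ioi,
      inter_eq_left.2 hsub]
  have e2 : ∀ r : ℝ, ∫⁻ t in Ioi 0, ENNReal.ofReal r⁻¹ * κ (t / r) * (Ioi 1).indicator g t =
      ∫⁻ t in Ioi 1, ENNReal.ofReal r⁻¹ * κ (t / r) * g t := by
    intro r
    rw [← e1]
    refine lintegral_congr fun t => ?_
    by_cases ht : t ∈ Ioi (1:ℝ) <;> simp [ht]
  have e3 : ∫⁻ t in Ioi 0, (Ioi 1).indicator g t ^ p * ENNReal.ofReal (t ^ b) =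
      ∫⁻ t in Ioi 1, g t ^ p * ENNReal.ofReal (t ^ b) := by
    rw [← e1]
    refine lintegral_congr fun t => ?_
    by_cases ht : t ∈ Ioi (1:ℝ) <;> simp [ht, hp0]
  simp only [e2, e3] at h
  exact (lintegral_mono_set hsub).trans h

theorem lintegral_Ioi_one_shift (F : ℝ → ℝ≥0∞) :
    ∫⁻ t in Ioi 1, F t = ∫⁻ t in Ioi 0, F (1 + t) := by
  rw [← lintegral_indicator measurableSet_Ioi, ← lintegral_indicator measurableSet_Ioi,
    ← lintegral_add_left_eq_self _ (1:ℝ)]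
  refine lintegral_congr fun t => ?_
  simp [indicator]

theorem lintegral_stieltjes_ne_top {p : ℝ} (hp : 1 < p) :
    ∫⁻ s in Ioi 0, ENNReal.ofReal (1 + s)⁻¹ * ENNReal.ofReal (s ^ (-((0 + 1) / p))) ≠ ⊤ := by
  have hp0 : 0 < p := by linarith
  have hp1 : 1 / p < 1 := by rw [div_lt_one hp0]; exact hp
  have hp2 : 0 < 1 / p := by positivity
  rw [zero_add]
  have hm : Measurable fun s : ℝ => (1 + s)⁻¹ * s ^ (-(1 / p)) := by fun_prop
  have key : IntegrableOn (fun s : ℝ => (1 + s)⁻¹ * s ^ (-(1 / p))) (Ioi 0) := by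
    have h1 : IntegrableOn (fun s : ℝ => (1 + s)⁻¹ * s ^ (-(1 / p))) (Ioc 0 1) := by
      have := intervalIntegral.intervalIntegrable_rpow' (r := -(1 / p)) (by linarith)
        (a := 0) (b := 1)
      rw [intervalIntegrable_iff_integrableOn_Ioc_of_le (by norm_num)] at this
      refine this.mono' hm.aestronglyMeasurable ?_
      filter_upwards [ae_restrict_mem measurableSet_Ioc] with s hs
      have hs0 := hs.1
      rw [Real.norm_of_nonneg (by positivity)]
      exact mul_le_of_le_one_left (by positivity) (inv_le_one_of_one_le₀ (by linarith))
    have h2 : IntegrableOn (fun s : ℝ => (1 + s)⁻¹ * s ^ (-(1 / p))) (Ioi 1) := by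
      have := integrableOn_Ioi_rpow_of_lt (a := -(1 / p) - 1) (by linarith) (c := 1) (by norm_num)
      refine this.mono' hm.aestronglyMeasurable ?_
      filter_upwards [ae_restrict_mem measurableSet_Ioi] with s hs
      have hs0 : 0 < s := lt_trans one_pos hs
      rw [Real.norm_of_nonneg (by positivity), Real.rpow_sub_one hs0.ne',
        div_eq_inv_mul (s ^ (-(1 / p))) s]
      gcongr
      linarith
    refine (h1.union h2).mono_set fun s hs => ?_
    rcases le_or_gt s 1 with h | h
    · exact Or.inl ⟨hs, h⟩
    · exact Or.inr h
  have := key.lintegral_lt_top.ne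
  rwa [setLIntegral_congr_fun measurableSet_Ioi fun s (hs : 0 < s) =>
    (ENNReal.ofReal_mul (by positivity) : ENNReal.ofReal _ = _)] at this

/-- Translation by 1 gives the kernel 1/(r+t), homogeneous of degree -1 on the unweighted half-line.
The weight is harmless: it is at most 2^(d-1) for r < 2, and at least one in t. -/
theorem lintegral_stieltjes_le {d p : ℝ} (hd : 1 < d) (hp : 1 < p) :
    ∃ C : ℝ≥0∞, C ≠ ⊤ ∧ ∀ g : ℝ → ℝ≥0∞, Measurable g →
      ∫⁻ r in Ioi 1, (∫⁻ t in Ioi 1,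
          ENNReal.ofReal (if r < 2 then ((r - 1) + (t - 1))⁻¹ else 0) * g t) ^ p *
          ENNReal.ofReal (r ^ (d - 1)) ≤
        C * ∫⁻ t in Ioi 1, g t ^ p * ENNReal.ofReal (t ^ (d - 1)) := by
  have hp0 : 0 < p := by linarith
  set M := ∫⁻ s in Ioi 0, ENNReal.ofReal (1 + s)⁻¹ * ENNReal.ofReal (s ^ (-((0 + 1) / p)))
  have hM : M ≠ ⊤ := lintegral_stieltjes_ne_top hp
  refine ⟨ENNReal.ofReal (2 ^ (d - 1)) * M ^ p,
    ENNReal.mul_ne_top ENNReal.ofReal_ne_top (ENNReal.rpow_ne_top_of_nonneg hp0.le hM),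
    fun g hg => ?_⟩
  have h := lintegral_homogeneous_le hp 0 (κ := fun s => ENNReal.ofReal (1 + s)⁻¹)
    (g := fun t => g (1 + t)) (by fun_prop) (hg.comp (by fun_prop))
  simp only [Real.rpow_zero, ENNReal.ofReal_one, mul_one] at h
  calc ∫⁻ r in Ioi 1, (∫⁻ t in Ioi 1,
          ENNReal.ofReal (if r < 2 then ((r - 1) + (t - 1))⁻¹ else 0) * g t) ^ p *
          ENNReal.ofReal (r ^ (d - 1))
      ≤ ∫⁻ r in Ioi 1, ENNReal.ofReal (2 ^ (d - 1)) * (∫⁻ t in Ioi 1,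
          ENNReal.ofReal ((r - 1) + (t - 1))⁻¹ * g t) ^ p := by
        refine setLIntegral_mono' measurableSet_Ioi fun r (hr : 1 < r) => ?_
        by_cases h2 : r < 2
        · simp only [if_pos h2]
          rw [mul_comm]
          gcongr
        · simp [if_neg h2, hp0]
    _ = ENNReal.ofReal (2 ^ (d - 1)) * ∫⁻ r in Ioi 0, (∫⁻ t in Ioi 0,
          ENNReal.ofReal r⁻¹ * ENNReal.ofReal (1 + t / r)⁻¹ * g (1 + t)) ^ p := by
        rw [lintegral_const_mul' _ _ ENNReal.ofReal_ne_top, lintegral_Ioi_one_shift]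
        congr 1
        refine setLIntegral_congr_fun measurableSet_Ioi fun r (hr : 0 < r) => ?_
        rw [lintegral_Ioi_one_shift]
        congr 1
        refine setLIntegral_congr_fun measurableSet_Ioi fun t (ht : 0 < t) => ?_
        rw [← ENNReal.ofReal_mul (by positivity)]
        congr 2
        rw [← mul_inv]; congr 1; field_simp; ring
    _ ≤ ENNReal.ofReal (2 ^ (d - 1)) * (M ^ p * ∫⁻ t in Ioi 0, g (1 + t) ^ p) :=
        mul_le_mul_right h _
    _ ≤ _ := by
        rw [mul_assoc]
        refine mul_le_mul_right (mul_le_mul_right ?_ _) _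
        rw [← lintegral_Ioi_one_shift (fun t => g t ^ p)]
        refine setLIntegral_mono' measurableSet_Ioi fun t (ht : 1 < t) => ?_
        refine le_mul_of_one_le_right (zero_le) ?_
        rw [ENNReal.one_le_ofReal]
        exact Real.one_le_rpow ht.le (by linarith)

theorem measurable_sameInt (d ε : ℝ) : Measurable fun x : ℝ × ℝ => sameInt d ε x.1 x.2 := by
  have h : Measurable fun x : (ℝ × ℝ) × ℝ =>
      Real.exp (-(x.2 * ε)) * sameKernel d x.2 x.1.1 x.1.2 :=
    Measurable.mul (by fun_prop) ((measurable_sameKernel d).comp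
      (g := fun x : ℝ × ℝ × ℝ => sameKernel d x.1 x.2.1 x.2.2)
      (f := fun x : (ℝ × ℝ) × ℝ => (x.2, x.1.1, x.1.2)) (by fun_prop))
  exact (h.stronglyMeasurable.integral_prod_right' (ν := volume.restrict (Ioi 0))).measurable

theorem measurable_crossInt (d ε : ℝ) : Measurable fun x : ℝ × ℝ => crossInt d ε x.1 x.2 := by
  have h : Measurable fun x : (ℝ × ℝ) × ℝ =>
      Real.exp (-(x.2 * ε)) * crossKernel d x.2 x.1.1 x.1.2 :=
    Measurable.mul (by fun_prop) ((measurable_crossKernel d).comp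
      (g := fun x : ℝ × ℝ × ℝ => crossKernel d x.1 x.2.1 x.2.2)
      (f := fun x : (ℝ × ℝ) × ℝ => (x.2, x.1.1, x.1.2)) (by fun_prop))
  exact (h.stronglyMeasurable.integral_prod_right' (ν := volume.restrict (Ioi 0))).measurable

theorem measurable_tailInt (d ε : ℝ) : Measurable (tailInt d ε) := by
  have h : Measurable fun x : ℝ × ℝ => Real.exp (-(x.2 * ε)) * tailKernel d x.2 x.1 :=
    Measurable.mul (by fun_prop) ((measurable_tailKernel d).comp
      (g := fun x : ℝ × ℝ => tailKernel d x.1 x.2) measurable_swap)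
  exact (h.stronglyMeasurable.integral_prod_right' (ν := volume.restrict (Ioi 0))).measurable

theorem abs_sameInt_le_inv {d : ℝ} (hd : 1 < d) {ε r t : ℝ} (hε : 0 < ε) (hr : 1 ≤ r)
    (ht : 1 ≤ t) : |sameInt d ε r t| ≤ 1 / ε := by
  rw [← integral_exp_neg_mul hε, ← Real.norm_eq_abs]
  refine norm_integral_le_of_norm_le (integrableOn_exp_neg_mul hε) ?_
  filter_upwards [ae_restrict_mem measurableSet_Ioi] with l hl
  rw [norm_mul, Real.norm_of_nonneg (Real.exp_pos _).le]
  exact mul_le_of_le_one_right (Real.exp_pos _).le (abs_sameKernel_le hd hl hr ht)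

theorem abs_crossInt_le_inv {d : ℝ} (hd : 1 < d) {ε r t : ℝ} (hε : 0 < ε) (hr : 1 ≤ r)
    (ht : 1 ≤ t) : |crossInt d ε r t| ≤ 1 / ε := by
  rw [← integral_exp_neg_mul hε, ← Real.norm_eq_abs]
  refine norm_integral_le_of_norm_le (integrableOn_exp_neg_mul hε) ?_
  filter_upwards [ae_restrict_mem measurableSet_Ioi] with l hl
  rw [norm_mul, Real.norm_of_nonneg (Real.exp_pos _).le]
  exact mul_le_of_le_one_right (Real.exp_pos _).le (abs_crossKernel_le hd hl hr ht)

theorem lintegral_Ioi_one_exp (F : ℝ → ℝ≥0∞) :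
    ∫⁻ t in Ioi 1, F t = ∫⁻ τ in Ioi 0, ENNReal.ofReal (Real.exp τ) * F (Real.exp τ) := by
  have himg : Real.exp '' Ioi 0 = Ioi 1 := by
    ext t
    constructor
    · rintro ⟨s, hs, rfl⟩; exact Real.one_lt_exp_iff.2 hs
    · intro ht
      exact ⟨Real.log t, Real.log_pos ht, Real.exp_log (lt_trans one_pos ht)⟩
  rw [← himg, lintegral_image_eq_lintegral_abs_deriv_mul measurableSet_Ioi
    (fun x _ => (Real.hasDerivAt_exp x).hasDerivWithinAt) Real.exp_injective.injOn]
  simp only [abs_of_pos (Real.exp_pos _)]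

theorem lintegral_indicator_Iic_ne_top {c β : ℝ} (hc : 0 < c) (hβ : β < 1) :
    ∫⁻ s in Ioi 0, (Iic c).indicator 1 s * ENNReal.ofReal (s ^ (-β)) ≠ ⊤ := by
  have := intervalIntegral.intervalIntegrable_rpow' (r := -β) (by linarith) (a := 0) (b := c)
  rw [intervalIntegrable_iff_integrableOn_Ioc_of_le hc.le] at this
  have h2 := this.lintegral_lt_top.ne
  convert! h2 using 1
  rw [← Ioi_inter_Iic, inter_comm, ← Measure.restrict_restrict measurableSet_Iic,
    ← lintegral_indicator measurableSet_Iic]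
  refine lintegral_congr fun s => ?_
  by_cases hs : s ∈ Iic c <;> simp [hs]

theorem lintegral_indicator_Ioi_ne_top {c β : ℝ} (hc : 0 < c) (hβ : 1 < β) :
    ∫⁻ s in Ioi 0, (Ioi c).indicator 1 s * ENNReal.ofReal (s ^ (-β)) ≠ ⊤ := by
  have := integrableOn_Ioi_rpow_of_lt (a := -β) (by linarith) hc
  have h2 := this.lintegral_lt_top.ne
  convert! h2 using 1
  have : Ioi c = Ioi c ∩ Ioi 0 := by
    rw [Ioi_inter_Ioi, sup_of_le_left hc.le]
  rw [this, ← Measure.restrict_restrict measurableSet_Ioi, ← this,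
    ← lintegral_indicator (measurableSet_Ioi (a := c)) (fun s => ENNReal.ofReal (s ^ (-β)))]
  refine lintegral_congr fun s => ?_
  by_cases hs : s ∈ Ioi c <;> simp only [hs, indicator_of_mem, Pi.one_apply, one_mul,
    not_false_eq_true, indicator_of_notMem, zero_mul]

/-- The Hardy inequality with a logarithm, in the critical case. -/
theorem lintegral_log_hardy_le {p : ℝ} (hp : 1 < p) :
    ∃ C : ℝ≥0∞, C ≠ ⊤ ∧ ∀ g : ℝ → ℝ≥0∞, Measurable g →
      ∫⁻ r in Ioi 1, (ENNReal.ofReal (r * Real.log r)⁻¹ * ∫⁻ t in Ioc 1 r, g t) ^ p *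
          ENNReal.ofReal (r ^ (p - 1)) ≤
        C * ∫⁻ t in Ioi 1, g t ^ p * ENNReal.ofReal (t ^ (p - 1)) := by
  have hp0 : 0 < p := by linarith
  have hp1 : (0 + 1) / p < 1 := by rw [zero_add, div_lt_one hp0]; exact hp
  refine ⟨_, ENNReal.rpow_ne_top_of_nonneg hp0.le (lintegral_indicator_Iic_ne_top one_pos hp1),
    fun g hg => ?_⟩
  -- With r = e^τ and t = e^σ, the weight t^(p-1)dt becomes unweighted for the function e^σ·g(e^σ),
  -- and the operator becomes the mean over (0, τ): the classical Hardy inequality.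
  have h := lintegral_homogeneous_le hp 0 (κ := (Iic 1).indicator 1)
    (g := fun σ => ENNReal.ofReal (Real.exp σ) * g (Real.exp σ))
    (measurable_one.indicator measurableSet_Iic)
    (Measurable.mul (by fun_prop) (hg.comp Real.measurable_exp))
  simp only [Real.rpow_zero, ENNReal.ofReal_one, mul_one] at h
  have hexp : ∀ τ : ℝ, ENNReal.ofReal (Real.exp τ) * ENNReal.ofReal (Real.exp τ ^ (p - 1)) =
      ENNReal.ofReal (Real.exp τ) ^ p := by
    intro τ
    rw [← ENNReal.ofReal_mul (Real.exp_pos τ).le, ENNReal.ofReal_rpow_of_pos (Real.exp_pos τ)]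
    congr 1
    rw [Real.rpow_sub_one (Real.exp_pos τ).ne']
    field_simp
  have eR : ∫⁻ t in Ioi 1, g t ^ p * ENNReal.ofReal (t ^ (p - 1)) =
      ∫⁻ σ in Ioi 0, (ENNReal.ofReal (Real.exp σ) * g (Real.exp σ)) ^ p := by
    rw [lintegral_Ioi_one_exp]
    refine lintegral_congr fun σ => ?_
    rw [mul_left_comm, hexp, ENNReal.mul_rpow_of_nonneg _ _ hp0.le, mul_comm]
  have eI : ∀ τ : ℝ, 0 < τ → ∫⁻ t in Ioc 1 (Real.exp τ), g t =
      ∫⁻ σ in Ioi 0, (Iic 1).indicator 1 (σ / τ) *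
        (ENNReal.ofReal (Real.exp σ) * g (Real.exp σ)) := by
    intro τ hτ
    rw [← Ioi_inter_Iic, inter_comm, ← Measure.restrict_restrict measurableSet_Iic,
      ← lintegral_indicator measurableSet_Iic, lintegral_Ioi_one_exp]
    refine lintegral_congr fun σ => ?_
    by_cases hσ : σ ≤ τ
    · rw [indicator_of_mem (show Real.exp σ ∈ Iic (Real.exp τ) from Real.exp_le_exp.2 hσ),
        indicator_of_mem (show σ / τ ∈ Iic (1:ℝ) from (div_le_one hτ).2 hσ)]
      simp
    · rw [indicator_of_notMem (show Real.exp σ ∉ Iic (Real.exp τ) from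
          fun h => hσ (Real.exp_le_exp.1 h)),
        indicator_of_notMem (show σ / τ ∉ Iic (1:ℝ) from fun h => hσ ((div_le_one hτ).1 h))]
      simp
  rw [eR]
  refine le_trans (le_of_eq ?_) h
  rw [lintegral_Ioi_one_exp]
  refine setLIntegral_congr_fun measurableSet_Ioi fun τ (hτ : 0 < τ) => ?_
  rw [mul_left_comm, hexp, ← ENNReal.mul_rpow_of_nonneg _ _ hp0.le, eI τ hτ, Real.log_exp]
  congr 1
  rw [mul_right_comm, ← ENNReal.ofReal_mul (by positivity),
    show (Real.exp τ * τ)⁻¹ * Real.exp τ = τ⁻¹ by field_simp,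
    ← lintegral_const_mul' _ _ ENNReal.ofReal_ne_top]
  simp only [mul_assoc]

/-- For r > 2 the tail is at most 2/r, so the homogeneous kernel r⁻¹·1_A(t/r) dominates. The set A
is {s ≤ 1/2} for Hardy's inequality and {s > 1/2} for its dual. -/
theorem tail_le_of_indicator {d p : ℝ} (hd : 1 < d) (hp : 1 < p) {A : Set ℝ}
    (hA : MeasurableSet A)
    (hM : ∫⁻ s in Ioi 0, A.indicator 1 s * ENNReal.ofReal (s ^ (-((d - 1 + 1) / p))) ≠ ⊤) :
    ∃ C : ℝ≥0∞, C ≠ ⊤ ∧ ∀ ε : ℝ, 0 < ε → ∀ φ : ℝ → ℝ, Measurable φ →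
      (∀ r, 2 < r → ‖∫ t in Ioc 1 (r / 2), φ t‖ₑ ≤
        ∫⁻ t in Ioi 1, A.indicator 1 (t / r) * ‖φ t‖ₑ) →
      ∫⁻ r in Ioi 1, (‖tailInt d ε r‖ₑ * ‖∫ t in Ioc 1 (r / 2), φ t‖ₑ) ^ p *
          ENNReal.ofReal (r ^ (d - 1)) ≤
        C * ∫⁻ t in Ioi 1, ‖φ t‖ₑ ^ p * ENNReal.ofReal (t ^ (d - 1)) := by
  have hp0 : 0 < p := by linarith
  set M := ∫⁻ s in Ioi 0, A.indicator 1 s * ENNReal.ofReal (s ^ (-((d - 1 + 1) / p)))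
  refine ⟨2 ^ p * M ^ p, ENNReal.mul_ne_top (by finiteness)
    (ENNReal.rpow_ne_top_of_nonneg hp0.le hM), fun ε hε φ hφ h => ?_⟩
  have key := lintegral_homogeneous_Ioi_one_le hp (d - 1) (κ := A.indicator 1)
    (g := fun t => ‖φ t‖ₑ) (measurable_one.indicator hA) hφ.enorm
  rw [mul_assoc]
  refine le_trans ?_ (mul_le_mul_right key _)
  rw [← lintegral_const_mul' _ _ (by finiteness)]
  refine setLIntegral_mono' measurableSet_Ioi fun r (hr : 1 < r) => ?_
  rw [← mul_assoc, ← ENNReal.mul_rpow_of_nonneg _ _ hp0.le]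
  refine mul_le_mul_left (ENNReal.rpow_le_rpow ?_ hp0.le) _
  rcases le_or_gt r 2 with h2 | h2
  · rw [Ioc_eq_empty (by linarith)]; simp
  have ht : ‖tailInt d ε r‖ₑ ≤ 2 * ENNReal.ofReal r⁻¹ := by
    rw [Real.enorm_eq_ofReal_abs, show (2:ℝ≥0∞) = ENNReal.ofReal 2 by simp,
      ← ENNReal.ofReal_mul (by norm_num)]
    refine ENNReal.ofReal_le_ofReal ((abs_tailInt_le hd hε hr).trans ?_)
    rw [← div_eq_mul_inv, div_le_div_iff₀ (by linarith) (by linarith)]; linarith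
  calc _ ≤ 2 * ENNReal.ofReal r⁻¹ * ∫⁻ t in Ioi 1, A.indicator 1 (t / r) * ‖φ t‖ₑ :=
        mul_le_mul' ht (h r h2)
    _ = _ := by
        rw [mul_assoc, ← lintegral_const_mul' _ _ ENNReal.ofReal_ne_top]
        simp only [mul_assoc]

/-- Extends `abs_tailInt_log_le` to 2 < r < 4, where log r ≤ 2 and the bound 1/(r-1) is as good. -/
theorem abs_tailInt_le_log {d : ℝ} (hd : 2 ≤ d) {ε r : ℝ} (hε : 0 < ε) (hr : 2 < r) :
    |tailInt d ε r| ≤ (4 * Real.Gamma (1 / 2) + 4) * (r * Real.log r)⁻¹ := by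
  have hG := Real.Gamma_pos_of_pos (show (0:ℝ) < 1 / 2 by norm_num)
  have hlog : 0 < Real.log r := Real.log_pos (by linarith)
  have hr0 : 0 < r := by linarith
  have h0 : 0 < (r * Real.log r)⁻¹ := by positivity
  rcases le_or_gt 4 r with h | h
  · refine (abs_tailInt_log_le hd hε h).trans ?_
    rw [div_eq_mul_inv]
    gcongr
    linarith
  · refine (abs_tailInt_le (by linarith) hε (by linarith)).trans ?_
    have h4 : Real.log r ≤ 2 := by
      have h1 : Real.log r ≤ Real.log 4 := Real.log_le_log hr0 h.le
      have h2 : Real.log 4 = 2 * Real.log 2 := by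
        rw [show (4:ℝ) = 2 ^ 2 by norm_num, Real.log_pow]; norm_num
      linarith [Real.log_two_lt_d9]
    calc 1 / (r - 1) ≤ 2 / r := by
          rw [div_le_div_iff₀ (by linarith) hr0]; linarith
      _ ≤ 4 * (r * Real.log r)⁻¹ := by
          rw [← div_eq_mul_inv, div_le_div_iff₀ hr0 (by positivity)]
          nlinarith
      _ ≤ _ := by gcongr; linarith

theorem tail_le {d p : ℝ} (hd : 1 < d) (hp : 1 < p) (hpd : d < 2 → p ≠ d) :
    ∃ C : ℝ≥0∞, C ≠ ⊤ ∧ ∀ ε : ℝ, 0 < ε → ∀ φ : ℝ → ℝ, IsBddCompact φ → ∫ t in Ioi 1, φ t = 0 →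
      ∫⁻ r in Ioi 1, (‖tailInt d ε r‖ₑ * ‖∫ t in Ioc 1 (r / 2), φ t‖ₑ) ^ p *
          ENNReal.ofReal (r ^ (d - 1)) ≤
        C * ∫⁻ t in Ioi 1, ‖φ t‖ₑ ^ p * ENNReal.ofReal (t ^ (d - 1)) := by
  have hp0 : 0 < p := by linarith
  -- The relevant power s^(-d/p) is integrable at infinity if p < d and at 0 if p > d. For p < d the
  -- vanishing integral of φ moves the integration from (1, r/2] to (r/2, ∞). For p = d, where d ≥ 2
  -- by hypothesis, the logarithmic gain in the tail replaces integrability.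
  rcases lt_trichotomy p d with h | h | h
  · have hM := lintegral_indicator_Ioi_ne_top (c := 1 / 2) (β := (d - 1 + 1) / p) (by norm_num)
      (by rw [one_lt_div hp0]; linarith)
    obtain ⟨C, hC, hh⟩ := tail_le_of_indicator hd hp measurableSet_Ioi hM
    refine ⟨C, hC, fun ε hε φ hφ h0 => hh ε hε φ hφ.measurable fun r hr => ?_⟩
    have hr0 : 0 < r := by linarith
    have hu : Ioi (1:ℝ) = Ioc 1 (r / 2) ∪ Ioi (r / 2) :=
      (Ioc_union_Ioi_eq_Ioi (by linarith)).symm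
    have hi := hφ.integrable
    rw [hu, setIntegral_union (Ioc_disjoint_Ioi le_rfl) measurableSet_Ioi hi.integrableOn
      hi.integrableOn] at h0
    rw [eq_neg_of_add_eq_zero_left h0, enorm_neg]
    refine (enorm_integral_le_lintegral_enorm _).trans (le_of_eq ?_)
    have h1 : Ioi (r / 2) = Ioi (r / 2) ∩ Ioi 1 := by
      rw [Ioi_inter_Ioi, sup_of_le_left (by linarith)]
    rw [h1, ← Measure.restrict_restrict measurableSet_Ioi,
      ← lintegral_indicator measurableSet_Ioi]
    refine lintegral_congr fun t => ?_
    have h2 : t / r ∈ Ioi (1 / 2 : ℝ) ↔ t ∈ Ioi (r / 2) := by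
      simp only [mem_Ioi, lt_div_iff₀ hr0]
      constructor <;> intro h <;> linarith
    by_cases ht : t ∈ Ioi (r / 2)
    · rw [indicator_of_mem ht, indicator_of_mem (h2.2 ht)]; simp
    · rw [indicator_of_notMem ht, indicator_of_notMem fun h => ht (h2.1 h)]; simp
  · subst h
    have h2 : 2 ≤ p := by
      by_contra h; exact hpd (not_le.1 h) rfl
    obtain ⟨C, hC, hh⟩ := lintegral_log_hardy_le hp
    set B := ENNReal.ofReal (4 * Real.Gamma (1 / 2) + 4) with hB
    have hBt : B ≠ ⊤ := ENNReal.ofReal_ne_top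
    have hG := Real.Gamma_pos_of_pos (show (0:ℝ) < 1 / 2 by norm_num)
    refine ⟨B ^ p * C, ENNReal.mul_ne_top (ENNReal.rpow_ne_top_of_nonneg hp0.le hBt) hC,
      fun ε hε φ hφ _ => ?_⟩
    rw [mul_assoc]
    refine le_trans ?_ (mul_le_mul_right (hh _ hφ.measurable.enorm) _)
    rw [← lintegral_const_mul' _ _ (ENNReal.rpow_ne_top_of_nonneg hp0.le hBt)]
    refine setLIntegral_mono' measurableSet_Ioi fun r (hr : 1 < r) => ?_
    rw [← mul_assoc, ← ENNReal.mul_rpow_of_nonneg _ _ hp0.le]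
    refine mul_le_mul_left (ENNReal.rpow_le_rpow ?_ hp0.le) _
    rcases le_or_gt r 2 with h3 | h3
    · rw [Ioc_eq_empty (by linarith)]; simp
    rw [← mul_assoc]
    refine mul_le_mul' ?_ ?_
    · rw [Real.enorm_eq_ofReal_abs, hB, ← ENNReal.ofReal_mul (by positivity)]
      exact ENNReal.ofReal_le_ofReal (abs_tailInt_le_log h2 hε h3)
    · refine (enorm_integral_le_lintegral_enorm _).trans (lintegral_mono_set ?_)
      exact Ioc_subset_Ioc_right (by linarith)
  · have hM := lintegral_indicator_Iic_ne_top (c := 1 / 2) (β := (d - 1 + 1) / p) (by norm_num)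
      (by rw [div_lt_one hp0]; linarith)
    obtain ⟨C, hC, hh⟩ := tail_le_of_indicator hd hp measurableSet_Iic hM
    refine ⟨C, hC, fun ε hε φ hφ _ => hh ε hε φ hφ.measurable fun r hr => ?_⟩
    have hr0 : 0 < r := by linarith
    refine (enorm_integral_le_lintegral_enorm _).trans (le_of_eq ?_)
    rw [← Ioi_inter_Iic, inter_comm, ← Measure.restrict_restrict measurableSet_Iic,
      ← lintegral_indicator measurableSet_Iic]
    refine lintegral_congr fun t => ?_
    have h2 : t / r ∈ Iic (1 / 2 : ℝ) ↔ t ∈ Iic (r / 2) := by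
      simp only [mem_Iic, div_le_iff₀ hr0]
      constructor <;> intro h <;> linarith
    by_cases ht : t ∈ Iic (r / 2)
    · rw [indicator_of_mem ht, indicator_of_mem (h2.2 ht)]; simp
    · rw [indicator_of_notMem ht, indicator_of_notMem fun h => ht (h2.1 h)]; simp

/-! ### The uniform L^p bound on a half-line -/

/-- `A` is measurable, and its `p`-th power integral over `(1, ∞)` is at most `c * W`. -/
def PowerBound (d p : ℝ) (W c : ℝ≥0∞) (A : ℝ → ℝ≥0∞) : Prop :=
  Measurable A ∧ ∫⁻ r in Ioi 1, A r ^ p * ENNReal.ofReal (r ^ (d - 1)) ≤ c * W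

theorem PowerBound.add {d p : ℝ} {W a b : ℝ≥0∞} {A B : ℝ → ℝ≥0∞} (hp : 1 < p)
    (hA : PowerBound d p W a A) (hB : PowerBound d p W b B) :
    PowerBound d p W (2 ^ (p - 1) * (a + b)) fun r => A r + B r := by
  refine ⟨hA.1.add hB.1, ?_⟩
  have hc : (2:ℝ≥0∞) ^ (p - 1) ≠ ⊤ := by
    refine ENNReal.rpow_ne_top_of_nonneg (by linarith) (by finiteness)
  calc ∫⁻ r in Ioi 1, (A r + B r) ^ p * ENNReal.ofReal (r ^ (d - 1))
      ≤ ∫⁻ r in Ioi 1, 2 ^ (p - 1) * (A r ^ p * ENNReal.ofReal (r ^ (d - 1)) +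
          B r ^ p * ENNReal.ofReal (r ^ (d - 1))) := by
        refine lintegral_mono fun r => ?_
        rw [← add_mul, ← mul_assoc]
        exact mul_le_mul_left (ENNReal.rpow_add_le_mul_rpow_add_rpow _ _ hp.le) _
    _ = 2 ^ (p - 1) * ((∫⁻ r in Ioi 1, A r ^ p * ENNReal.ofReal (r ^ (d - 1))) +
          ∫⁻ r in Ioi 1, B r ^ p * ENNReal.ofReal (r ^ (d - 1))) := by
        rw [lintegral_const_mul' _ _ hc, lintegral_add_left]
        exact (hA.1.pow_const p).mul (by fun_prop)
    _ ≤ 2 ^ (p - 1) * (a * W + b * W) := mul_le_mul_right (add_le_add hA.2 hB.2) _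
    _ = _ := by ring

theorem PowerBound.const_mul {d p : ℝ} {W a : ℝ≥0∞} {A : ℝ → ℝ≥0∞} (hp : 1 < p)
    (hA : PowerBound d p W a A) {c : ℝ≥0∞} (hc : c ≠ ⊤) :
    PowerBound d p W (c ^ p * a) fun r => c * A r := by
  have hp0 : 0 < p := by linarith
  refine ⟨hA.1.const_mul c, ?_⟩
  simp only [ENNReal.mul_rpow_of_nonneg _ _ hp0.le, mul_assoc]
  rw [lintegral_const_mul' _ _ (ENNReal.rpow_ne_top_of_nonneg hp0.le hc)]
  exact mul_le_mul_right hA.2 _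

theorem PowerBound.mono {d p : ℝ} {W W' a : ℝ≥0∞} {A : ℝ → ℝ≥0∞}
    (hA : PowerBound d p W a A) (h : W ≤ W') : PowerBound d p W' a A :=
  ⟨hA.1, hA.2.trans (mul_le_mul_right h _)⟩

/-- `∫ e^(-lε) T_l dl` on the half-line `(1, ∞)`, where `φ` is the derivative on this half-line and
`ψ` the derivative on the reflected one. -/
def transformInt (d ε : ℝ) (φ ψ : ℝ → ℝ) (r : ℝ) : ℝ :=
  (∫ t in Ioi 1, sameInt d ε r t * φ t) + ∫ t in Ioi 1, crossInt d ε r t * ψ t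

theorem ae_ne_restrict (s : Set ℝ) (r : ℝ) : ∀ᵐ t ∂(volume.restrict s), t ≠ r :=
  ae_restrict_of_ae (compl_mem_ae_iff.2 (measure_singleton r))

theorem IsBddCompact.indicator_rpow_mul {φ : ℝ → ℝ} (h : IsBddCompact φ) {α : ℝ} (hα : 0 ≤ α) :
    IsBddCompact ((Ioi 1).indicator fun t => t ^ α * φ t) := by
  obtain ⟨B, hB⟩ := h.bounded
  obtain ⟨M, hM⟩ := h.support
  have hB0 : 0 ≤ B := (abs_nonneg _).trans (hB 0)
  refine ⟨(Measurable.mul (by fun_prop) h.measurable).indicator measurableSet_Ioi,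
    ⟨|M| ^ α * B, fun t => ?_⟩, ⟨M, fun t ht => ?_⟩⟩
  · by_cases ht : t ∈ Ioi (1:ℝ)
    · rw [indicator_of_mem ht]
      have ht0 : 0 < t := lt_trans one_pos ht
      rcases lt_or_ge M |t| with h1 | h1
      · rw [hM t h1]; simp; positivity
      · rw [abs_mul, abs_of_pos (Real.rpow_pos_of_pos ht0 α)]
        refine mul_le_mul (Real.rpow_le_rpow ht0.le ?_ hα) (hB t) (abs_nonneg _) (by positivity)
        exact (le_abs_self t).trans (h1.trans (le_abs_self M))
    · rw [indicator_of_notMem ht]; simp; positivity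
  · by_cases h1 : t ∈ Ioi (1:ℝ)
    · rw [indicator_of_mem h1, hM t ht, mul_zero]
    · rw [indicator_of_notMem h1]

/-- The unweighted theorem for t^α·φ(t) with α = (d-1)/p: the p-th power of r^(-α) cancels the
weight r^(d-1). -/
theorem powerBound_hilbert {d p : ℝ} (hd : 1 < d) (hp : 1 < p) :
    ∃ C : ℝ≥0∞, C ≠ ⊤ ∧ ∀ ε : ℝ, 0 < ε → ∀ φ : ℝ → ℝ, IsBddCompact φ →
      PowerBound d p (∫⁻ t in Ioi 1, ‖φ t‖ₑ ^ p * ENNReal.ofReal (t ^ (d - 1))) C fun r =>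
        ENNReal.ofReal (r ^ (-((d - 1) / p))) * ‖∫ t, hilbertKernel ε (r - t) *
          (Ioi 1).indicator (fun t => t ^ ((d - 1) / p) * φ t) t‖ₑ := by
  have hp0 : 0 < p := by linarith
  have hα : 0 ≤ (d - 1) / p := div_nonneg (by linarith) hp0.le
  obtain ⟨C, hC, h⟩ := hilbert_le hp
  refine ⟨C, hC, fun ε hε φ hφ => ?_⟩
  have hφ' := hφ.indicator_rpow_mul hα
  have hm : Measurable fun r => ∫ t, hilbertKernel ε (r - t) *
          (Ioi 1).indicator (fun t => t ^ ((d - 1) / p) * φ t) t := by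
    have : Measurable fun x : ℝ × ℝ => hilbertKernel ε (x.1 - x.2) *
          (Ioi 1).indicator (fun t => t ^ ((d - 1) / p) * φ t) x.2 :=
      ((measurable_hilbertKernel ε).comp (measurable_fst.sub measurable_snd)).mul
        (hφ'.measurable.comp measurable_snd)
    exact this.stronglyMeasurable.integral_prod_right'.measurable
  refine ⟨Measurable.mul (by fun_prop) hm.enorm, ?_⟩
  have hpow : ∀ r : ℝ, 1 < r → ENNReal.ofReal (r ^ ((d - 1) / p)) ^ p =
      ENNReal.ofReal (r ^ (d - 1)) := by
    intro r hr
    have hr0 : 0 < r := by linarith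
    rw [ENNReal.ofReal_rpow_of_nonneg (by positivity) hp0.le, ← Real.rpow_mul hr0.le,
      div_mul_cancel₀ _ hp0.ne']
  calc _ = ∫⁻ r in Ioi 1, ‖∫ t, hilbertKernel ε (r - t) *
          (Ioi 1).indicator (fun t => t ^ ((d - 1) / p) * φ t) t‖ₑ ^ p := by
        refine setLIntegral_congr_fun measurableSet_Ioi fun r (hr : 1 < r) => ?_
        have hr0 : 0 < r := by linarith
        have e : ENNReal.ofReal (r ^ (-((d - 1) / p))) * ENNReal.ofReal (r ^ ((d - 1) / p)) = 1 := by
          rw [← ENNReal.ofReal_mul (by positivity), ← Real.rpow_add hr0]; simp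
        simp only
        rw [← hpow r hr, ← ENNReal.mul_rpow_of_nonneg _ _ hp0.le, mul_right_comm, e, one_mul]
    _ ≤ ∫⁻ r, ‖∫ t, hilbertKernel ε (r - t) *
          (Ioi 1).indicator (fun t => t ^ ((d - 1) / p) * φ t) t‖ₑ ^ p := setLIntegral_le_lintegral _ _
    _ ≤ _ := h ε hε _ hφ'
    _ = _ := by
        congr 1
        rw [← lintegral_indicator measurableSet_Ioi]
        refine lintegral_congr fun t => ?_
        by_cases ht : t ∈ Ioi (1:ℝ)
        · have ht0 : 0 < t := lt_trans one_pos ht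
          rw [indicator_of_mem ht, indicator_of_mem ht, enorm_mul, ← hpow t ht,
            ENNReal.mul_rpow_of_nonneg _ _ hp0.le, mul_comm,
            Real.enorm_of_nonneg (Real.rpow_nonneg ht0.le ((d - 1) / p))]
        · rw [indicator_of_notMem ht, indicator_of_notMem ht]; simp [hp0]

theorem powerBound_profile {d p : ℝ} (hd : 1 < d) (hp : 1 < p) :
    ∃ C : ℝ≥0∞, C ≠ ⊤ ∧ ∀ φ : ℝ → ℝ, IsBddCompact φ →
      PowerBound d p (∫⁻ t in Ioi 1, ‖φ t‖ₑ ^ p * ENNReal.ofReal (t ^ (d - 1))) C fun r =>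
        ∫⁻ t in Ioi 1, ENNReal.ofReal r⁻¹ *
          ENNReal.ofReal (errorProfile ((d - 1) / p) (t / r)) * ‖φ t‖ₑ := by
  have hp0 : 0 < p := by linarith
  have hM := lintegral_errorProfile_ne_top hd hp
  refine ⟨_, ENNReal.rpow_ne_top_of_nonneg hp0.le hM, fun φ hφ => ⟨?_,
    lintegral_homogeneous_Ioi_one_le hp (d - 1)
      (measurable_errorProfile ((d - 1) / p)).ennreal_ofReal hφ.measurable.enorm⟩⟩
  have : Measurable fun x : ℝ × ℝ => ENNReal.ofReal x.1⁻¹ *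
      ENNReal.ofReal (errorProfile ((d - 1) / p) (x.2 / x.1)) * ‖φ x.2‖ₑ := by
    refine (Measurable.mul measurable_fst.inv.ennreal_ofReal ?_).mul
      (hφ.measurable.comp measurable_snd).enorm
    exact ((measurable_errorProfile ((d - 1) / p)).comp
      (measurable_snd.div measurable_fst)).ennreal_ofReal
  exact this.lintegral_prod_right'

theorem powerBound_stieltjes {d p : ℝ} (hd : 1 < d) (hp : 1 < p) :
    ∃ C : ℝ≥0∞, C ≠ ⊤ ∧ ∀ φ : ℝ → ℝ, IsBddCompact φ →
      PowerBound d p (∫⁻ t in Ioi 1, ‖φ t‖ₑ ^ p * ENNReal.ofReal (t ^ (d - 1))) C fun r =>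
        ∫⁻ t in Ioi 1, ENNReal.ofReal (if r < 2 then ((r - 1) + (t - 1))⁻¹ else 0) * ‖φ t‖ₑ := by
  obtain ⟨C, hC, h⟩ := lintegral_stieltjes_le hd hp
  refine ⟨C, hC, fun φ hφ => ⟨?_, h _ hφ.measurable.enorm⟩⟩
  have : Measurable fun x : ℝ × ℝ =>
      ENNReal.ofReal (if x.1 < 2 then ((x.1 - 1) + (x.2 - 1))⁻¹ else 0) * ‖φ x.2‖ₑ := by
    refine (Measurable.ennreal_ofReal ?_).mul (hφ.measurable.comp measurable_snd).enorm
    exact Measurable.ite (measurableSet_lt measurable_fst measurable_const) (by fun_prop)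
      measurable_const
  exact this.lintegral_prod_right'

theorem powerBound_tail {d p : ℝ} (hd : 1 < d) (hp : 1 < p) (hpd : d < 2 → p ≠ d) :
    ∃ C : ℝ≥0∞, C ≠ ⊤ ∧ ∀ ε : ℝ, 0 < ε → ∀ φ : ℝ → ℝ, IsBddCompact φ → ∫ t in Ioi 1, φ t = 0 →
      PowerBound d p (∫⁻ t in Ioi 1, ‖φ t‖ₑ ^ p * ENNReal.ofReal (t ^ (d - 1))) C fun r =>
        ‖tailInt d ε r‖ₑ * ‖∫ t in Ioc 1 (r / 2), φ t‖ₑ := by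
  obtain ⟨C, hC, h⟩ := tail_le hd hp hpd
  refine ⟨C, hC, fun ε hε φ hφ h0 => ⟨?_, h ε hε φ hφ h0⟩⟩
  refine (measurable_tailInt d ε).enorm.mul (Measurable.enorm ?_)
  have hs : MeasurableSet {x : ℝ × ℝ | x.2 ∈ Ioc 1 (x.1 / 2)} :=
    (measurableSet_lt measurable_const measurable_snd).inter
      (measurableSet_le measurable_snd (by fun_prop))
  have := ((hφ.measurable.comp measurable_snd).indicator hs).stronglyMeasurable.integral_prod_right'
    (ν := (volume : Measure ℝ))
  convert! this.measurable using 1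
  funext z
  rw [← integral_indicator measurableSet_Ioc]
  rfl

theorem integrable_kernel_mul {K φ : ℝ → ℝ} {c : ℝ} (hK : Measurable K) (hφ : IsBddCompact φ)
    (h : ∀ t, 1 < t → |K t| ≤ c) : IntegrableOn (fun t => K t * φ t) (Ioi 1) := by
  refine (hφ.integrable.integrableOn).bdd_mul (c := c) hK.aestronglyMeasurable ?_
  filter_upwards [ae_restrict_mem measurableSet_Ioi] with t ht
  exact h t ht

theorem integrable_sameInt_mul {d : ℝ} (hd : 1 < d) {ε r : ℝ} (hε : 0 < ε) (hr : 1 ≤ r)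
    {φ : ℝ → ℝ} (hφ : IsBddCompact φ) :
    IntegrableOn (fun t => sameInt d ε r t * φ t) (Ioi 1) :=
  integrable_kernel_mul (K := fun t => sameInt d ε r t)
    ((measurable_sameInt d ε).comp (measurable_const.prodMk measurable_id)) hφ
    fun _ ht => abs_sameInt_le_inv hd hε hr ht.le

theorem integrable_crossInt_mul {d : ℝ} (hd : 1 < d) {ε r : ℝ} (hε : 0 < ε) (hr : 1 ≤ r)
    {φ : ℝ → ℝ} (hφ : IsBddCompact φ) :
    IntegrableOn (fun t => crossInt d ε r t * φ t) (Ioi 1) :=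
  integrable_kernel_mul (K := fun t => crossInt d ε r t)
    ((measurable_crossInt d ε).comp (measurable_const.prodMk measurable_id)) hφ
    fun _ ht => abs_crossInt_le_inv hd hε hr ht.le

theorem integral_ite_tail {φ : ℝ → ℝ} (c r : ℝ) :
    ∫ t in Ioi 1, (if t ≤ r / 2 then c else 0) * φ t = c * ∫ t in Ioc 1 (r / 2), φ t := by
  rw [← Ioi_inter_Iic, inter_comm, ← Measure.restrict_restrict measurableSet_Iic,
    ← integral_indicator measurableSet_Iic, ← integral_const_mul]
  refine integral_congr_ae (Eventually.of_forall fun t => ?_)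
  by_cases ht : t ≤ r / 2
  · simp [ht]
  · simp [ht]

theorem integrable_ite_tail {φ : ℝ → ℝ} (hφ : IsBddCompact φ) (c r : ℝ) :
    IntegrableOn (fun t => (if t ≤ r / 2 then c else 0) * φ t) (Ioi 1) := by
  refine integrable_kernel_mul (c := |c|)
    (Measurable.ite measurableSet_Iic measurable_const measurable_const) hφ fun t _ => ?_
  split_ifs <;> simp

theorem enorm_setIntegral_le {K φ : ℝ → ℝ} {B : ℝ → ℝ} {r : ℝ}
    (h : ∀ t, 1 < t → t ≠ r → |K t| ≤ B t) :
    ‖∫ t in Ioi 1, K t * φ t‖ₑ ≤ ∫⁻ t in Ioi 1, ENNReal.ofReal (B t) * ‖φ t‖ₑ := by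
  refine (enorm_integral_le_lintegral_enorm _).trans (lintegral_mono_ae ?_)
  filter_upwards [ae_restrict_mem measurableSet_Ioi, ae_ne_restrict _ r] with t ht hne
  rw [enorm_mul, Real.enorm_eq_ofReal_abs]
  exact mul_le_mul_left (ENNReal.ofReal_le_ofReal (h t ht hne)) _

/-- The transform splits into the conjugated Hilbert transform of φ, homogeneous errors for φ and ψ,
a Stieltjes error for ψ, and one tail for each of φ and ψ. Only the tails use that the integrals of
φ and ψ vanish. The constant collects repeated uses of (a+b)^p ≤ 2^(p-1)(a^p+b^p). -/
theorem halfLine_le {d p : ℝ} (hd : 1 < d) (hp : 1 < p) (hpd : d < 2 → p ≠ d) :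
    ∃ C : ℝ≥0∞, C ≠ ⊤ ∧ ∀ ε : ℝ, 0 < ε → ∀ φ ψ : ℝ → ℝ, IsBddCompact φ → IsBddCompact ψ →
      ∫ t in Ioi 1, φ t = 0 → ∫ t in Ioi 1, ψ t = 0 →
      ∫⁻ r in Ioi 1, ‖transformInt d ε φ ψ r‖ₑ ^ p * ENNReal.ofReal (r ^ (d - 1)) ≤
        C * ((∫⁻ t in Ioi 1, ‖φ t‖ₑ ^ p * ENNReal.ofReal (t ^ (d - 1))) +
          ∫⁻ t in Ioi 1, ‖ψ t‖ₑ ^ p * ENNReal.ofReal (t ^ (d - 1))) := by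
  have hp0 : 0 < p := by linarith
  set α := (d - 1) / p with hαdef
  have hα : 0 ≤ α := div_nonneg (by linarith) hp0.le
  have hαd : α ≤ d := by
    rw [hαdef, div_le_iff₀ hp0]; nlinarith
  obtain ⟨a, ha, hA⟩ := powerBound_hilbert hd hp
  obtain ⟨b, hb, hB⟩ := powerBound_profile hd hp
  obtain ⟨x, hx, hX⟩ := powerBound_stieltjes hd hp
  obtain ⟨c, hc, hT⟩ := powerBound_tail hd hp hpd
  obtain ⟨C₁, hC₁, hE₁⟩ := sameInt_error_le hd hα hαd
  obtain ⟨C₂, hC₂, hE₂⟩ := crossInt_error_le hd hα hαd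
  have h2 : (2:ℝ≥0∞) ^ (p - 1) ≠ ⊤ :=
    ENNReal.rpow_ne_top_of_nonneg (by linarith) (by finiteness)
  have hK₁ : ENNReal.ofReal C₁ ^ p ≠ ⊤ :=
    ENNReal.rpow_ne_top_of_nonneg hp0.le ENNReal.ofReal_ne_top
  have hK₂ : ENNReal.ofReal C₂ ^ p ≠ ⊤ :=
    ENNReal.rpow_ne_top_of_nonneg hp0.le ENNReal.ofReal_ne_top
  refine ⟨2 ^ (p - 1) * (2 ^ (p - 1) * (a + ENNReal.ofReal C₁ ^ p * b) +
    2 ^ (p - 1) * (2 ^ (p - 1) * (ENNReal.ofReal C₂ ^ p * b + ENNReal.ofReal C₂ ^ p * x) +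
      2 ^ (p - 1) * (c + c))), ?_, fun ε hε φ ψ hφ hψ hφ0 hψ0 => ?_⟩
  · finiteness
  set Wφ := ∫⁻ t in Ioi 1, ‖φ t‖ₑ ^ p * ENNReal.ofReal (t ^ (d - 1))
  set Wψ := ∫⁻ t in Ioi 1, ‖ψ t‖ₑ ^ p * ENNReal.ofReal (t ^ (d - 1))
  have l1 : Wφ ≤ Wφ + Wψ := le_self_add
  have l2 : Wψ ≤ Wφ + Wψ := le_add_self
  have bound := PowerBound.add hp
    (((hA ε hε φ hφ).mono l1).add hp (((hB φ hφ).mono l1).const_mul hp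
      (ENNReal.ofReal_ne_top (r := C₁))))
    (((((hB ψ hψ).mono l2).const_mul hp (ENNReal.ofReal_ne_top (r := C₂))).add hp
      (((hX ψ hψ).mono l2).const_mul hp (ENNReal.ofReal_ne_top (r := C₂)))).add hp
      (((hT ε hε φ hφ hφ0).mono l1).add hp ((hT ε hε ψ hψ hψ0).mono l2)))
  refine le_trans (setLIntegral_mono' measurableSet_Ioi fun r (hr : 1 < r) => ?_) bound.2
  refine mul_le_mul_left (ENNReal.rpow_le_rpow ?_ hp0.le) _
  have hr0 : 0 < r := by linarith
  have i1 := integrable_sameInt_mul hd hε hr.le hφ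
  have i2 := integrable_crossInt_mul hd hε hr.le hψ
  have i3 := integrable_ite_tail hφ (tailInt d ε r) r
  have i4 := integrable_ite_tail hψ (tailInt d ε r) r
  have i5 : IntegrableOn (fun t => hilbertKernel ε (r - t) * (t ^ α * φ t)) (Ioi 1) := by
    refine (integrable_hilbertKernel_mul hε (hφ.indicator_rpow_mul hα).integrable r).integrableOn
      |>.congr_fun (fun t ht => ?_) measurableSet_Ioi
    simp only [indicator_of_mem ht]
  have e5 : ∫ t in Ioi 1, hilbertKernel ε (r - t) * (t ^ α * φ t) =
      ∫ t, hilbertKernel ε (r - t) * (Ioi 1).indicator (fun t => t ^ α * φ t) t := by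
    rw [← integral_indicator measurableSet_Ioi]
    refine integral_congr_ae (Eventually.of_forall fun t => ?_)
    by_cases ht : t ∈ Ioi (1:ℝ)
    · simp only [indicator_of_mem ht]
    · simp only [indicator_of_notMem ht, mul_zero]
  have e1 : ∫ t in Ioi 1, sameInt d ε r t * φ t =
      (∫ t in Ioi 1, (sameInt d ε r t - 1 / 2 * ((t / r) ^ α * hilbertKernel ε (r - t)) -
        (if t ≤ r / 2 then tailInt d ε r else 0)) * φ t) +
      (1 / 2 * r ^ (-α)) * (∫ t, hilbertKernel ε (r - t) *
        (Ioi 1).indicator (fun t => t ^ α * φ t) t) +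
      tailInt d ε r * ∫ t in Ioc 1 (r / 2), φ t := by
    rw [← e5, ← integral_ite_tail, ← integral_const_mul]
    have : ∫ t in Ioi 1, (sameInt d ε r t - 1 / 2 * ((t / r) ^ α * hilbertKernel ε (r - t)) -
        (if t ≤ r / 2 then tailInt d ε r else 0)) * φ t =
        ∫ t in Ioi 1, (sameInt d ε r t * φ t -
          (1 / 2 * r ^ (-α)) * (hilbertKernel ε (r - t) * (t ^ α * φ t)) -
          (if t ≤ r / 2 then tailInt d ε r else 0) * φ t) := by
      refine setIntegral_congr_fun measurableSet_Ioi fun t (ht : 1 < t) => ?_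
      rw [Real.div_rpow (by linarith) hr0.le, Real.rpow_neg hr0.le]
      ring
    have i6 : IntegrableOn (fun t => sameInt d ε r t * φ t -
        (1 / 2 * r ^ (-α)) * (hilbertKernel ε (r - t) * (t ^ α * φ t))) (Ioi 1) :=
      i1.sub (i5.const_mul _)
    rw [this, integral_sub i6 i3, integral_sub i1 (i5.const_mul _)]
    ring
  have e2 : ∫ t in Ioi 1, crossInt d ε r t * ψ t =
      (∫ t in Ioi 1, (crossInt d ε r t + (if t ≤ r / 2 then tailInt d ε r else 0)) * ψ t) -
      tailInt d ε r * ∫ t in Ioc 1 (r / 2), ψ t := by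
    rw [← integral_ite_tail, ← integral_sub _ i4]
    · refine setIntegral_congr_fun measurableSet_Ioi fun t (ht : 1 < t) => ?_
      ring
    · refine (i2.add i4).congr_fun (fun t _ => ?_) measurableSet_Ioi
      simp only [Pi.add_apply]; ring
  have n1 := enorm_setIntegral_le (φ := φ) (r := r) fun t ht hne => hE₁ ε r t hε hr ht hne
  have n2 := enorm_setIntegral_le (φ := ψ) (r := r) fun t ht hne => hE₂ ε r t hε hr ht hne
  have m1 : ∫⁻ t in Ioi 1, ENNReal.ofReal (C₁ * (r⁻¹ * errorProfile α (t / r))) * ‖φ t‖ₑ =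
      ENNReal.ofReal C₁ * ∫⁻ t in Ioi 1, ENNReal.ofReal r⁻¹ *
        ENNReal.ofReal (errorProfile α (t / r)) * ‖φ t‖ₑ := by
    rw [← lintegral_const_mul' _ _ ENNReal.ofReal_ne_top]
    refine lintegral_congr fun t => ?_
    rw [ENNReal.ofReal_mul hC₁, ENNReal.ofReal_mul (by positivity), mul_assoc]
  have m2 : ∫⁻ t in Ioi 1, ENNReal.ofReal (C₂ * (r⁻¹ * errorProfile α (t / r) +
        (if r < 2 then ((r - 1) + (t - 1))⁻¹ else 0))) * ‖ψ t‖ₑ ≤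
      ENNReal.ofReal C₂ * (∫⁻ t in Ioi 1, ENNReal.ofReal r⁻¹ *
        ENNReal.ofReal (errorProfile α (t / r)) * ‖ψ t‖ₑ) +
      ENNReal.ofReal C₂ * ∫⁻ t in Ioi 1,
        ENNReal.ofReal (if r < 2 then ((r - 1) + (t - 1))⁻¹ else 0) * ‖ψ t‖ₑ := by
    rw [← mul_add, ← lintegral_add_left, ← lintegral_const_mul' _ _ ENNReal.ofReal_ne_top]
    · refine lintegral_mono fun t => ?_
      rw [ENNReal.ofReal_mul hC₂, ← add_mul, mul_assoc]
      refine mul_le_mul_right (mul_le_mul_left ?_ _) _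
      rw [← ENNReal.ofReal_mul (by positivity)]
      exact ENNReal.ofReal_add_le
    · refine Measurable.mul (Measurable.mul measurable_const ?_) hψ.measurable.enorm
      exact ((measurable_errorProfile α).comp (measurable_id.div_const r)).ennreal_ofReal
  rw [m1] at n1
  have n2' := n2.trans m2
  rw [transformInt, e1, e2]
  have n3 : ‖(1 / 2 * r ^ (-α)) * (∫ t, hilbertKernel ε (r - t) *
      (Ioi 1).indicator (fun t => t ^ α * φ t) t)‖ₑ ≤ ENNReal.ofReal (r ^ (-α)) *
        ‖∫ t, hilbertKernel ε (r - t) * (Ioi 1).indicator (fun t => t ^ α * φ t) t‖ₑ := by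
    rw [enorm_mul, Real.enorm_of_nonneg (by positivity)]
    refine mul_le_mul_left (ENNReal.ofReal_le_ofReal ?_) _
    have : 0 ≤ r ^ (-α) := by positivity
    linarith
  set P := ∫ t in Ioi 1, (sameInt d ε r t - 1 / 2 * ((t / r) ^ α * hilbertKernel ε (r - t)) -
        (if t ≤ r / 2 then tailInt d ε r else 0)) * φ t
  set Q := (1 / 2 * r ^ (-α)) * (∫ t, hilbertKernel ε (r - t) *
      (Ioi 1).indicator (fun t => t ^ α * φ t) t)
  set R := ∫ t in Ioi 1, (crossInt d ε r t + (if t ≤ r / 2 then tailInt d ε r else 0)) * ψ t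
  set U := tailInt d ε r * ∫ t in Ioc 1 (r / 2), φ t with hU
  set V := tailInt d ε r * ∫ t in Ioc 1 (r / 2), ψ t with hV
  calc ‖P + Q + U + (R - V)‖ₑ ≤ (‖Q‖ₑ + ‖P‖ₑ) + (‖R‖ₑ + (‖U‖ₑ + ‖V‖ₑ)) := by
        have : P + Q + U + (R - V) = (Q + P) + (R + (U + -V)) := by ring
        rw [this]
        refine (enorm_add_le _ _).trans (add_le_add (enorm_add_le _ _) ?_)
        refine (enorm_add_le _ _).trans (add_le_add le_rfl ?_)
        refine (enorm_add_le _ _).trans ?_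
        rw [enorm_neg]
    _ ≤ _ := by
        refine add_le_add (add_le_add n3 n1) (add_le_add n2' ?_)
        rw [hU, hV, enorm_mul, enorm_mul]

/-! ### The broken line as two half-lines -/

/-- The measure `r^(d-1) dr` on the half-line `(1, ∞)`. -/
def half (d : ℝ) : Measure ℝ :=
  (volume.restrict (Ioi 1)).withDensity fun r => ENNReal.ofReal (r ^ (d - 1))

theorem ae_half_mem (d : ℝ) : ∀ᵐ r ∂(half d), r ∈ Ioi (1:ℝ) :=
  (withDensity_absolutelyContinuous _ _).ae_le (ae_restrict_mem measurableSet_Ioi)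

instance (d : ℝ) : SigmaFinite (mu d) := by
  unfold mu; exact SigmaFinite.withDensity_ofReal _

theorem lintegral_half (d : ℝ) (g : ℝ → ℝ≥0∞) :
    ∫⁻ r, g r ∂(half d) = ∫⁻ r in Ioi 1, g r * ENNReal.ofReal (r ^ (d - 1)) := by
  rw [half, lintegral_withDensity_eq_lintegral_mul_non_measurable _ (by fun_prop) (by simp)]
  simp only [Pi.mul_apply, mul_comm]

theorem lintegral_mu (d : ℝ) (g : ℝ → ℝ≥0∞) :
    ∫⁻ r, g r ∂(mu d) = ∫⁻ r, g r ∂(half d) + ∫⁻ r, g (-r) ∂(half d) := by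
  have hline : (line : Set ℝ) =ᵐ[volume] (Iio (-1) ∪ Ioi 1 : Set ℝ) :=
    Iio_ae_eq_Iic.symm.union Ioi_ae_eq_Ici.symm
  rw [mu, lintegral_withDensity_eq_lintegral_mul_non_measurable _ (by fun_prop) (by simp),
    lintegral_half, lintegral_half, setLIntegral_congr hline,
    lintegral_union measurableSet_Ioi, add_comm]
  · congr 1
    · refine setLIntegral_congr_fun measurableSet_Ioi fun r (hr : 1 < r) => ?_
      simp only [Pi.mul_apply]
      rw [abs_of_pos (by linarith), mul_comm]
    · have h : MeasurePreserving (MeasurableEquiv.neg ℝ) volume volume :=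
        Measure.measurePreserving_neg _
      have := h.setLIntegral_comp_preimage_emb (MeasurableEquiv.neg ℝ).measurableEmbedding
        ((fun r : ℝ => ENNReal.ofReal (|r| ^ (d - 1))) * g) (Iio (-1))
      rw [← this]
      have e : (MeasurableEquiv.neg ℝ) ⁻¹' Iio (-1) = Ioi 1 := by
        ext r; simp
      rw [e]
      refine setLIntegral_congr_fun measurableSet_Ioi fun r (hr : 1 < r) => ?_
      change ENNReal.ofReal (|-r| ^ (d - 1)) * g (-r) = _
      rw [abs_neg, abs_of_pos (by linarith), mul_comm]
  · rw [Set.disjoint_iff]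
    rintro r ⟨h1, h2⟩
    simp only [mem_Iio, mem_Ioi] at h1 h2
    linarith

theorem mu_eq (d : ℝ) : mu d = half d + (half d).map Neg.neg := by
  ext s hs
  rw [← lintegral_indicator_one hs, ← lintegral_indicator_one hs, lintegral_mu,
    lintegral_add_measure, lintegral_map (measurable_one.indicator hs) measurable_neg]

theorem ae_mu_iff {d : ℝ} {P : ℝ → Prop} :
    (∀ᵐ r ∂(mu d), P r) ↔ (∀ᵐ r ∂(half d), P r) ∧ ∀ᵐ r ∂(half d), P (-r) := by
  rw [mu_eq, ae_add_measure_iff]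
  refine and_congr_right fun _ => ?_
  exact (MeasurableEquiv.neg ℝ).measurableEmbedding.ae_map_iff

theorem integral_mu {d : ℝ} {g : ℝ → ℝ} (hg : Integrable g (mu d)) :
    ∫ r, g r ∂(mu d) = ∫ r, g r ∂(half d) + ∫ r, g (-r) ∂(half d) := by
  have h := hg
  rw [mu_eq, integrable_add_measure] at h
  rw [mu_eq, integral_add_measure h.1 h.2]
  congr 1
  exact (MeasurableEquiv.neg ℝ).measurableEmbedding.integral_map _

theorem memLp_mu_iff {d : ℝ} {g : ℝ → ℝ} :
    MemLp g 2 (mu d) ↔ MemLp g 2 (half d) ∧ MemLp (fun r => g (-r)) 2 (half d) := by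
  have e : MemLp g 2 ((half d).map Neg.neg) ↔ MemLp (fun r => g (-r)) 2 (half d) :=
    (MeasurableEquiv.neg ℝ).measurableEmbedding.memLp_map_measure_iff
  rw [← e]
  constructor
  · intro h
    rw [mu_eq] at h
    exact ⟨h.mono_measure (Measure.le_add_right le_rfl),
      h.mono_measure (Measure.le_add_left le_rfl)⟩
  · rintro ⟨h1, h2⟩
    have m : AEStronglyMeasurable g (mu d) := by
      rw [mu_eq, aestronglyMeasurable_add_measure_iff]
      exact ⟨h1.1, h2.1⟩
    rw [memLp_two_iff_integrable_sq m, mu_eq, integrable_add_measure]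
    exact ⟨(memLp_two_iff_integrable_sq h1.1).1 h1, (memLp_two_iff_integrable_sq h2.1).1 h2⟩

theorem integral_half (d : ℝ) (g : ℝ → ℝ) :
    ∫ r, g r ∂(half d) = ∫ r in Ioi 1, r ^ (d - 1) * g r := by
  rw [half, integral_withDensity_eq_integral_toReal_smul (by fun_prop) (by simp)]
  refine setIntegral_congr_fun measurableSet_Ioi fun r (hr : 1 < r) => ?_
  have : 0 ≤ r ^ (d - 1) := by positivity
  simp [ENNReal.toReal_ofReal this]

theorem integrable_half_iff {d : ℝ} {g : ℝ → ℝ} :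
    Integrable g (half d) ↔ IntegrableOn (fun r => r ^ (d - 1) * g r) (Ioi 1) := by
  rw [half, integrable_withDensity_iff_integrable_smul' (by fun_prop) (by simp)]
  refine integrableOn_congr_fun (fun r (hr : 1 < r) => ?_) measurableSet_Ioi
  have : 0 ≤ r ^ (d - 1) := by positivity
  simp [ENNReal.toReal_ofReal this]

theorem memLp_exp_half (d : ℝ) {l : ℝ} (hl : 0 < l) :
    MemLp (fun r => Real.exp (-(l * r))) 2 (half d) := by
  rw [memLp_two_iff_integrable_sq (by fun_prop), integrable_half_iff]
  have h1 : ∀ᶠ r : ℝ in atTop, r ^ (d - 1) * Real.exp (-(l * r)) ≤ 1 := by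
    have := tendsto_rpow_mul_exp_neg_mul_atTop_nhds_zero (d - 1) l hl
    filter_upwards [this.eventually (gt_mem_nhds one_pos)] with r hr
    rw [← neg_mul]; exact hr.le
  obtain ⟨R, hR⟩ := eventually_atTop.1 h1
  have hc : ContinuousOn (fun r : ℝ => r ^ (d - 1) * Real.exp (-(l * r)) ^ 2) (Ici 1) := by
    refine ContinuousOn.mul (ContinuousOn.rpow_const continuousOn_id fun r hr => Or.inl ?_)
      (by fun_prop)
    have : (1:ℝ) ≤ r := hr
    linarith
  have hsub : Ioi (1:ℝ) ⊆ Icc 1 (max R 1) ∪ Ioi (max R 1) := by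
    intro r hr
    rcases le_or_gt r (max R 1) with h | h
    · exact Or.inl ⟨le_of_lt hr, h⟩
    · exact Or.inr h
  refine IntegrableOn.mono_set (IntegrableOn.union ?_ ?_) hsub
  · exact (hc.mono Icc_subset_Ici_self).integrableOn_compact isCompact_Icc
  · have hm : IntegrableOn (fun r : ℝ => Real.exp (-l * r)) (Ioi (max R 1)) :=
      exp_neg_integrableOn_Ioi _ hl
    refine Integrable.mono' hm
      ((Measurable.mul (by fun_prop) (by fun_prop)).aestronglyMeasurable) ?_
    filter_upwards [ae_restrict_mem measurableSet_Ioi] with r hr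
    have hr1 : 0 < r := lt_of_lt_of_le one_pos ((le_max_right R 1).trans (le_of_lt hr))
    rw [Real.norm_of_nonneg (by positivity), sq, ← mul_assoc, neg_mul]
    exact mul_le_of_le_one_left (Real.exp_pos _).le (hR r ((le_max_left R 1).trans (le_of_lt hr)))

theorem memLp_half_of_decay (d : ℝ) {l M C : ℝ} (hl : 0 < l) {h : ℝ → ℝ}
    (hc : ContinuousOn h (Ici 1)) (hb : ∀ r, 1 ≤ r → M ≤ r → |h r| ≤ C * Real.exp (-(l * r))) :
    MemLp h 2 (half d) := by
  have hg : ContinuousOn (fun r => h r * Real.exp (l * r)) (Icc 1 M) :=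
    (hc.mono Icc_subset_Ici_self).mul (by fun_prop)
  obtain ⟨B, hB⟩ := isCompact_Icc.exists_bound_of_continuousOn hg
  refine (((memLp_exp_half d hl).const_mul (max B C)).mono'
    ((hc.mono Ioi_subset_Ici_self).aestronglyMeasurable measurableSet_Ioi |>.mono_ac
      (withDensity_absolutelyContinuous _ _))) ?_
  filter_upwards [ae_half_mem d] with r hr
  have hr1 : 1 ≤ r := le_of_lt hr
  rcases le_total M r with h1 | h1
  · refine (hb r hr1 h1).trans ?_
    gcongr
    exact le_max_right _ _
  · have h2 := hB r ⟨hr1, h1⟩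
    rw [norm_mul, Real.norm_of_nonneg (Real.exp_pos _).le] at h2
    calc ‖h r‖ = ‖h r‖ * Real.exp (l * r) * Real.exp (-(l * r)) := by
          rw [mul_assoc, ← Real.exp_add]; simp
      _ ≤ _ := by
          gcongr
          exact h2.trans (le_max_left _ _)

/-- The function on the broken line given by `p` on the right and by the reflection of `q` on the
left. -/
def join (p q : ℝ → ℝ) (r : ℝ) : ℝ := if 0 < r then p r else q (-r)

theorem join_of_pos (p q : ℝ → ℝ) {r : ℝ} (hr : 0 < r) : join p q r = p r := if_pos hr

theorem join_neg (p q : ℝ → ℝ) {r : ℝ} (hr : 0 < r) : join p q (-r) = q r := by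
  rw [join, if_neg (by linarith), neg_neg]

theorem join_of_neg (p q : ℝ → ℝ) {r : ℝ} (hr : r < 0) : join p q r = q (-r) :=
  if_neg (by linarith)

theorem ne_zero_of_mem_line {r : ℝ} (hr : r ∈ line) : r ≠ 0 := by
  rintro rfl
  rcases hr with h | h
  · simp only [mem_Iic] at h; linarith
  · simp only [mem_Ici] at h; linarith

theorem hasDerivAt_join {p p' q q' : ℝ → ℝ} (hp : ∀ r, 0 < r → HasDerivAt p (p' r) r)
    (hq : ∀ r, 0 < r → HasDerivAt q (q' r) r) {r : ℝ} (hr : r ≠ 0) :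
    HasDerivAt (join p q) (join p' (fun r => -q' r) r) r := by
  rcases hr.lt_or_gt with h | h
  · rw [join_of_neg _ _ h]
    have := (hq (-r) (by linarith)).comp r (hasDerivAt_neg r)
    rw [mul_neg_one] at this
    refine this.congr_of_eventuallyEq ?_
    filter_upwards [Iio_mem_nhds h] with s hs
    exact join_of_neg _ _ hs
  · rw [join_of_pos _ _ h]
    refine (hp r h).congr_of_eventuallyEq ?_
    filter_upwards [Ioi_mem_nhds h] with s hs
    exact join_of_pos _ _ hs

theorem continuousAt_join {p q : ℝ → ℝ} (hp : ContinuousOn p (Ioi 0)) (hq : ContinuousOn q (Ioi 0))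
    {r : ℝ} (hr : r ≠ 0) : ContinuousAt (join p q) r := by
  rcases hr.lt_or_gt with h | h
  · have : ContinuousAt (fun r => q (-r)) r :=
      ContinuousAt.comp (f := fun r : ℝ => -r)
        (hq.continuousAt (Ioi_mem_nhds (by linarith))) continuousAt_neg
    refine this.congr_of_eventuallyEq ?_
    filter_upwards [Iio_mem_nhds h] with s hs
    exact join_of_neg _ _ hs
  · refine (hp.continuousAt (Ioi_mem_nhds h)).congr_of_eventuallyEq ?_
    filter_upwards [Ioi_mem_nhds h] with s hs
    exact join_of_pos _ _ hs

theorem grad_join {p p' q q' : ℝ → ℝ} (hp : ∀ r, 0 < r → HasDerivAt p (p' r) r)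
    (hq : ∀ r, 0 < r → HasDerivAt q (q' r) r) {r : ℝ} (hr : r ∈ line) :
    grad (join p q) r = join p' (fun r => -q' r) r :=
  (hasDerivAt_join hp hq (ne_zero_of_mem_line hr)).hasDerivWithinAt.derivWithin
    (uniqueDiffOn_line r hr)

theorem isC1_join {p p' q q' : ℝ → ℝ} (hp : ∀ r, 0 < r → HasDerivAt p (p' r) r)
    (hq : ∀ r, 0 < r → HasDerivAt q (q' r) r) (hp' : ContinuousOn p' (Ioi 0))
    (hq' : ContinuousOn q' (Ioi 0)) (h0 : q 1 = p 1) (h1 : -q' 1 = p' 1) :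
    IsC1 (join p q) where
  contDiffOn := by
    rw [contDiffOn_one_iff_derivWithin uniqueDiffOn_line]
    refine ⟨fun r hr => (hasDerivAt_join hp hq
      (ne_zero_of_mem_line hr)).differentiableAt.differentiableWithinAt, ?_⟩
    refine ContinuousOn.congr (f := join p' (fun r => -q' r)) (fun r hr => ?_)
      fun r hr => grad_join hp hq hr
    exact (continuousAt_join hp' hq'.neg (ne_zero_of_mem_line hr)).continuousWithinAt
  glue := by rw [join_neg _ _ one_pos, join_of_pos _ _ one_pos, h0]
  glue_grad := by
    rw [grad_join hp hq neg_one_mem, grad_join hp hq one_mem, join_neg _ _ one_pos,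
      join_of_pos _ _ one_pos, h1]

theorem memLp_join {d : ℝ} {p q : ℝ → ℝ} (hp : MemLp p 2 (half d)) (hq : MemLp q 2 (half d)) :
    MemLp (join p q) 2 (mu d) := by
  rw [memLp_mu_iff]
  refine ⟨hp.ae_eq ?_, hq.ae_eq ?_⟩
  · filter_upwards [ae_half_mem d] with r hr
    rw [join_of_pos _ _ (lt_trans one_pos hr)]
  · filter_upwards [ae_half_mem d] with r hr
    rw [join_neg _ _ (lt_trans one_pos hr)]

theorem intervalIntegrable_of_continuousOn_Ioi {g : ℝ → ℝ} (hg : ContinuousOn g (Ioi 0)) {a b : ℝ}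
    (ha : 0 < a) (hb : 0 < b) : IntervalIntegrable g volume a b := by
  refine (hg.mono fun t ht => ?_).intervalIntegrable
  exact lt_of_lt_of_le (lt_min ha hb) ht.1

theorem hasDerivAt_primitive {g : ℝ → ℝ} (hg : ContinuousOn g (Ioi 0)) {b r : ℝ} (hb : 0 < b)
    (hr : 0 < r) : HasDerivAt (fun r => ∫ t in b..r, g t) (g r) r :=
  intervalIntegral.integral_hasDerivAt_right (intervalIntegrable_of_continuousOn_Ioi hg hb hr)
    (hg.stronglyMeasurableAtFilter isOpen_Ioi r hr) (hg.continuousAt (Ioi_mem_nhds hr))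

theorem hasDerivAt_primitive_left {g : ℝ → ℝ} (hg : ContinuousOn g (Ioi 0)) {b r : ℝ} (hb : 0 < b)
    (hr : 0 < r) : HasDerivAt (fun r => ∫ t in r..b, g t) (-g r) r :=
  intervalIntegral.integral_hasDerivAt_left (intervalIntegrable_of_continuousOn_Ioi hg hr hb)
    (hg.stronglyMeasurableAtFilter isOpen_Ioi r hr) (hg.continuousAt (Ioi_mem_nhds hr))

/-! ### Variation of parameters -/

/-- The value on the right half-line of `Δ (Δ + l²)⁻¹` applied to the function with derivatives
`φ` on the right and `ψ` on the reflected left, both supported in `[1, M]`. -/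
def valueOp (d l M : ℝ) (φ ψ : ℝ → ℝ) (r : ℝ) : ℝ :=
  decaySol d l r * (∫ t in (1:ℝ)..r, t ^ (d - 1) * growSolDeriv d l t * φ t) +
    growSol d l r * (∫ t in r..M, t ^ (d - 1) * decaySolDeriv d l t * φ t) +
    decaySol d l r * (gluing d l * ∫ t in (1:ℝ)..M, t ^ (d - 1) * decaySolDeriv d l t * ψ t)

/-- The difference of the derivative of `valueOp` and `φ`. -/
def derivOp (d l M : ℝ) (φ ψ : ℝ → ℝ) (r : ℝ) : ℝ :=
  decaySolDeriv d l r * (∫ t in (1:ℝ)..r, t ^ (d - 1) * growSolDeriv d l t * φ t) +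
    growSolDeriv d l r * (∫ t in r..M, t ^ (d - 1) * decaySolDeriv d l t * φ t) +
    decaySolDeriv d l r * (gluing d l * ∫ t in (1:ℝ)..M, t ^ (d - 1) * decaySolDeriv d l t * ψ t)

section

variable {d l M : ℝ} {φ ψ : ℝ → ℝ}

theorem continuousOn_weight_decay (hd : 1 < d) (hl : 0 < l) (hφ : Continuous φ) :
    ContinuousOn (fun t => t ^ (d - 1) * decaySolDeriv d l t * φ t) (Ioi 0) := fun r hr =>
  (((solutionPair hd hl).hasDerivAt_k₁ r hr).continuousAt.mul
    hφ.continuousAt).continuousWithinAt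

theorem continuousOn_weight_grow (hd : 1 < d) (hl : 0 < l) (hφ : Continuous φ) :
    ContinuousOn (fun t => t ^ (d - 1) * growSolDeriv d l t * φ t) (Ioi 0) := fun r hr =>
  (((solutionPair hd hl).hasDerivAt_u₁ r hr).continuousAt.mul
    hφ.continuousAt).continuousWithinAt

/-- The moving limits of integration contribute r^(d-1)(k·u₁ - u·k₁)·φ, which is φ by the Wronskian.
-/
theorem hasDerivAt_valueOp (hd : 1 < d) (hl : 0 < l) (hM : 1 ≤ M) (hφ : Continuous φ) {r : ℝ}
    (hr : 0 < r) : HasDerivAt (valueOp d l M φ ψ) (derivOp d l M φ ψ r + φ r) r := by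
  have S := solutionPair hd hl
  have hA := hasDerivAt_primitive (continuousOn_weight_grow hd hl hφ) one_pos hr
  have hB := hasDerivAt_primitive_left (continuousOn_weight_decay hd hl hφ)
    (show 0 < M by linarith) hr
  have hk := S.hasDerivAt_k r hr
  have hu := S.hasDerivAt_u r hr
  refine (((hk.mul hA).add (hu.mul hB)).add (hk.mul_const _)).congr_deriv ?_
  have hw := S.wronskian r hr
  rw [derivOp]
  linear_combination (φ r) * hw

/-- Here the contributions of the moving limits cancel, and both solutions satisfy the equation. -/
theorem hasDerivAt_weight_derivOp (hd : 1 < d) (hl : 0 < l) (hM : 1 ≤ M) (hφ : Continuous φ)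
    {r : ℝ} (hr : 0 < r) : HasDerivAt (fun r => r ^ (d - 1) * derivOp d l M φ ψ r)
      (l ^ 2 * (r ^ (d - 1) * valueOp d l M φ ψ r)) r := by
  have S := solutionPair hd hl
  have hA := hasDerivAt_primitive (continuousOn_weight_grow hd hl hφ) one_pos hr
  have hB := hasDerivAt_primitive_left (continuousOn_weight_decay hd hl hφ)
    (show 0 < M by linarith) hr
  have hk := S.hasDerivAt_k₁ r hr
  have hu := S.hasDerivAt_u₁ r hr
  have e : (fun r => r ^ (d - 1) * derivOp d l M φ ψ r) = fun r =>
      (r ^ (d - 1) * decaySolDeriv d l r) *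
        (∫ t in (1:ℝ)..r, t ^ (d - 1) * growSolDeriv d l t * φ t) +
      (r ^ (d - 1) * growSolDeriv d l r) *
        (∫ t in r..M, t ^ (d - 1) * decaySolDeriv d l t * φ t) +
      (r ^ (d - 1) * decaySolDeriv d l r) *
        (gluing d l * ∫ t in (1:ℝ)..M, t ^ (d - 1) * decaySolDeriv d l t * ψ t) := by
    funext r; rw [derivOp]; ring
  rw [e]
  refine (((hk.mul hA).add (hu.mul hB)).add (hk.mul_const _)).congr_deriv ?_
  rw [valueOp]
  ring

theorem continuousOn_valueOp (hd : 1 < d) (hl : 0 < l) (hM : 1 ≤ M) (hφ : Continuous φ) :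
    ContinuousOn (valueOp d l M φ ψ) (Ioi 0) := fun _ hr =>
  (hasDerivAt_valueOp hd hl hM hφ hr).continuousAt.continuousWithinAt

theorem continuousOn_derivOp (hd : 1 < d) (hl : 0 < l) (hM : 1 ≤ M) (hφ : Continuous φ) :
    ContinuousOn (derivOp d l M φ ψ) (Ioi 0) := by
  have h1 : ContinuousOn (fun r => r ^ (d - 1) * derivOp d l M φ ψ r) (Ioi 0) := fun r hr =>
    (hasDerivAt_weight_derivOp hd hl hM hφ hr).continuousAt.continuousWithinAt
  have h2 : ContinuousOn (fun r : ℝ => (r ^ (d - 1))⁻¹) (Ioi 0) := by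
    refine ContinuousOn.inv₀ (ContinuousOn.rpow_const continuousOn_id fun r hr =>
      Or.inl (ne_of_gt hr)) fun r hr => (Real.rpow_pos_of_pos hr _).ne'
  refine (h2.mul h1).congr fun r hr => ?_
  have := (Real.rpow_pos_of_pos hr (d - 1)).ne'
  simp only [Pi.mul_apply]
  field_simp

/-- At the gluing point u = a·k, so φ and ψ enter symmetrically. With the antisymmetry in
`derivOp_one` this makes the two halves fit together to a C¹ function. -/
theorem valueOp_one (hd : 1 < d) (hl : 0 < l) : valueOp d l M φ ψ 1 = valueOp d l M ψ φ 1 := by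
  have S := solutionPair hd hl
  simp only [valueOp, intervalIntegral.integral_same, S.glue]
  ring

theorem derivOp_one (hd : 1 < d) (hl : 0 < l) : derivOp d l M φ ψ 1 = -derivOp d l M ψ φ 1 := by
  have S := solutionPair hd hl
  simp only [derivOp, intervalIntegral.integral_same, S.glue_deriv]
  ring

theorem integral_eq_of_support {g : ℝ → ℝ} (hg : ∀ t, M ≤ t → φ t = 0) {a r : ℝ} (hr : M ≤ r)
    (hi : IntervalIntegrable (fun t => g t * φ t) volume a M)
    (hi' : IntervalIntegrable (fun t => g t * φ t) volume M r) :
    ∫ t in a..r, g t * φ t = ∫ t in a..M, g t * φ t := by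
  have h : ∫ t in M..r, g t * φ t = 0 := by
    rw [intervalIntegral.integral_congr (g := fun _ => 0) fun t ht => ?_]
    · simp
    · rw [uIcc_of_le hr] at ht
      simp [hg t ht.1]
  rw [← intervalIntegral.integral_add_adjacent_intervals hi hi', h, add_zero]

/-- The coefficient of the decaying solution beyond the support. -/
def tailCoeff (d l M : ℝ) (φ ψ : ℝ → ℝ) : ℝ :=
  (∫ t in (1:ℝ)..M, t ^ (d - 1) * growSolDeriv d l t * φ t) +
    gluing d l * ∫ t in (1:ℝ)..M, t ^ (d - 1) * decaySolDeriv d l t * ψ t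

theorem ops_of_ge (hd : 1 < d) (hl : 0 < l) (hM : 1 ≤ M) (hφ : Continuous φ)
    (h0 : ∀ t, M ≤ t → φ t = 0) {r : ℝ} (hr : M ≤ r) :
    valueOp d l M φ ψ r = decaySol d l r * tailCoeff d l M φ ψ ∧
      derivOp d l M φ ψ r = decaySolDeriv d l r * tailCoeff d l M φ ψ := by
  have hM0 : 0 < M := by linarith
  have hr0 : 0 < r := by linarith
  have h1 : ∫ t in (1:ℝ)..r, t ^ (d - 1) * growSolDeriv d l t * φ t =
      ∫ t in (1:ℝ)..M, t ^ (d - 1) * growSolDeriv d l t * φ t :=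
    integral_eq_of_support h0 hr
      (intervalIntegrable_of_continuousOn_Ioi (continuousOn_weight_grow hd hl hφ) one_pos hM0)
      (intervalIntegrable_of_continuousOn_Ioi (continuousOn_weight_grow hd hl hφ) hM0 hr0)
  have h2 : ∫ t in r..M, t ^ (d - 1) * decaySolDeriv d l t * φ t = 0 := by
    rw [intervalIntegral.integral_congr (g := fun _ => 0) fun t ht => ?_]
    · simp
    · rw [uIcc_of_ge hr] at ht
      simp [h0 t ht.1]
  constructor
  · rw [valueOp, h1, h2, tailCoeff]; ring
  · rw [derivOp, h1, h2, tailCoeff]; ring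

/-- Beyond the support of φ both functions are multiples of k and k₁, which decay exponentially. -/
theorem memLp_ops (hd : 1 < d) (hl : 0 < l) (hM : 1 ≤ M) (hφ : Continuous φ)
    (h0 : ∀ t, M ≤ t → φ t = 0) :
    MemLp (valueOp d l M φ ψ) 2 (half d) ∧ MemLp (derivOp d l M φ ψ) 2 (half d) := by
  have S := solutionPair hd hl
  have hsub : Ici (1:ℝ) ⊆ Ioi 0 := fun r (hr : 1 ≤ r) => lt_of_lt_of_le (one_pos (α := ℝ)) hr
  have hk : ∀ r, 1 ≤ r → decaySol d l r ≤ decaySol d l 1 * Real.exp l * Real.exp (-(l * r)) := by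
    intro r hr
    refine (S.k_le_exp one_pos hr).trans (le_of_eq ?_)
    rw [mul_assoc, ← Real.exp_add]; congr 2; ring
  set c := tailCoeff d l M φ ψ
  constructor
  · refine memLp_half_of_decay d (M := M) (C := |c| * (decaySol d l 1 * Real.exp l)) hl
      ((continuousOn_valueOp hd hl hM hφ).mono hsub) fun r hr hMr => ?_
    rw [(ops_of_ge hd hl hM hφ h0 hMr).1, abs_mul, abs_of_pos (S.pos r (by linarith)), mul_comm,
      mul_assoc]
    exact mul_le_mul_of_nonneg_left (hk r hr) (abs_nonneg _)
  · refine memLp_half_of_decay d (M := M)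
      (C := |c| * ((l + (d + 1)) * (decaySol d l 1 * Real.exp l))) hl
      ((continuousOn_derivOp hd hl hM hφ).mono hsub) fun r hr hMr => ?_
    rw [(ops_of_ge hd hl hM hφ h0 hMr).2, abs_mul, abs_of_neg (S.k₁_neg hl (by linarith)),
      mul_comm, mul_assoc]
    refine mul_le_mul_of_nonneg_left ((S.k₁_ge hd hl hr).trans ?_) (abs_nonneg _)
    have h1 : (d + 1) / r ≤ d + 1 := div_le_self (by linarith) hr
    have h2 := S.pos r (by linarith)
    calc (l + (d + 1) / r) * decaySol d l r ≤ (l + (d + 1)) * decaySol d l r := by gcongr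
      _ ≤ (l + (d + 1)) * (decaySol d l 1 * Real.exp l * Real.exp (-(l * r))) := by
          gcongr; exact hk r hr
      _ = _ := by ring

/-- The product r^(d-1)·`derivOp`·g is a primitive of the weighted integrand. It tends to 0 at
infinity because it and its derivative are integrable, so only the boundary term at 1 survives. -/
theorem integral_derivOp_mul (hd : 1 < d) (hl : 0 < l) (hM : 1 ≤ M) (hφ : Continuous φ)
    (h0 : ∀ t, M ≤ t → φ t = 0) {g g' : ℝ → ℝ} (hg : ∀ r, 1 < r → HasDerivAt g (g' r) r)
    (hg1 : ContinuousWithinAt g (Ici 1) 1) (hgL : MemLp g 2 (half d))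
    (hgL' : MemLp g' 2 (half d)) :
    ∫ r, derivOp d l M φ ψ r * g' r ∂(half d) + l ^ 2 * ∫ r, valueOp d l M φ ψ r * g r ∂(half d) =
      -(derivOp d l M φ ψ 1 * g 1) := by
  obtain ⟨hT, hS⟩ := memLp_ops (ψ := ψ) hd hl hM hφ h0
  have i1 : Integrable (fun r => derivOp d l M φ ψ r * g' r) (half d) := hS.integrable_mul hgL'
  have i2 : Integrable (fun r => valueOp d l M φ ψ r * g r) (half d) := hT.integrable_mul hgL
  have i3 := hS.integrable_mul hgL
  rw [← integral_const_mul, ← integral_add i1 (i2.const_mul _), integral_half]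
  have i4 := i1.add (i2.const_mul (l ^ 2))
  rw [integrable_half_iff] at i3 i4
  have hd1 : ∀ r ∈ Ioi (1:ℝ), HasDerivAt (fun r => r ^ (d - 1) * derivOp d l M φ ψ r * g r)
      (r ^ (d - 1) * (derivOp d l M φ ψ r * g' r + l ^ 2 * (valueOp d l M φ ψ r * g r))) r := by
    intro r hr
    refine ((hasDerivAt_weight_derivOp hd hl hM hφ (lt_trans one_pos hr)).mul
      (hg r hr)).congr_deriv ?_
    ring
  have i3' : IntegrableOn (fun r => r ^ (d - 1) * derivOp d l M φ ψ r * g r) (Ioi 1) := by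
    refine i3.congr_fun (fun r _ => ?_) measurableSet_Ioi
    simp only [Pi.mul_apply]; ring
  have lim := tendsto_zero_of_hasDerivAt_of_integrableOn_Ioi hd1 i4 i3'
  have hc : ContinuousWithinAt (fun r => r ^ (d - 1) * derivOp d l M φ ψ r * g r) (Ici 1) 1 :=
    (hasDerivAt_weight_derivOp hd hl hM hφ one_pos).continuousAt.continuousWithinAt.mul hg1
  have := integral_Ioi_of_hasDerivAt_of_tendsto hc hd1 i4 lim
  refine this.trans ?_
  simp

end

/-! ### Identification of the resolvent on functions vanishing at the gluing point -/

/-- The derivative on the right half-line, extended by a constant. -/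
def rightDeriv (f : ℝ → ℝ) (r : ℝ) : ℝ := grad f (max r 1)

/-- The derivative of the reflection of the left half-line, extended by a constant. -/
def leftDeriv (f : ℝ → ℝ) (r : ℝ) : ℝ := -grad f (-max r 1)

theorem mem_line_of_one_le {r : ℝ} (hr : 1 ≤ r) : r ∈ line := Or.inr hr

theorem neg_mem_line_of_one_le {r : ℝ} (hr : 1 ≤ r) : -r ∈ line :=
  Or.inl (by simp only [mem_Iic]; linarith)

theorem line_mem_nhds {r : ℝ} (hr : 1 < r) : line ∈ 𝓝 r :=
  mem_of_superset (Ioi_mem_nhds hr) fun _ h => mem_line_of_one_le (le_of_lt h)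

theorem line_mem_nhds_neg {r : ℝ} (hr : 1 < r) : line ∈ 𝓝 (-r) :=
  mem_of_superset (Iio_mem_nhds (by linarith : -r < -1)) fun s (h : s < -1) => Or.inl h.le

theorem IsC1.hasDerivAt {g : ℝ → ℝ} (hg : ContDiffOn ℝ 1 g line) {r : ℝ} (hr : 1 < r) :
    HasDerivAt g (grad g r) r :=
  ((hg.differentiableOn (by simp)) r
    (mem_line_of_one_le hr.le)).hasDerivWithinAt.hasDerivAt (line_mem_nhds hr)

theorem IsC1.hasDerivAt_neg {g : ℝ → ℝ} (hg : ContDiffOn ℝ 1 g line) {r : ℝ} (hr : 1 < r) :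
    HasDerivAt (fun r => g (-r)) (-grad g (-r)) r := by
  have h := ((hg.differentiableOn (by simp)) (-r)
    (neg_mem_line_of_one_le hr.le)).hasDerivWithinAt.hasDerivAt (line_mem_nhds_neg hr)
  have := h.comp r (_root_.hasDerivAt_neg r)
  rwa [mul_neg_one] at this

theorem continuousOn_comp_neg {g : ℝ → ℝ} (hg : ContinuousOn g line) :
    ContinuousOn (fun r => g (-r)) (Ici 1) :=
  hg.comp continuous_neg.continuousOn fun _ hr => neg_mem_line_of_one_le hr

section

variable {f : ℝ → ℝ}

theorem IsTest.contDiffOn_one (hf : IsTest f) : ContDiffOn ℝ 1 f line :=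
  hf.contDiffOn.of_le (by exact_mod_cast le_top)

theorem IsTest.continuousOn_grad (hf : IsTest f) : ContinuousOn (grad f) line :=
  hf.contDiffOn_one.continuousOn_derivWithin uniqueDiffOn_line le_rfl

theorem IsTest.continuous_rightDeriv (hf : IsTest f) : Continuous (rightDeriv f) :=
  hf.continuousOn_grad.comp_continuous (by fun_prop)
    fun _ => mem_line_of_one_le (le_max_right _ _)

theorem IsTest.continuous_leftDeriv (hf : IsTest f) : Continuous (leftDeriv f) :=
  (hf.continuousOn_grad.comp_continuous (f := fun r => -max r 1) (by fun_prop)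
    fun _ => neg_mem_line_of_one_le (le_max_right _ _)).neg

theorem IsTest.exists_support (hf : IsTest f) : ∃ M : ℝ, 1 ≤ M ∧ ∀ t, M ≤ t →
    f t = 0 ∧ f (-t) = 0 ∧ rightDeriv f t = 0 ∧ leftDeriv f t = 0 := by
  obtain ⟨K, hK, h0⟩ := hf.compactSupport
  obtain ⟨R, hR⟩ := hK.isBounded.exists_norm_le
  have key : ∀ t, max R 1 < |t| → t ∈ line → f t = 0 := fun t ht hl =>
    h0 t hl fun hk => absurd (hR t hk) (not_le.2 ((le_max_left _ _).trans_lt ht))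
  refine ⟨max R 1 + 1, by linarith [le_max_right R 1], fun t ht => ?_⟩
  have h1 : 1 < t := by linarith [le_max_right R 1]
  have hnear : ∀ s, max R 1 < s → f s = 0 ∧ f (-s) = 0 := fun s hs => by
    have hs1 : 1 < s := (le_max_right R 1).trans_lt hs
    refine ⟨key s ?_ (mem_line_of_one_le hs1.le), key (-s) ?_ (neg_mem_line_of_one_le hs1.le)⟩
    · rwa [abs_of_pos (by linarith)]
    · rwa [abs_neg, abs_of_pos (by linarith)]
  have hn : ∀ᶠ s in 𝓝 t, max R 1 < s := Ioi_mem_nhds (by linarith)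
  refine ⟨(hnear t (by linarith)).1, (hnear t (by linarith)).2, ?_, ?_⟩
  · rw [rightDeriv, max_eq_left h1.le]
    have e : f =ᶠ[𝓝 t] fun _ => 0 := hn.mono fun s hs => (hnear s hs).1
    exact (IsC1.hasDerivAt hf.contDiffOn_one h1).unique
      ((hasDerivAt_const t (0:ℝ)).congr_of_eventuallyEq e)
  · rw [leftDeriv, max_eq_left h1.le]
    have e : (fun s => f (-s)) =ᶠ[𝓝 t] fun _ => 0 := hn.mono fun s hs => (hnear s hs).2
    exact (IsC1.hasDerivAt_neg hf.contDiffOn_one h1).unique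
      ((hasDerivAt_const t (0:ℝ)).congr_of_eventuallyEq e)

theorem IsS0.eq_integral (hf : IsS0 f) {r : ℝ} (hr : 1 ≤ r) :
    f r = ∫ t in (1:ℝ)..r, rightDeriv f t := by
  rw [intervalIntegral.integral_eq_sub_of_hasDerivAt_of_le (f := f) hr, hf.right, sub_zero]
  · exact hf.contDiffOn.continuousOn.mono fun t ht => mem_line_of_one_le ht.1
  · intro t ht
    rw [rightDeriv, max_eq_left ht.1.le]
    exact IsC1.hasDerivAt hf.toIsTest.contDiffOn_one ht.1
  · exact hf.toIsTest.continuous_rightDeriv.intervalIntegrable _ _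

theorem IsS0.neg_eq_integral (hf : IsS0 f) {r : ℝ} (hr : 1 ≤ r) :
    f (-r) = ∫ t in (1:ℝ)..r, leftDeriv f t := by
  rw [intervalIntegral.integral_eq_sub_of_hasDerivAt_of_le (f := fun t => f (-t)) hr, hf.left,
    sub_zero]
  · exact (continuousOn_comp_neg hf.contDiffOn.continuousOn).mono Icc_subset_Ici_self
  · intro t ht
    rw [leftDeriv, max_eq_left ht.1.le]
    exact IsC1.hasDerivAt_neg hf.toIsTest.contDiffOn_one ht.1
  · exact hf.toIsTest.continuous_leftDeriv.intervalIntegrable _ _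

theorem isLaplacian_resolvent {d l : ℝ} (hl : 0 < l) (g : L2 d) :
    IsLaplacian d (resolvent d l g) (g - l ^ 2 • resolvent d l g) := by
  rw [resolvent, dif_pos hl]
  exact (existsUnique_resolvent d l hl g).choose_spec.1

theorem resolvent_eq {d l : ℝ} (hl : 0 < l) {g u : L2 d} (h : IsLaplacian d u (g - l ^ 2 • u)) :
    resolvent d l g = u :=
  (existsUnique_resolvent d l hl g).unique (isLaplacian_resolvent hl g) h

theorem inner_eq_half {d : ℝ} {x y : L2 d} {p q : ℝ → ℝ} (hx : x =ᵐ[mu d] p) (hy : y =ᵐ[mu d] q) :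
    inner ℝ x y = ∫ r, p r * q r ∂(half d) + ∫ r, p (-r) * q (-r) ∂(half d) := by
  have hp : MemLp p 2 (mu d) := (Lp.memLp x).ae_eq hx
  have hq : MemLp q 2 (mu d) := (Lp.memLp y).ae_eq hy
  rw [L2.inner_def, ← integral_mu (g := fun r => p r * q r) (hp.integrable_mul hq)]
  refine integral_congr_ae ?_
  filter_upwards [hx, hy] with r h1 h2
  simp [h1, h2, mul_comm]

/-- The candidate for (Δ+l²)⁻¹f is V = l⁻²(f - T), with T given by `valueOp`. Since T' = S + f' with
S given by `derivOp`, V' = -l⁻²S. The weak equation on both halves gives Q(V, g) = ⟨T, g⟩ = ⟨f -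
l²V, g⟩ for C¹ functions g, by closure for all g in the form domain, and the resolvent is unique.
The condition f(±1) = 0 enters by writing f as the integral of its derivative. -/
theorem sqrtIntegrand_eq {d l M : ℝ} (hd : 1 < d) (hl : 0 < l) (hf : IsS0 f) (hM : 1 ≤ M)
    (h0 : ∀ t, M ≤ t → rightDeriv f t = 0 ∧ leftDeriv f t = 0) :
    sqrtIntegrand d (hf.toIsTest.toL2 d) l =ᵐ[mu d]
      join (valueOp d l M (rightDeriv f) (leftDeriv f))
        (valueOp d l M (leftDeriv f) (rightDeriv f)) := by
  set φ := rightDeriv f with hφdef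
  set ψ := leftDeriv f with hψdef
  have hφ : Continuous φ := hf.toIsTest.continuous_rightDeriv
  have hψ : Continuous ψ := hf.toIsTest.continuous_leftDeriv
  have hl2 : l ^ 2 ≠ 0 := by positivity
  set T₁ := valueOp d l M φ ψ with hT₁
  set T₂ := valueOp d l M ψ φ with hT₂
  set S₁ := derivOp d l M φ ψ with hS₁
  set S₂ := derivOp d l M ψ φ with hS₂
  obtain ⟨mT₁, mS₁⟩ := memLp_ops (ψ := ψ) hd hl hM hφ fun t ht => (h0 t ht).1
  obtain ⟨mT₂, mS₂⟩ := memLp_ops (ψ := φ) hd hl hM hψ fun t ht => (h0 t ht).2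
  set p : ℝ → ℝ := fun r => (l ^ 2)⁻¹ * ((∫ t in (1:ℝ)..r, φ t) - T₁ r) with hp
  set q : ℝ → ℝ := fun r => (l ^ 2)⁻¹ * ((∫ t in (1:ℝ)..r, ψ t) - T₂ r) with hq
  have dp : ∀ r, 0 < r → HasDerivAt p (-(l ^ 2)⁻¹ * S₁ r) r := fun r hr => by
    refine (((hasDerivAt_primitive hφ.continuousOn one_pos hr).sub
      (hasDerivAt_valueOp (ψ := ψ) hd hl hM hφ hr)).const_mul _).congr_deriv ?_
    rw [hS₁]; ring
  have dq : ∀ r, 0 < r → HasDerivAt q (-(l ^ 2)⁻¹ * S₂ r) r := fun r hr => by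
    refine (((hasDerivAt_primitive hψ.continuousOn one_pos hr).sub
      (hasDerivAt_valueOp (ψ := φ) hd hl hM hψ hr)).const_mul _).congr_deriv ?_
    rw [hS₂]; ring
  have cS₁ : ContinuousOn (fun r => -(l ^ 2)⁻¹ * S₁ r) (Ioi 0) :=
    continuousOn_const.mul (continuousOn_derivOp hd hl hM hφ)
  have cS₂ : ContinuousOn (fun r => -(l ^ 2)⁻¹ * S₂ r) (Ioi 0) :=
    continuousOn_const.mul (continuousOn_derivOp hd hl hM hψ)
  have g0 : q 1 = p 1 := by
    simp only [hp, hq, intervalIntegral.integral_same, hT₁, hT₂, valueOp_one (φ := φ) hd hl]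
  have g1 : S₁ 1 = -S₂ 1 := derivOp_one hd hl
  have hC1 : IsC1 (join p q) := isC1_join dp dq cS₁ cS₂ g0 (by rw [g1]; ring)
  have mf := memLp_mu_iff.1 (hf.toIsTest.memLp d)
  have mp : MemLp p 2 (half d) := by
    refine ((mf.1.sub mT₁).const_mul (l ^ 2)⁻¹).ae_eq ?_
    filter_upwards [ae_half_mem d] with r hr
    rw [Pi.sub_apply, hf.eq_integral (le_of_lt hr)]
  have mq : MemLp q 2 (half d) := by
    refine ((mf.2.sub mT₂).const_mul (l ^ 2)⁻¹).ae_eq ?_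
    filter_upwards [ae_half_mem d] with r hr
    rw [Pi.sub_apply, hf.neg_eq_integral (le_of_lt hr)]
  set p' : ℝ → ℝ := fun r => -(l ^ 2)⁻¹ * S₁ r with hp'
  set q' : ℝ → ℝ := fun r => -(l ^ 2)⁻¹ * S₂ r with hq'
  have mV : MemLp (join p q) 2 (mu d) := memLp_join mp mq
  have mV' : MemLp (join p' fun r => -q' r) 2 (mu d) :=
    memLp_join (mS₁.const_mul _) (mS₂.const_mul _).neg
  set V : L2 d := mV.toLp _ with hV
  set V' : L2 d := mV'.toLp _ with hV'
  have aV : V =ᵐ[mu d] join p q := mV.coeFn_toLp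
  have aV' : V' =ᵐ[mu d] join p' fun r => -q' r := mV'.coeFn_toLp
  set F : L2 d := hf.toIsTest.toL2 d with hF
  have aF : F =ᵐ[mu d] f := (hf.toIsTest.memLp d).coeFn_toLp
  have aT : (F - l ^ 2 • V : L2 d) =ᵐ[mu d] join T₁ T₂ := by
    filter_upwards [Lp.coeFn_sub F (l ^ 2 • V), Lp.coeFn_smul (l ^ 2) V, aV, aF,
      ae_mem_line d] with r h1 h2 h3 h4 h5
    rw [h1, Pi.sub_apply, h2, Pi.smul_apply, h3, h4, smul_eq_mul]
    rcases h5 with h | h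
    · have h' : 1 ≤ -r := by simp only [mem_Iic] at h; linarith
      have h6 := hf.neg_eq_integral h'
      rw [neg_neg] at h6
      rw [join_of_neg _ _ (by linarith), join_of_neg _ _ (by linarith), h6]
      simp only [hq]
      field_simp
      ring
    · have h' : 1 ≤ r := h
      rw [join_of_pos _ _ (by linarith), join_of_pos _ _ (by linarith), hf.eq_integral h']
      simp only [hp]
      field_simp
      ring
  have hx : (WithLp.toLp 2 (V, V') : WithLp 2 (L2 d × L2 d)) ∈ gradGraph d := by
    refine ⟨join p q, hC1, aV, aV'.trans ?_⟩
    filter_upwards [ae_mem_line d] with r hr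
    exact (grad_join dp dq hr).symm
  have weak : ∀ y ∈ gradGraph d, inner ℝ V' y.snd = inner ℝ (F - l ^ 2 • V) y.fst := by
    rintro y ⟨g, hg, h1, h2⟩
    have mg := memLp_mu_iff.1 ((Lp.memLp y.fst).ae_eq h1)
    have mg' := memLp_mu_iff.1 ((Lp.memLp y.snd).ae_eq h2)
    have w₁ := integral_derivOp_mul (ψ := ψ) hd hl hM hφ (fun t ht => (h0 t ht).1)
      (g := g) (g' := grad g) (fun r hr => IsC1.hasDerivAt hg.contDiffOn hr)
      ((hg.contDiffOn.continuousOn 1 one_mem).mono fun r hr => mem_line_of_one_le hr) mg.1 mg'.1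
    have w₂ := integral_derivOp_mul (ψ := φ) hd hl hM hψ (fun t ht => (h0 t ht).2)
      (g := fun r => g (-r)) (g' := fun r => -grad g (-r))
      (fun r hr => IsC1.hasDerivAt_neg hg.contDiffOn hr)
      (continuousOn_comp_neg hg.contDiffOn.continuousOn 1 self_mem_Ici) mg.2 mg'.2.neg
    rw [inner_eq_half aV' h2, inner_eq_half aT h1]
    have e₁ : ∫ r, join p' (fun r => -q' r) r * grad g r ∂(half d) =
        -(l ^ 2)⁻¹ * ∫ r, S₁ r * grad g r ∂(half d) := by
      rw [← integral_const_mul]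
      refine integral_congr_ae ?_
      filter_upwards [ae_half_mem d] with r hr
      rw [join_of_pos _ _ (lt_trans one_pos hr), hp']
      ring
    have e₂ : ∫ r, join p' (fun r => -q' r) (-r) * grad g (-r) ∂(half d) =
        -(l ^ 2)⁻¹ * ∫ r, S₂ r * -grad g (-r) ∂(half d) := by
      rw [← integral_const_mul]
      refine integral_congr_ae ?_
      filter_upwards [ae_half_mem d] with r hr
      rw [join_neg _ _ (lt_trans one_pos hr), hq']
      ring
    have e₃ : ∫ r, join T₁ T₂ r * g r ∂(half d) = ∫ r, T₁ r * g r ∂(half d) := by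
      refine integral_congr_ae ?_
      filter_upwards [ae_half_mem d] with r hr
      rw [join_of_pos _ _ (lt_trans one_pos hr)]
    have e₄ : ∫ r, join T₁ T₂ (-r) * g (-r) ∂(half d) = ∫ r, T₂ r * g (-r) ∂(half d) := by
      refine integral_congr_ae ?_
      filter_upwards [ae_half_mem d] with r hr
      rw [join_neg _ _ (lt_trans one_pos hr)]
    rw [e₁, e₂, e₃, e₄]
    rw [← hS₁, ← hT₁] at w₁
    rw [← hS₂, ← hT₂, hg.glue] at w₂
    -- As S₁(1) = -S₂(1) and g(-1) = g(1), the boundary terms of the two halves cancel.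
    rw [g1] at w₁
    have w₁' := eq_sub_of_add_eq w₁
    have w₂' := eq_sub_of_add_eq w₂
    rw [w₁', w₂']
    field_simp
    ring
  have hlap : IsLaplacian d V (F - l ^ 2 • V) := by
    refine ⟨WithLp.toLp 2 (V, V'), (gradGraph d).le_topologicalClosure hx, rfl, fun y hy => ?_⟩
    have hcl : IsClosed {y : WithLp 2 (L2 d × L2 d) |
        inner ℝ V' y.snd = inner ℝ (F - l ^ 2 • V) y.fst} := by
      refine isClosed_eq ?_ ?_
      · exact continuous_const.inner (WithLp.sndL 2 ℝ (L2 d) (L2 d)).continuous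
      · exact continuous_const.inner (WithLp.fstL 2 ℝ (L2 d) (L2 d)).continuous
    exact closure_minimal (fun y hy => weak y hy) hcl hy
  rw [sqrtIntegrand, resolvent_eq hl hlap]
  exact aT

end

/-! ### Resolvent estimates and absolute convergence of the square root -/

section

variable {d l : ℝ}

theorem IsLaplacian.inner_nonneg {u h : L2 d} (hu : IsLaplacian d u h) : 0 ≤ inner ℝ h u := by
  obtain ⟨x, hx, rfl, hh⟩ := hu
  rw [← hh x hx]
  exact real_inner_self_nonneg

theorem IsLaplacian.sub {u v h k : L2 d} (hu : IsLaplacian d u h) (hv : IsLaplacian d v k) :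
    IsLaplacian d (u - v) (h - k) := by
  obtain ⟨x, hx, rfl, hh⟩ := hu
  obtain ⟨y, hy, rfl, hk⟩ := hv
  refine ⟨x - y, sub_mem hx hy, rfl, fun z hz => ?_⟩
  rw [WithLp.sub_snd, inner_sub_left, inner_sub_left, hh z hz, hk z hz]

theorem IsLaplacian.smul {u h : L2 d} (c : ℝ) (hu : IsLaplacian d u h) :
    IsLaplacian d (c • u) (c • h) := by
  obtain ⟨x, hx, rfl, hh⟩ := hu
  refine ⟨c • x, Submodule.smul_mem _ c hx, rfl, fun z hz => ?_⟩
  rw [WithLp.smul_snd, real_inner_smul_left, real_inner_smul_left, hh z hz]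

theorem norm_resolvent_le (hl : 0 < l) (g : L2 d) : l ^ 2 * ‖resolvent d l g‖ ≤ ‖g‖ := by
  have h := (isLaplacian_resolvent hl g).inner_nonneg
  rw [inner_sub_left, real_inner_smul_left, real_inner_self_eq_norm_sq] at h
  have h2 := real_inner_le_norm g (resolvent d l g)
  rcases (norm_nonneg (resolvent d l g)).eq_or_lt with h3 | h3
  · rw [← h3]; simp
  · have : l ^ 2 * ‖resolvent d l g‖ * ‖resolvent d l g‖ ≤ ‖g‖ * ‖resolvent d l g‖ := by
      nlinarith
    exact le_of_mul_le_mul_right this h3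

/-- With v = (Δ+l²)⁻¹u and w = Δv = u - l²v, one has ‖w‖² = ⟨w, u⟩ - l²⟨w, v⟩, and ⟨w, v⟩ ≥ 0. -/
theorem norm_sqrtIntegrand_le (hl : 0 < l) (u : L2 d) : ‖sqrtIntegrand d u l‖ ≤ ‖u‖ := by
  have h := (isLaplacian_resolvent hl u).inner_nonneg
  rw [← sqrtIntegrand] at h
  have h1 : inner ℝ (sqrtIntegrand d u l) (sqrtIntegrand d u l) =
      inner ℝ (sqrtIntegrand d u l) u - l ^ 2 * inner ℝ (sqrtIntegrand d u l) (resolvent d l u) := by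
    conv_lhs => rw [show inner ℝ (sqrtIntegrand d u l) (sqrtIntegrand d u l) =
      inner ℝ (sqrtIntegrand d u l) (u - l ^ 2 • resolvent d l u) from rfl]
    rw [inner_sub_right, real_inner_smul_right]
  rw [real_inner_self_eq_norm_sq] at h1
  have h2 := real_inner_le_norm (sqrtIntegrand d u l) u
  have h4 : 0 ≤ l ^ 2 * inner ℝ (sqrtIntegrand d u l) (resolvent d l u) := by positivity
  rcases (norm_nonneg (sqrtIntegrand d u l)).eq_or_lt with h3 | h3
  · rw [← h3]; exact norm_nonneg u
  · nlinarith

theorem sqrtIntegrand_eq_resolvent (hl : 0 < l) {u h : L2 d} (hu : IsLaplacian d u h) :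
    sqrtIntegrand d u l = resolvent d l h := by
  refine (resolvent_eq hl ?_).symm
  have := hu.sub ((isLaplacian_resolvent hl u).smul (l ^ 2))
  exact this

/-- The resolvent identity. It yields continuity in l, and thereby measurability of the integrand of
the square root. -/
theorem resolvent_sub_resolvent {m : ℝ} (hl : 0 < l) (hm : 0 < m) (u : L2 d) :
    resolvent d l u - resolvent d m u = resolvent d l ((m ^ 2 - l ^ 2) • resolvent d m u) := by
  refine (resolvent_eq hl ?_).symm
  have := (isLaplacian_resolvent hl u).sub (isLaplacian_resolvent hm u)
  convert this using 1
  module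

theorem continuousOn_resolvent (u : L2 d) : ContinuousOn (fun l => resolvent d l u) (Ioi 0) := by
  intro m (hm : 0 < m)
  have h1 : ∀ l ∈ Ioi (0:ℝ), dist (resolvent d l u) (resolvent d m u) ≤
      (l ^ 2)⁻¹ * (|m ^ 2 - l ^ 2| * ‖resolvent d m u‖) := by
    intro l (hl : 0 < l)
    rw [dist_eq_norm, resolvent_sub_resolvent hl hm]
    have := norm_resolvent_le (d := d) hl ((m ^ 2 - l ^ 2) • resolvent d m u)
    rw [norm_smul, Real.norm_eq_abs] at this
    rw [inv_mul_eq_div, le_div_iff₀ (by positivity)]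
    linarith
  rw [ContinuousWithinAt, tendsto_iff_dist_tendsto_zero]
  refine squeeze_zero' (Eventually.of_forall fun _ => dist_nonneg)
    (eventually_nhdsWithin_of_forall h1) ?_
  have hc : ContinuousAt (fun l : ℝ => (l ^ 2)⁻¹ * (|m ^ 2 - l ^ 2| * ‖resolvent d m u‖)) m := by
    refine ContinuousAt.mul (ContinuousAt.inv₀ (by fun_prop) (by positivity)) (by fun_prop)
  have := hc.tendsto
  simp only [sub_self, abs_zero, zero_mul, mul_zero] at this
  exact this.mono_left nhdsWithin_le_nhds

theorem aestronglyMeasurable_sqrtIntegrand (u : L2 d) :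
    AEStronglyMeasurable (sqrtIntegrand d u) (volume.restrict (Ioi 0)) := by
  have : ContinuousOn (sqrtIntegrand d u) (Ioi 0) :=
    continuousOn_const.sub ((by fun_prop : ContinuousOn (fun l : ℝ => l ^ 2) (Ioi 0)).smul
      (continuousOn_resolvent u))
  exact this.aestronglyMeasurable measurableSet_Ioi

/-- For l ≤ 1 the integrand is bounded by ‖u‖. For l > 1 it equals (Δ+l²)⁻¹Δu, whose norm is at most
l⁻²‖Δu‖. -/
theorem sqrtConverges_of_isLaplacian {u h : L2 d} (hu : IsLaplacian d u h) : SqrtConverges d u := by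
  have hm := aestronglyMeasurable_sqrtIntegrand u
  have h1 : IntegrableOn (sqrtIntegrand d u) (Ioc 0 1) := by
    refine Integrable.mono' (g := fun _ => ‖u‖) (integrableOn_const (by simp))
      (hm.mono_measure (Measure.restrict_mono Ioc_subset_Ioi_self le_rfl)) ?_
    filter_upwards [ae_restrict_mem measurableSet_Ioc] with l hl
    exact norm_sqrtIntegrand_le hl.1 u
  have h2 : IntegrableOn (sqrtIntegrand d u) (Ioi 1) := by
    refine Integrable.mono' ((integrableOn_Ioi_rpow_of_lt (a := -2) (by norm_num)
      (one_pos (α := ℝ))).mul_const ‖h‖)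
      (hm.mono_measure (Measure.restrict_mono (Ioi_subset_Ioi zero_le_one) le_rfl)) ?_
    filter_upwards [ae_restrict_mem measurableSet_Ioi] with l hl
    have hl0 : 0 < l := lt_trans one_pos hl
    rw [sqrtIntegrand_eq_resolvent hl0 hu, Real.rpow_neg hl0.le, Real.rpow_two,
      inv_mul_eq_div, le_div_iff₀ (by positivity), mul_comm]
    exact norm_resolvent_le hl0 h
  rw [SqrtConverges, ← Ioc_union_Ioi_eq_Ioi zero_le_one]
  exact h1.union h2

theorem integral_by_parts_half {φ φ' g g' : ℝ → ℝ} (hφ : ∀ r, 1 < r → HasDerivAt φ (φ' r) r)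
    (hφ1 : ContinuousWithinAt φ (Ici 1) 1) (hg : ∀ r, 1 < r → HasDerivAt g (g' r) r)
    (hg1 : ContinuousWithinAt g (Ici 1) 1) (mφ : MemLp φ 2 (half d))
    (mh : MemLp (fun r => φ' r + (d - 1) / r * φ r) 2 (half d)) (mg : MemLp g 2 (half d))
    (mg' : MemLp g' 2 (half d)) :
    ∫ r, φ r * g' r ∂(half d) + ∫ r, (φ' r + (d - 1) / r * φ r) * g r ∂(half d) =
      -(φ 1 * g 1) := by
  have i1 : Integrable (fun r => φ r * g' r) (half d) := mφ.integrable_mul mg'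
  have i2 : Integrable (fun r => (φ' r + (d - 1) / r * φ r) * g r) (half d) := mh.integrable_mul mg
  have i3 : Integrable (fun r => φ r * g r) (half d) := mφ.integrable_mul mg
  rw [← integral_add i1 i2, integral_half]
  have i4 := i1.add i2
  rw [integrable_half_iff] at i3 i4
  have hd1 : ∀ r ∈ Ioi (1:ℝ), HasDerivAt (fun r => r ^ (d - 1) * (φ r * g r))
      (r ^ (d - 1) * (φ r * g' r + (φ' r + (d - 1) / r * φ r) * g r)) r := by
    intro r hr
    refine ((hasDerivAt_weight d (lt_trans one_pos hr)).mul
      ((hφ r hr).mul (hg r hr))).congr_deriv ?_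
    simp only [Pi.mul_apply]
    ring
  have lim := tendsto_zero_of_hasDerivAt_of_integrableOn_Ioi hd1 i4 i3
  have hc : ContinuousWithinAt (fun r => r ^ (d - 1) * (φ r * g r)) (Ici 1) 1 :=
    (hasDerivAt_weight d one_pos).continuousAt.continuousWithinAt.mul (hφ1.mul hg1)
  have := integral_Ioi_of_hasDerivAt_of_tendsto hc hd1 i4 lim
  refine this.trans ?_
  simp

theorem memLp_half_of_support {h : ℝ → ℝ} {M : ℝ} (hc : ContinuousOn h (Ici 1))
    (h0 : ∀ r, M ≤ r → h r = 0) : MemLp h 2 (half d) :=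
  memLp_half_of_decay d (M := M) (C := 0) one_pos hc fun r _ hr => by simp [h0 r hr]

/-- The image is Δf = -(f'' + (d-1)f'/r). Integration by parts on the two halves leaves boundary
terms that cancel because f' and the C¹ function g agree at ±1. -/
theorem exists_isLaplacian {f : ℝ → ℝ} (hf : IsTest f) : ∃ h, IsLaplacian d (hf.toL2 d) h := by
  set f₁ := grad f with hf₁
  set f₂ := grad f₁ with hf₂
  have c1 : ContDiffOn ℝ 1 f₁ line :=
    hf.contDiffOn.derivWithin uniqueDiffOn_line (WithTop.coe_le_coe.2 le_top)
  have k1 : ContinuousOn f₁ line := c1.continuousOn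
  have k2 : ContinuousOn f₂ line := c1.continuousOn_derivWithin uniqueDiffOn_line le_rfl
  have k3 : ContinuousOn (fun r => -(f₂ r + (d - 1) / r * f₁ r)) line := by
    refine (k2.add (ContinuousOn.mul ?_ k1)).neg
    exact continuousOn_const.div continuousOn_id fun r hr => ne_zero_of_mem_line hr
  obtain ⟨M, hM, h0⟩ := hf.exists_support
  have z1 : ∀ t, M ≤ t → f₁ t = 0 ∧ f₁ (-t) = 0 := by
    intro t ht
    obtain ⟨-, -, a, b⟩ := h0 t ht
    rw [rightDeriv, max_eq_left (by linarith)] at a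
    rw [leftDeriv, max_eq_left (by linarith), neg_eq_zero] at b
    exact ⟨a, b⟩
  -- Moving past M makes f₁ vanish on a whole neighbourhood of the point, which is what its
  -- derivative needs.
  have z2 : ∀ t, M + 1 ≤ t → f₂ t = 0 ∧ f₂ (-t) = 0 := by
    intro t ht
    have h1 : 1 < t := by linarith
    have hn : ∀ᶠ s in 𝓝 t, M < s := Ioi_mem_nhds (by linarith)
    constructor
    · have e : f₁ =ᶠ[𝓝 t] fun _ => 0 := hn.mono fun s hs => (z1 s (le_of_lt hs)).1
      exact (IsC1.hasDerivAt c1 h1).unique ((hasDerivAt_const t (0:ℝ)).congr_of_eventuallyEq e)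
    · have e : (fun s => f₁ (-s)) =ᶠ[𝓝 t] fun _ => 0 := hn.mono fun s hs => (z1 s (le_of_lt hs)).2
      exact neg_eq_zero.1 ((IsC1.hasDerivAt_neg c1 h1).unique
        ((hasDerivAt_const t (0:ℝ)).congr_of_eventuallyEq e))
  have hIci : Ici (1:ℝ) ⊆ line := fun _ h => mem_line_of_one_le h
  have m1 : MemLp f₁ 2 (half d) := memLp_half_of_support (k1.mono hIci) fun r hr => (z1 r hr).1
  have m1' : MemLp (fun r => f₁ (-r)) 2 (half d) :=
    memLp_half_of_support (continuousOn_comp_neg k1) fun r hr => (z1 r hr).2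
  have m2 : MemLp (fun r => -(f₂ r + (d - 1) / r * f₁ r)) 2 (half d) :=
    memLp_half_of_support (M := M + 1) (k3.mono hIci) fun r hr => by
      rw [(z1 r (by linarith)).1, (z2 r hr).1]; simp
  have m2' : MemLp (fun r => -(f₂ (-r) + (d - 1) / (-r) * f₁ (-r))) 2 (half d) :=
    memLp_half_of_support (M := M + 1) (continuousOn_comp_neg k3) fun r hr => by
      rw [(z1 r (by linarith)).2, (z2 r hr).2]; simp
  have mG : MemLp f₁ 2 (mu d) := memLp_mu_iff.2 ⟨m1, m1'⟩
  have mH : MemLp (fun r => -(f₂ r + (d - 1) / r * f₁ r)) 2 (mu d) := memLp_mu_iff.2 ⟨m2, m2'⟩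
  have g1 : f₁ (-1) = f₁ 1 := by
    have := hf.glue 1
    rwa [iteratedDerivWithin_one] at this
  have hC1 : IsC1 f := ⟨hf.contDiffOn_one, by simpa using hf.glue 0, g1⟩
  set F : L2 d := hf.toL2 d with hF
  set G : L2 d := mG.toLp _ with hG
  set H : L2 d := mH.toLp _ with hH
  have aF : F =ᵐ[mu d] f := (hf.memLp d).coeFn_toLp
  have aG : G =ᵐ[mu d] f₁ := mG.coeFn_toLp
  have aH : H =ᵐ[mu d] fun r => -(f₂ r + (d - 1) / r * f₁ r) := mH.coeFn_toLp
  refine ⟨H, WithLp.toLp 2 (F, G), (gradGraph d).le_topologicalClosure ⟨f, hC1, aF, aG⟩, rfl,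
    fun y hy => ?_⟩
  have weak : ∀ y ∈ gradGraph d, inner ℝ G y.snd = inner ℝ H y.fst := by
    rintro y ⟨g, hg, h1, h2⟩
    have mg := memLp_mu_iff.1 ((Lp.memLp y.fst).ae_eq h1)
    have mg' := memLp_mu_iff.1 ((Lp.memLp y.snd).ae_eq h2)
    have w₁ := integral_by_parts_half (d := d) (φ := f₁) (φ' := f₂) (g := g) (g' := grad g)
      (fun r hr => IsC1.hasDerivAt c1 hr) ((k1 1 one_mem).mono hIci)
      (fun r hr => IsC1.hasDerivAt hg.contDiffOn hr)
      ((hg.contDiffOn.continuousOn 1 one_mem).mono hIci) m1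
      (m2.neg.ae_eq (Eventually.of_forall fun r => by simp)) mg.1 mg'.1
    have w₂ := integral_by_parts_half (d := d) (φ := fun r => -f₁ (-r)) (φ' := fun r => f₂ (-r))
      (g := fun r => g (-r)) (g' := fun r => -grad g (-r))
      (fun r hr => (IsC1.hasDerivAt_neg c1 hr).neg.congr_deriv (neg_neg _))
      ((continuousOn_comp_neg k1).neg 1 self_mem_Ici)
      (fun r hr => IsC1.hasDerivAt_neg hg.contDiffOn hr)
      (continuousOn_comp_neg hg.contDiffOn.continuousOn 1 self_mem_Ici) m1'.neg
      (m2'.neg.ae_eq (Eventually.of_forall fun r => by simp [div_neg])) mg.2 mg'.2.neg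
    rw [inner_eq_half aG h2, inner_eq_half aH h1]
    have e₁ : ∫ r, -(f₂ r + (d - 1) / r * f₁ r) * g r ∂(half d) =
        -∫ r, (f₂ r + (d - 1) / r * f₁ r) * g r ∂(half d) := by
      rw [← integral_neg]; simp only [neg_mul]
    have e₂ : ∫ r, -(f₂ (-r) + (d - 1) / (-r) * f₁ (-r)) * g (-r) ∂(half d) =
        -∫ r, (f₂ (-r) + (d - 1) / r * -f₁ (-r)) * g (-r) ∂(half d) := by
      rw [← integral_neg]
      refine integral_congr_ae (Eventually.of_forall fun r => ?_)
      simp only [div_neg]; ring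
    simp only [neg_mul_neg] at w₂
    rw [e₁, e₂]
    rw [hg.glue, g1] at w₂
    linarith
  have hcl : IsClosed {y : WithLp 2 (L2 d × L2 d) | inner ℝ G y.snd = inner ℝ H y.fst} := by
    refine isClosed_eq ?_ ?_
    · exact continuous_const.inner (WithLp.sndL 2 ℝ (L2 d) (L2 d)).continuous
    · exact continuous_const.inner (WithLp.fstL 2 ℝ (L2 d) (L2 d)).continuous
  exact closure_minimal (fun y hy => weak y hy) hcl hy

theorem IsTest.sqrtConverges {f : ℝ → ℝ} (hf : IsTest f) : SqrtConverges d (hf.toL2 d) :=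
  sqrtConverges_of_isLaplacian (exists_isLaplacian hf).choose_spec

end

/-! ### From operators to kernels: Fubini and pointwise values of vector integrals -/

/-- The value of `Δ (Δ + l²)⁻¹` on the right half-line as a kernel operator on derivatives. -/
def kernelOp (d l : ℝ) (φ ψ : ℝ → ℝ) (r : ℝ) : ℝ :=
  (∫ t in Ioi 1, sameKernel d l r t * φ t) + ∫ t in Ioi 1, crossKernel d l r t * ψ t

theorem integral_Ioi_eq_of_support {h : ℝ → ℝ} {M : ℝ} (h0 : ∀ t, M ≤ t → h t = 0) (r : ℝ) :
    ∫ t in Ioi r, h t = ∫ t in r..M, h t := by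
  rcases le_total r M with hr | hr
  · rw [intervalIntegral.integral_of_le hr]
    refine setIntegral_eq_of_subset_of_forall_sdiff_eq_zero measurableSet_Ioi
      Ioc_subset_Ioi_self fun t ht => h0 t ?_
    by_contra hlt
    exact ht.2 ⟨ht.1, (not_le.1 hlt).le⟩
  · rw [setIntegral_congr_fun (g := fun _ => 0) measurableSet_Ioi fun t ht =>
        h0 t (hr.trans (le_of_lt ht)),
      intervalIntegral.integral_congr (g := fun _ => 0) fun t ht => ?_]
    · simp
    · rw [uIcc_of_ge hr] at ht
      exact h0 t ht.1

theorem isBddCompact_indicator {φ : ℝ → ℝ} {M : ℝ} (hφ : Continuous φ)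
    (h0 : ∀ t, M ≤ t → φ t = 0) : IsBddCompact ((Ioi 1).indicator φ) := by
  obtain ⟨B, hB⟩ := (isCompact_Icc (a := (1:ℝ)) (b := M)).exists_bound_of_continuousOn
    hφ.continuousOn
  refine ⟨hφ.measurable.indicator measurableSet_Ioi, ⟨max B 0, fun t => ?_⟩, ⟨M, fun t ht => ?_⟩⟩
  · by_cases h1 : t ∈ Ioi (1:ℝ)
    · rw [indicator_of_mem h1]
      rcases le_total M t with h2 | h2
      · rw [h0 t h2]; simp
      · exact (hB t ⟨le_of_lt h1, h2⟩).trans (le_max_left _ _)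
    · rw [indicator_of_notMem h1]; simp
  · by_cases h1 : t ∈ Ioi (1:ℝ)
    · rw [indicator_of_mem h1]
      rw [abs_of_pos (lt_trans one_pos h1)] at ht
      exact h0 t ht.le
    · rw [indicator_of_notMem h1]

theorem setIntegral_mul_indicator (K φ : ℝ → ℝ) :
    ∫ t in Ioi 1, K t * (Ioi 1).indicator φ t = ∫ t in Ioi 1, K t * φ t :=
  setIntegral_congr_fun measurableSet_Ioi fun t ht => by simp only [indicator_of_mem ht]

theorem kernelOp_indicator (d l : ℝ) (φ ψ : ℝ → ℝ) (r : ℝ) :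
    kernelOp d l ((Ioi 1).indicator φ) ((Ioi 1).indicator ψ) r = kernelOp d l φ ψ r := by
  rw [kernelOp, kernelOp, setIntegral_mul_indicator, setIntegral_mul_indicator]

theorem measurable_sameKernel_right (d l r : ℝ) : Measurable fun t => sameKernel d l r t :=
  (measurable_sameKernel d).comp (g := fun x : ℝ × ℝ × ℝ => sameKernel d x.1 x.2.1 x.2.2)
    (f := fun t => (l, r, t)) (by fun_prop)

theorem integrableOn_sameKernel_mul {d l r : ℝ} (hd : 1 < d) (hl : 0 < l) (hr : 1 ≤ r)
    {φ : ℝ → ℝ} (hφ : IsBddCompact φ) :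
    IntegrableOn (fun t => sameKernel d l r t * φ t) (Ioi 1) :=
  integrable_kernel_mul (measurable_sameKernel_right d l r) hφ
    fun _ ht => abs_sameKernel_le hd hl hr ht.le

theorem valueOp_eq_kernelOp {d l M : ℝ} (hd : 1 < d) (hl : 0 < l) {φ ψ : ℝ → ℝ}
    (hφ : Continuous φ) (h0 : ∀ t, M ≤ t → φ t = 0) (h0' : ∀ t, M ≤ t → ψ t = 0) {r : ℝ}
    (hr : 1 < r) : valueOp d l M φ ψ r = kernelOp d l φ ψ r := by
  have hi : IntegrableOn (fun t => sameKernel d l r t * φ t) (Ioi 1) := by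
    refine (integrableOn_sameKernel_mul hd hl hr.le (isBddCompact_indicator hφ h0)).congr_fun
      (fun t ht => ?_) measurableSet_Ioi
    simp only [indicator_of_mem ht]
  have h1 : ∫ t in Ioi 1, sameKernel d l r t * φ t =
      decaySol d l r * (∫ t in (1:ℝ)..r, t ^ (d - 1) * growSolDeriv d l t * φ t) +
      growSol d l r * ∫ t in r..M, t ^ (d - 1) * decaySolDeriv d l t * φ t := by
    rw [← Ioc_union_Ioi_eq_Ioi hr.le, setIntegral_union (Ioc_disjoint_Ioi le_rfl)
      measurableSet_Ioi (hi.mono_set Ioc_subset_Ioi_self)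
      (hi.mono_set (Ioi_subset_Ioi hr.le)), intervalIntegral.integral_of_le hr.le,
      ← integral_Ioi_eq_of_support (fun t ht => by rw [h0 t ht, mul_zero]) r,
      ← integral_const_mul, ← integral_const_mul]
    congr 1
    · refine setIntegral_congr_fun measurableSet_Ioc fun t ht => ?_
      simp only [sameKernel]
      rw [if_pos ht.2]; ring
    · refine setIntegral_congr_fun measurableSet_Ioi fun t ht => ?_
      simp only [sameKernel]
      rw [if_neg (not_le.2 ht)]; ring
  have h2 : ∫ t in Ioi 1, crossKernel d l r t * ψ t =
      decaySol d l r * (gluing d l * ∫ t in (1:ℝ)..M, t ^ (d - 1) * decaySolDeriv d l t * ψ t) := by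
    rw [← integral_Ioi_eq_of_support (fun t ht => by rw [h0' t ht, mul_zero]) 1, ← mul_assoc,
      ← integral_const_mul]
    refine setIntegral_congr_fun measurableSet_Ioi fun t _ => ?_
    simp only [crossKernel]
    ring
  rw [kernelOp, h1, h2, valueOp]

theorem abs_kernelOp_le {d l r : ℝ} (hd : 1 < d) (hl : 0 < l) (hr : 1 ≤ r) {φ ψ : ℝ → ℝ}
    (hφ : IsBddCompact φ) (hψ : IsBddCompact ψ) :
    |kernelOp d l φ ψ r| ≤ (∫ t in Ioi 1, |φ t|) + ∫ t in Ioi 1, |ψ t| := by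
  refine (abs_add_le _ _).trans (add_le_add ?_ ?_)
  · rw [← Real.norm_eq_abs]
    refine norm_integral_le_of_norm_le hφ.integrable.abs.integrableOn ?_
    filter_upwards [ae_restrict_mem measurableSet_Ioi] with t ht
    rw [norm_mul]
    exact mul_le_of_le_one_left (norm_nonneg _) (abs_sameKernel_le hd hl hr (le_of_lt ht))
  · rw [← Real.norm_eq_abs]
    refine norm_integral_le_of_norm_le hψ.integrable.abs.integrableOn ?_
    filter_upwards [ae_restrict_mem measurableSet_Ioi] with t ht
    rw [norm_mul]
    exact mul_le_of_le_one_left (norm_nonneg _) (abs_crossKernel_le hd hl hr (le_of_lt ht))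

theorem measurable_kernelOp (d : ℝ) {φ ψ : ℝ → ℝ} (hφ : Measurable φ) (hψ : Measurable ψ) :
    Measurable fun x : ℝ × ℝ => kernelOp d x.1 φ ψ x.2 := by
  have h1 : Measurable fun x : (ℝ × ℝ) × ℝ => sameKernel d x.1.1 x.1.2 x.2 * φ x.2 :=
    ((measurable_sameKernel d).comp (g := fun x : ℝ × ℝ × ℝ => sameKernel d x.1 x.2.1 x.2.2)
      (f := fun x : (ℝ × ℝ) × ℝ => (x.1.1, x.1.2, x.2)) (by fun_prop)).mul
      (hφ.comp measurable_snd)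
  have h2 : Measurable fun x : (ℝ × ℝ) × ℝ => crossKernel d x.1.1 x.1.2 x.2 * ψ x.2 :=
    ((measurable_crossKernel d).comp (g := fun x : ℝ × ℝ × ℝ => crossKernel d x.1 x.2.1 x.2.2)
      (f := fun x : (ℝ × ℝ) × ℝ => (x.1.1, x.1.2, x.2)) (by fun_prop)).mul
      (hψ.comp measurable_snd)
  exact (h1.stronglyMeasurable.integral_prod_right' (ν := volume.restrict (Ioi 1))).measurable.add
    (h2.stronglyMeasurable.integral_prod_right' (ν := volume.restrict (Ioi 1))).measurable

/-- The kernels are merely bounded by one, so it is the factor e^(-lε) that makes the double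
integral absolutely convergent. -/
theorem integral_integral_kernel {ε : ℝ} (hε : 0 < ε) {K : ℝ → ℝ → ℝ}
    (hK : Measurable (Function.uncurry K)) (hb : ∀ l t, 0 < l → 1 < t → |K l t| ≤ 1) {φ : ℝ → ℝ}
    (hφ : IsBddCompact φ) :
    IntegrableOn (fun l => Real.exp (-(l * ε)) * ∫ t in Ioi 1, K l t * φ t) (Ioi 0) ∧
    ∫ t in Ioi 1, (∫ l in Ioi 0, Real.exp (-(l * ε)) * K l t) * φ t =
      ∫ l in Ioi 0, Real.exp (-(l * ε)) * ∫ t in Ioi 1, K l t * φ t := by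
  have hi : Integrable (fun x : ℝ × ℝ => Real.exp (-(x.1 * ε)) * (K x.1 x.2 * φ x.2))
      ((volume.restrict (Ioi 0)).prod (volume.restrict (Ioi 1))) := by
    refine Integrable.mono' (Integrable.mul_prod (integrableOn_exp_neg_mul hε)
      (hφ.integrable.abs.integrableOn (s := Ioi 1))) ?_ ?_
    · exact (Measurable.mul (by fun_prop)
        (hK.mul (hφ.measurable.comp measurable_snd))).aestronglyMeasurable
    · rw [Measure.prod_restrict]
      filter_upwards [ae_restrict_mem (measurableSet_Ioi.prod measurableSet_Ioi)] with x hx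
      rw [norm_mul, norm_mul, Real.norm_of_nonneg (Real.exp_pos _).le]
      refine mul_le_mul_of_nonneg_left ?_ (Real.exp_pos _).le
      exact mul_le_of_le_one_left (norm_nonneg _) (hb _ _ hx.1 hx.2)
  constructor
  · refine hi.integral_prod_left.congr (Eventually.of_forall fun l => ?_)
    simp only
    rw [integral_const_mul]
  · have h := integral_integral_swap (f := fun l t => Real.exp (-(l * ε)) * (K l t * φ t)) hi
    calc _ = ∫ t in Ioi 1, ∫ l in Ioi 0, Real.exp (-(l * ε)) * (K l t * φ t) := by
          refine integral_congr_ae (Eventually.of_forall fun t => ?_)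
          simp only
          rw [← integral_mul_const]
          simp only [mul_assoc]
      _ = _ := by
          rw [← h]
          refine integral_congr_ae (Eventually.of_forall fun l => ?_)
          simp only
          rw [integral_const_mul]

theorem transformInt_eq {d ε : ℝ} (hd : 1 < d) (hε : 0 < ε) {φ ψ : ℝ → ℝ} (hφ : IsBddCompact φ)
    (hψ : IsBddCompact ψ) {r : ℝ} (hr : 1 ≤ r) :
    transformInt d ε φ ψ r = ∫ l in Ioi 0, Real.exp (-(l * ε)) * kernelOp d l φ ψ r := by
  obtain ⟨i1, h1⟩ := integral_integral_kernel hε (K := fun l t => sameKernel d l r t)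
    ((measurable_sameKernel d).comp (g := fun x : ℝ × ℝ × ℝ => sameKernel d x.1 x.2.1 x.2.2)
      (f := fun x : ℝ × ℝ => (x.1, r, x.2)) (by fun_prop))
    (fun l t hl ht => abs_sameKernel_le hd hl hr ht.le) hφ
  obtain ⟨i2, h2⟩ := integral_integral_kernel hε (K := fun l t => crossKernel d l r t)
    ((measurable_crossKernel d).comp (g := fun x : ℝ × ℝ × ℝ => crossKernel d x.1 x.2.1 x.2.2)
      (f := fun x : ℝ × ℝ => (x.1, r, x.2)) (by fun_prop))
    (fun l t hl ht => abs_crossKernel_le hd hl hr ht.le) hψ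
  simp only [transformInt, sameInt, crossInt, kernelOp, mul_add]
  rw [h1, h2, integral_add i1 i2]

/-- A Bochner integral in `L²` is computed pointwise. -/
theorem coeFn_integral {d : ℝ} {Φ : ℝ → L2 d} {G : ℝ → ℝ → ℝ} {b : ℝ → ℝ}
    (hΦ : IntegrableOn Φ (Ioi 0)) (hG : Measurable (Function.uncurry G)) (hbm : Measurable b)
    (hb : IntegrableOn b (Ioi 0)) (hGb : ∀ l, 0 < l → ∀ᵐ r ∂(mu d), |G l r| ≤ b l)
    (h : ∀ l, 0 < l → Φ l =ᵐ[mu d] G l) :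
    (∫ l in Ioi 0, Φ l : L2 d) =ᵐ[mu d] fun r => ∫ l in Ioi 0, G l r := by
  have hi : ∀ s, MeasurableSet s → mu d s < ⊤ → Integrable (fun x : ℝ × ℝ => G x.1 x.2)
      ((volume.restrict (Ioi 0)).prod ((mu d).restrict s)) := by
    intro s hs hfin
    have : IsFiniteMeasure ((mu d).restrict s) := ⟨by simpa using hfin⟩
    refine Integrable.mono' (Integrable.mul_prod hb (integrable_const (1:ℝ)))
      hG.aestronglyMeasurable ?_
    rw [Measure.ae_prod_iff_ae_ae]
    · filter_upwards [ae_restrict_mem measurableSet_Ioi] with l hl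
      filter_upwards [ae_restrict_of_ae (hGb l hl)] with r hr
      simpa using hr
    · exact measurableSet_le hG.norm ((hbm.comp measurable_fst).mul_const 1)
  -- Both sides are integrated over sets of finite measure: for the vector integral this is an inner
  -- product with an indicator, which passes under the Bochner integral; for the pointwise integral
  -- it is Fubini.
  refine ae_eq_of_forall_setIntegral_eq_of_sigmaFinite (fun s hs hfin => ?_)
    (fun s hs hfin => ?_) fun s hs hfin => ?_
  · have : IsFiniteMeasure ((mu d).restrict s) := ⟨by simpa using hfin⟩
    exact ((Lp.memLp (∫ l in Ioi 0, Φ l : L2 d)).restrict s).integrable (by norm_num)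
  · exact (hi s hs hfin).integral_prod_right
  · have h1 := L2.inner_indicatorConstLp_one (𝕜 := ℝ) hs hfin.ne (∫ l in Ioi 0, Φ l : L2 d)
    rw [← h1, ← integral_inner hΦ]
    have h2 := integral_integral_swap (f := G) (hi s hs hfin)
    rw [← h2]
    refine setIntegral_congr_fun measurableSet_Ioi fun l hl => ?_
    rw [L2.inner_indicatorConstLp_one]
    exact integral_congr_ae (ae_restrict_of_ae (h l hl))

/-! ### Regularization and passage to the limit -/

/-- The regularization `∫ e^(-lε) Δ (Δ + l²)⁻¹ u dl`. -/
def regularized (d ε : ℝ) (u : L2 d) : L2 d :=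
  ∫ l in Ioi (0:ℝ), Real.exp (-(l * ε)) • sqrtIntegrand d u l

section

variable {d : ℝ}

theorem integrableOn_regularized {u : L2 d} (hu : SqrtConverges d u) {ε : ℝ} (hε : 0 < ε) :
    IntegrableOn (fun l => Real.exp (-(l * ε)) • sqrtIntegrand d u l) (Ioi 0) := by
  refine Integrable.mono hu ?_ ?_
  · have hc : Continuous fun l : ℝ => Real.exp (-(l * ε)) := by fun_prop
    exact hc.aestronglyMeasurable.smul hu.1
  · filter_upwards [ae_restrict_mem measurableSet_Ioi] with l hl
    have hl0 : 0 < l := hl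
    rw [norm_smul, Real.norm_of_nonneg (Real.exp_pos _).le]
    refine mul_le_of_le_one_left (norm_nonneg _) ?_
    rw [Real.exp_le_one_iff]; nlinarith

theorem tendsto_regularized {u : L2 d} (hu : SqrtConverges d u) :
    Tendsto (fun n : ℕ => regularized d (1 / ((n:ℝ) + 1)) u) atTop
      (𝓝 (∫ l in Ioi (0:ℝ), sqrtIntegrand d u l)) := by
  refine tendsto_integral_of_dominated_convergence (fun l => ‖sqrtIntegrand d u l‖)
    (fun n => (integrableOn_regularized hu (by positivity)).1) hu.norm (fun n => ?_) ?_
  · filter_upwards [ae_restrict_mem measurableSet_Ioi] with l hl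
    have hl0 : 0 < l := hl
    rw [norm_smul, Real.norm_of_nonneg (Real.exp_pos _).le]
    refine mul_le_of_le_one_left (norm_nonneg _) ?_
    rw [Real.exp_le_one_iff]
    have : 0 < l * (1 / ((n:ℝ) + 1)) := by positivity
    linarith
  · refine Eventually.of_forall fun l => ?_
    have h1 : Tendsto (fun n : ℕ => Real.exp (-(l * (1 / ((n:ℝ) + 1))))) atTop (𝓝 1) := by
      have h2 : Tendsto (fun n : ℕ => -(l * (1 / ((n:ℝ) + 1)))) atTop (𝓝 (-(l * 0))) :=
        (tendsto_one_div_add_atTop_nhds_zero_nat.const_mul l).neg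
      have h3 := (Real.continuous_exp.tendsto _).comp h2
      simp only [mul_zero, neg_zero, Real.exp_zero] at h3
      exact h3
    simpa using h1.smul_const (sqrtIntegrand d u l)

theorem regularized_eq (hd : 1 < d) {f : ℝ → ℝ} (hf : IsS0 f) {M : ℝ} (hM : 1 ≤ M)
    (h0 : ∀ t, M ≤ t → rightDeriv f t = 0 ∧ leftDeriv f t = 0) {ε : ℝ} (hε : 0 < ε) :
    regularized d ε (hf.toIsTest.toL2 d) =ᵐ[mu d] join
      (transformInt d ε ((Ioi 1).indicator (rightDeriv f)) ((Ioi 1).indicator (leftDeriv f)))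
      (transformInt d ε ((Ioi 1).indicator (leftDeriv f)) ((Ioi 1).indicator (rightDeriv f))) := by
  have bφ := isBddCompact_indicator hf.toIsTest.continuous_rightDeriv fun t ht => (h0 t ht).1
  have bψ := isBddCompact_indicator hf.toIsTest.continuous_leftDeriv fun t ht => (h0 t ht).2
  set φ := (Ioi 1).indicator (rightDeriv f) with hφ
  set ψ := (Ioi 1).indicator (leftDeriv f) with hψ
  set B := (∫ t in Ioi 1, |φ t|) + ∫ t in Ioi 1, |ψ t| with hB
  have key := coeFn_integral (d := d)
    (Φ := fun l => Real.exp (-(l * ε)) • sqrtIntegrand d (hf.toIsTest.toL2 d) l)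
    (G := fun l r => Real.exp (-(l * ε)) * join (kernelOp d l φ ψ) (kernelOp d l ψ φ) r)
    (b := fun l => Real.exp (-(l * ε)) * B)
    (integrableOn_regularized hf.toIsTest.sqrtConverges hε) ?_ (by fun_prop)
    ((integrableOn_exp_neg_mul hε).mul_const B) ?_ ?_
  · refine key.trans ?_
    change ∀ᵐ r ∂(mu d), _
    rw [ae_mu_iff]
    constructor
    · filter_upwards [ae_half_mem d] with r hr
      have hr0 : 0 < r := lt_trans one_pos hr
      rw [join_of_pos _ _ hr0, transformInt_eq hd hε bφ bψ (le_of_lt hr)]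
      simp only [join_of_pos _ _ hr0]
    · filter_upwards [ae_half_mem d] with r hr
      have hr0 : 0 < r := lt_trans one_pos hr
      rw [join_neg _ _ hr0, transformInt_eq hd hε bψ bφ (le_of_lt hr)]
      simp only [join_neg _ _ hr0]
  · refine Measurable.mul (by fun_prop) ?_
    refine Measurable.ite (measurableSet_lt measurable_const measurable_snd)
      (measurable_kernelOp d bφ.measurable bψ.measurable) ?_
    exact (measurable_kernelOp d bψ.measurable bφ.measurable).comp
      (f := fun x : ℝ × ℝ => (x.1, -x.2)) (by fun_prop)
  · intro l hl
    rw [ae_mu_iff]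
    constructor
    · filter_upwards [ae_half_mem d] with r hr
      rw [join_of_pos _ _ (lt_trans one_pos hr), abs_mul, abs_of_pos (Real.exp_pos _)]
      exact mul_le_mul_of_nonneg_left (abs_kernelOp_le hd hl (le_of_lt hr) bφ bψ)
        (Real.exp_pos _).le
    · filter_upwards [ae_half_mem d] with r hr
      rw [join_neg _ _ (lt_trans one_pos hr), abs_mul, abs_of_pos (Real.exp_pos _), hB, add_comm]
      exact mul_le_mul_of_nonneg_left (abs_kernelOp_le hd hl (le_of_lt hr) bψ bφ)
        (Real.exp_pos _).le
  · intro l hl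
    refine (Lp.coeFn_smul _ _).trans ?_
    have h1 := sqrtIntegrand_eq hd hl hf hM h0
    change ∀ᵐ r ∂(mu d), _ at h1
    change ∀ᵐ r ∂(mu d), _
    rw [ae_mu_iff] at h1 ⊢
    constructor
    · filter_upwards [ae_half_mem d, h1.1] with r hr h2
      have hr0 : 0 < r := lt_trans one_pos hr
      rw [Pi.smul_apply, h2, smul_eq_mul, join_of_pos _ _ hr0, join_of_pos _ _ hr0, hφ, hψ,
        kernelOp_indicator, valueOp_eq_kernelOp hd hl hf.toIsTest.continuous_rightDeriv
          (fun t ht => (h0 t ht).1) (fun t ht => (h0 t ht).2) hr]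
    · filter_upwards [ae_half_mem d, h1.2] with r hr h2
      have hr0 : 0 < r := lt_trans one_pos hr
      rw [Pi.smul_apply, h2, smul_eq_mul, join_neg _ _ hr0, join_neg _ _ hr0, hφ, hψ,
        kernelOp_indicator, valueOp_eq_kernelOp hd hl hf.toIsTest.continuous_leftDeriv
          (fun t ht => (h0 t ht).2) (fun t ht => (h0 t ht).1) hr]

theorem eLpNorm_regularized_le (hd : 1 < d) {p : ℝ} (hp : 1 < p) (hpd : d < 2 → p ≠ d) :
    ∃ C : ℝ≥0∞, C ≠ ⊤ ∧ ∀ (f : ℝ → ℝ) (hf : IsS0 f) (ε : ℝ), 0 < ε →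
      eLpNorm (regularized d ε (hf.toIsTest.toL2 d)) (ENNReal.ofReal p) (mu d) ≤
        C * eLpNorm (grad f) (ENNReal.ofReal p) (mu d) := by
  have hp0 : 0 < p := by linarith
  obtain ⟨C, hC, h⟩ := halfLine_le hd hp hpd
  -- One C for each half-line, both measured against the total p-th power integral of f'.
  refine ⟨(C + C) ^ (1 / p), ENNReal.rpow_ne_top_of_nonneg (by positivity) (by finiteness),
    fun f hf ε hε => ?_⟩
  obtain ⟨M, hM, h0⟩ := hf.toIsTest.exists_support
  have h0' : ∀ t, M ≤ t → rightDeriv f t = 0 ∧ leftDeriv f t = 0 := fun t ht => (h0 t ht).2.2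
  have bφ := isBddCompact_indicator hf.toIsTest.continuous_rightDeriv fun t ht => (h0' t ht).1
  have bψ := isBddCompact_indicator hf.toIsTest.continuous_leftDeriv fun t ht => (h0' t ht).2
  have e := regularized_eq hd hf hM h0' hε
  -- The integral is f(M) - f(1), and f vanishes at both points; this is the cancellation needed for
  -- p < d.
  have zφ : ∫ t in Ioi 1, (Ioi 1).indicator (rightDeriv f) t = 0 := by
    rw [setIntegral_congr_fun measurableSet_Ioi fun t ht => indicator_of_mem ht _,
      integral_Ioi_eq_of_support (fun t ht => (h0' t ht).1), ← hf.eq_integral hM, (h0 M le_rfl).1]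
  have zψ : ∫ t in Ioi 1, (Ioi 1).indicator (leftDeriv f) t = 0 := by
    rw [setIntegral_congr_fun measurableSet_Ioi fun t ht => indicator_of_mem ht _,
      integral_Ioi_eq_of_support (fun t ht => (h0' t ht).2), ← hf.neg_eq_integral hM,
      (h0 M le_rfl).2.1]
  set φ := (Ioi 1).indicator (rightDeriv f) with hφ
  set ψ := (Ioi 1).indicator (leftDeriv f) with hψ
  have hpt : (ENNReal.ofReal p).toReal = p := ENNReal.toReal_ofReal hp0.le
  have hpz : ENNReal.ofReal p ≠ 0 := by simpa using hp0
  rw [eLpNorm_congr_ae e, eLpNorm_eq_lintegral_rpow_enorm_toReal hpz ENNReal.ofReal_ne_top,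
    eLpNorm_eq_lintegral_rpow_enorm_toReal hpz ENNReal.ofReal_ne_top, hpt,
    ← ENNReal.mul_rpow_of_nonneg _ _ (by positivity)]
  refine ENNReal.rpow_le_rpow ?_ (by positivity)
  rw [lintegral_mu, lintegral_mu, lintegral_half, lintegral_half, lintegral_half, lintegral_half]
  have eφ : ∫⁻ r in Ioi 1, ‖grad f r‖ₑ ^ p * ENNReal.ofReal (r ^ (d - 1)) =
      ∫⁻ r in Ioi 1, ‖φ r‖ₑ ^ p * ENNReal.ofReal (r ^ (d - 1)) := by
    refine setLIntegral_congr_fun measurableSet_Ioi fun r (hr : 1 < r) => ?_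
    rw [hφ, indicator_of_mem (show r ∈ Ioi 1 from hr), rightDeriv, max_eq_left hr.le]
  have eψ : ∫⁻ r in Ioi 1, ‖grad f (-r)‖ₑ ^ p * ENNReal.ofReal (r ^ (d - 1)) =
      ∫⁻ r in Ioi 1, ‖ψ r‖ₑ ^ p * ENNReal.ofReal (r ^ (d - 1)) := by
    refine setLIntegral_congr_fun measurableSet_Ioi fun r (hr : 1 < r) => ?_
    rw [hψ, indicator_of_mem (show r ∈ Ioi 1 from hr), leftDeriv, max_eq_left hr.le, enorm_neg]
  have e₁ : ∫⁻ r in Ioi 1, ‖join (transformInt d ε φ ψ) (transformInt d ε ψ φ) r‖ₑ ^ p *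
      ENNReal.ofReal (r ^ (d - 1)) =
      ∫⁻ r in Ioi 1, ‖transformInt d ε φ ψ r‖ₑ ^ p * ENNReal.ofReal (r ^ (d - 1)) := by
    refine setLIntegral_congr_fun measurableSet_Ioi fun r (hr : 1 < r) => ?_
    rw [join_of_pos _ _ (by linarith)]
  have e₂ : ∫⁻ r in Ioi 1, ‖join (transformInt d ε φ ψ) (transformInt d ε ψ φ) (-r)‖ₑ ^ p *
      ENNReal.ofReal (r ^ (d - 1)) =
      ∫⁻ r in Ioi 1, ‖transformInt d ε ψ φ r‖ₑ ^ p * ENNReal.ofReal (r ^ (d - 1)) := by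
    refine setLIntegral_congr_fun measurableSet_Ioi fun r (hr : 1 < r) => ?_
    rw [join_neg _ _ (by linarith)]
  rw [eφ, eψ, e₁, e₂, add_mul]
  refine add_le_add (h ε hε φ ψ bφ bψ zφ zψ) ?_
  rw [add_comm (∫⁻ r in Ioi 1, ‖φ r‖ₑ ^ p * ENNReal.ofReal (r ^ (d - 1)))]
  exact h ε hε ψ φ bψ bφ zψ zφ

/-- Fatou's lemma along an almost everywhere convergent subsequence: the L² limit inherits a uniform
bound in another exponent. -/
theorem eLpNorm_le_of_tendsto {h : ℕ → L2 d} {g : L2 d} (hg : Tendsto h atTop (𝓝 g)) {q B : ℝ≥0∞}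
    (hB : ∀ n, eLpNorm (h n) q (mu d) ≤ B) : eLpNorm g q (mu d) ≤ B := by
  obtain ⟨ns, -, hae⟩ := (tendstoInMeasure_of_tendsto_Lp hg).exists_seq_tendsto_ae
  refine (Lp.eLpNorm_lim_le_liminf_eLpNorm (f := fun n => h (ns n))
    (fun n => Lp.aestronglyMeasurable _) g hae).trans ?_
  refine liminf_le_of_le (by isBoundedDefault) fun b hb => ?_
  obtain ⟨n, hn⟩ := hb.exists
  exact hn.trans (hB _)

end

end BrokenLine

end

theorem mainTheorem3 (d : ℝ) (hd : 1 < d) (p : ℝ) (hp : 1 < p) (hpd : d < 2 → p ≠ d) :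
    ∃ C : NNReal, ∀ (f : ℝ → ℝ) (hf : BrokenLine.IsS0 f),
      BrokenLine.SqrtConverges d (hf.toIsTest.toL2 d) ∧
      MeasureTheory.eLpNorm (BrokenLine.sqrtLaplacian d (hf.toIsTest.toL2 d))
          (ENNReal.ofReal p) (BrokenLine.mu d) ≤
        C * MeasureTheory.eLpNorm (BrokenLine.grad f) (ENNReal.ofReal p) (BrokenLine.mu d) := by
  obtain ⟨C, hC, h⟩ := BrokenLine.eLpNorm_regularized_le hd hp hpd
  refine ⟨‖(2 / Real.pi : ℝ)‖₊ * C.toNNReal, fun f hf => ?_⟩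
  have hconv : BrokenLine.SqrtConverges d (hf.toIsTest.toL2 d) := hf.toIsTest.sqrtConverges
  refine ⟨hconv, ?_⟩
  -- The bounds do not depend on ε = 1/(n+1), so they survive the limit; the factor 2/π comes from
  -- the resolvent formula.
  have key := BrokenLine.eLpNorm_le_of_tendsto (BrokenLine.tendsto_regularized hconv)
    fun n => h f hf (1 / ((n : ℝ) + 1)) (by positivity)
  rw [BrokenLine.sqrtLaplacian, eLpNorm_congr_ae (Lp.coeFn_smul _ _), eLpNorm_const_smul,
    ENNReal.coe_mul, ENNReal.coe_toNNReal hC, mul_assoc]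
  exact mul_le_mul_right key _
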